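/- **Setting.** Let $L>0$ and let $\gamma:[0,L]\to\mathbb R^3$ be a simple curve of class $C^2$ parametrized by arc length, with a frame $R_0\in C^1([0,L];\mathbb M^{3\times3})$ such that $R_0(s)\in SO(3)$ and $R_0(s)e_1=\gamma'(s)$ for all $s\in[0,L]$; put $\nu_k=R_0e_k$ for $k=2,3$. Let $D\subset\mathbb R^2$ be a bounded, open, connected set with Lipschitz boundary, $\mathcal L^2(D)=1$ and $\int_D\xi\zeta\,d\xi\,d\zeta=\int_D\xi\,d\xi\,d\zeta=\int_D\zeta\,d\xi\,d\zeta=0$. Put $\Omega=(0,L)\times D$ and, for $h>0$ and $(s,\xi,\zeta)\in\Omega$, $$\Psi^{(h)}(s,\xi,\zeta)=\gamma(s)+h\,\xi\,\nu_2(s)+h\,\zeta\,\nu_3(s),\qquad \nabla_h z=\Big(\partial_s z\,\Big|\,\tfrac1h\partial_\xi z\,\Big|\,\tfrac1h\partial_\zeta z\Big).$$ Matrices carry the Euclidean (Frobenius) norm $|\cdot|$ and $\operatorname{dist}$ is the corresponding distance. Let $W:(0,L)\times\mathbb M^{3\times3}\to[0,+\infty]$ be a Carathéodory function (measurable in $s$,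 and continuous in $F$ for a.e. $s$) such that 1. there is $\delta>0$ such that, for a.e. $s$, $F\mapsto W(s,F)$ is finite and of class $C^2$ on $\{F:\operatorname{dist}(F,SO(3))<\delta\}$; on this set $\partial^2W/\partial F^2$ is a Carathéodory function, and for some $C_1>0$ one has $\big|\frac{\partial^2W}{\partial F^2}(s,F)[G,G]\big|\le C_1|G|^2$ for a.e. $s$, all $F$ in this set and all symmetric $G$; 2. $W(s,RF)=W(s,F)$ for a.e. $s$, all $F$ and all $R\in SO(3)$; 3. $W(s,R)=0$ for a.e. $s$ and all $R\in SO(3)$; 4. there are $C_2,C_3>0$ with $C_2\operatorname{dist}^2(F,SO(3))\le W(s,F)\le C_3\operatorname{dist}^2(F,SO(3))$ for a.e. $s$ and all $F$. For $v\in L^2(\Omega;\mathbb R^3)$ let $$J^{(h)}(v)=\int_\Omega W\big(s,\nabla_hv\,(\nabla_h\Psi^{(h)})^{-1}\big)\det(\nabla_h\Psi^{(h)})\,ds\,d\xi\,d\zeta\quad\text{if }v\in W^{1,2}(\Omega;\mathbb R^3),$$ and $J^{(h)}(v)=+\infty$ otherwise. (For $h$ small, $\nabla_h\Psi^{(h)}$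 is invertible with positive determinant on $\Omega$; only small $h$ matters below.) Let $$\mathcal W_1=\{v\in W^{1,2}((0,L);\mathbb R^3):|v'(s)|\le1\text{ for a.e. }s\},$$ regarded as a subset of $L^2(\Omega;\mathbb R^3)$ consisting of functions of $s$ alone. **Theorem (Compactness and $\Gamma$-convergence, intermediate scaling).** Let $0<\alpha<2$. (a) Let $h_j>0$, $h_j\to0$, and let $v_j\in L^2(\Omega;\mathbb R^3)$ satisfy $h_j^{-\alpha}J^{(h_j)}(v_j)\le c<+\infty$ for all $j$. Then there are $v\in\mathcal W_1$ and constants $c_j\in\mathbb R^3$ such that, along a subsequence, $v_j-c_j\rightharpoonup v$ weakly in $W^{1,2}(\Omega;\mathbb R^3)$. (b) As $h\to0^+$, the functionals $h^{-\alpha}J^{(h)}$ $\Gamma$-converge, with respect to the strong topology of $L^2(\Omega;\mathbb R^3)$, to the functional $I$ that equals $0$ on $\mathcal W_1$ and $+\infty$ elsewhere in $L^2(\Omega;\mathbb R^3)$. That is, $I(v)\le\liminf_{h\to0^+}h^{-\alpha}J^{(h)}(v^{(h)})$ whenever $v^{(h)}\to v$ strongly in $L^2(\Omega;\mathbb R^3)$,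 and every $v\in L^2(\Omega;\mathbb R^3)$ admits a family $v^{(h)}\to v$ strongly in $L^2(\Omega;\mathbb R^3)$ with $\limsup_{h\to0^+}h^{-\alpha}J^{(h)}(v^{(h)})\le I(v)$. -/

import Mathlib

open MeasureTheory Set Filter Topology
open scoped ENNReal NNReal ContDiff

attribute [local instance] Matrix.frobeniusNormedAddCommGroup Matrix.frobeniusNormedSpace

noncomputable section

namespace CurvedRod

/-- Euclidean space `ℝ³`. A point of the reference cylinder is `z = (s, ξ, ζ) = (z 0, z 1, z 2)`. -/
abbrev R3 : Type := EuclideanSpace ℝ (Fin 3)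

/-- Euclidean plane `ℝ²`, which contains the cross section. -/
abbrev R2 : Type := EuclideanSpace ℝ (Fin 2)

/-- Real `3 × 3` matrices, with the Euclidean (Frobenius) norm. -/
abbrev M3 : Type := Matrix (Fin 3) (Fin 3) ℝ

/-- The rotation group `SO(3)` as a set of matrices. -/
def SO3 : Set M3 := {R | R.transpose * R = 1 ∧ R.det = 1}

/-- The `k`-th column of the frame `R₀`, as a vector field along the curve (so `k = 0` is the
tangent and `k = 1, 2` are the two normal fields `ν₂, ν₃`). -/
def frameVec (R₀ : ℝ → M3) (k : Fin 3) (s : ℝ) : R3 := WithLp.toLp 2 fun i => R₀ s i k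

/-- `γ : [0, L] → ℝ³` is a simple curve of class `C²` parametrized by arc length, and `R₀` is a
`C¹` orthonormal frame along it whose first vector is the unit tangent.  Injectivity is only asked
on `[0, L)`, so that simple closed curves are included. -/
structure IsFramedCurve (L : ℝ) (γ : ℝ → R3) (R₀ : ℝ → M3) : Prop where
  contDiff_curve : ContDiffOn ℝ 2 γ (Icc 0 L)
  simple : InjOn γ (Ico 0 L)
  arcLength : ∀ s ∈ Icc 0 L, ‖derivWithin γ (Icc 0 L) s‖ = 1
  contDiff_frame : ContDiffOn ℝ 1 R₀ (Icc 0 L)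
  frame_mem : ∀ s ∈ Icc 0 L, R₀ s ∈ SO3
  frame_tangent : ∀ s ∈ Icc 0 L, frameVec R₀ 0 s = derivWithin γ (Icc 0 L) s

/-- Lipschitz boundary: near each boundary point, in suitable orthonormal coordinates, the set is
the region strictly above the graph of a Lipschitz function. -/
def HasLipschitzBoundary (D : Set R2) : Prop :=
  ∀ p ∈ frontier D, ∃ (T : R2 ≃ₗᵢ[ℝ] R2) (K : ℝ≥0) (f : ℝ → ℝ) (r : ℝ),
    LipschitzWith K f ∧ 0 < r ∧ ∀ x ∈ Metric.ball p r, x ∈ D ↔ f (T x 0) < T x 1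

/-- The assumptions on the cross section `D` of the beam. -/
structure IsCrossSection (D : Set R2) : Prop where
  isOpen : IsOpen D
  bounded : Bornology.IsBounded D
  connected : IsConnected D
  lipschitz : HasLipschitzBoundary D
  area : volume D = 1
  moment_mixed : ∫ x in D, x 0 * x 1 = 0
  moment_fst : ∫ x in D, x 0 = 0
  moment_snd : ∫ x in D, x 1 = 0

/-- The reference cylinder `Ω = (0, L) × D`. -/
def cyl (L : ℝ) (D : Set R2) : Set R3 := {z | z 0 ∈ Ioo 0 L ∧ !₂[z 1, z 2] ∈ D}

/-- The assumptions on the stored energy density `W(s, F) ∈ [0, +∞]`.  Measurability in `s` is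
Lebesgue measurability on `(0, L)`. -/
structure IsEnergyDensity (L : ℝ) (W : ℝ → M3 → ℝ≥0∞) : Prop where
  measurable : ∀ F, AEMeasurable (fun s => W s F) (volume.restrict (Ioo 0 L))
  continuous : ∀ᵐ s ∂volume.restrict (Ioo 0 L), Continuous (W s)
  /-- `W(s, ·)` is (finite and) of class `C²` near `SO(3)`, its second derivative is a
  Carathéodory function there, and it is bounded on symmetric matrices. -/
  regular : ∃ δ > 0, ∃ C₁ > 0,
    (∀ᵐ s ∂volume.restrict (Ioo 0 L),
      (∀ F, Metric.infDist F SO3 < δ → W s F ≠ ⊤) ∧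
      ContDiffOn ℝ 2 (fun F => (W s F).toReal) {F | Metric.infDist F SO3 < δ}) ∧
    (∀ F, Metric.infDist F SO3 < δ → ∀ G : Fin 2 → M3,
      AEMeasurable (fun s => iteratedFDeriv ℝ 2 (fun F' => (W s F').toReal) F G)
        (volume.restrict (Ioo 0 L))) ∧
    (∀ᵐ s ∂volume.restrict (Ioo 0 L),
      ContinuousOn (fun F => iteratedFDeriv ℝ 2 (fun F' => (W s F').toReal) F)
        {F | Metric.infDist F SO3 < δ}) ∧
    (∀ᵐ s ∂volume.restrict (Ioo 0 L), ∀ F, Metric.infDist F SO3 < δ → ∀ G : M3, G.IsSymm →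
      |iteratedFDeriv ℝ 2 (fun F' => (W s F').toReal) F ![G, G]| ≤ C₁ * ‖G‖ ^ 2)
  frameIndifferent : ∀ᵐ s ∂volume.restrict (Ioo 0 L), ∀ F, ∀ R ∈ SO3, W s (R * F) = W s F
  zero_on_rotations : ∀ᵐ s ∂volume.restrict (Ioo 0 L), ∀ R ∈ SO3, W s R = 0
  coercive : ∃ C₂ > 0, ∀ᵐ s ∂volume.restrict (Ioo 0 L), ∀ F,
    ENNReal.ofReal (C₂ * Metric.infDist F SO3 ^ 2) ≤ W s F
  growth : ∃ C₃ > 0, ∀ᵐ s ∂volume.restrict (Ioo 0 L), ∀ F,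
    W s F ≤ ENNReal.ofReal (C₃ * Metric.infDist F SO3 ^ 2)

/-! ### Sobolev spaces -/

/-- `g` is the weak derivative of `u` on `Ω` in the direction `e` (used for `u, g ∈ L²(Ω; ℝ³)`). -/
def HasWeakDeriv {X : Type*} [NormedAddCommGroup X] [NormedSpace ℝ X] [MeasureSpace X]
    (Ω : Set X) (e : X) (u g : X → R3) : Prop :=
  ∀ φ : X → ℝ, ContDiff ℝ ∞ φ → HasCompactSupport φ → tsupport φ ⊆ Ω →
    ∫ x in Ω, (fderiv ℝ φ x e) • u x = -∫ x in Ω, φ x • g x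

/-- `L²(Ω; ℝ³)`. -/
abbrev L2 (Ω : Set R3) : Type := Lp R3 2 (volume.restrict Ω)

theorem integrable_smul_L2 {Ω : Set R3} {φ : R3 → ℝ} (hφ : Continuous φ)
    (hc : HasCompactSupport φ) (u : L2 Ω) :
    Integrable (fun x => φ x • u x) (volume.restrict Ω) := by
  have h1 : MemLp φ 2 (volume.restrict Ω) := hφ.memLp_of_hasCompactSupport hc
  exact memLp_one_iff_integrable.1 ((Lp.memLp u).smul h1)

/-- The Hilbert space `W^{1,2}(Ω; ℝ³)`: the `L²` functions (first component) together with their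
`L²` weak partial derivatives (second component), with the norm
`(‖u‖² + ∑ i, ‖∂ᵢ u‖²)^{1/2}`. -/
def W12 (Ω : Set R3) : Submodule ℝ (WithLp 2 (L2 Ω × PiLp 2 fun _ : Fin 3 => L2 Ω)) where
  carrier := {U | ∀ i, HasWeakDeriv Ω (EuclideanSpace.single i 1) U.fst (U.snd i)}
  zero_mem' := by
    intro i φ hφ hc _
    have h0 : ((0 : L2 Ω) : R3 → R3) =ᵐ[volume.restrict Ω] 0 := Lp.coeFn_zero _ _ _
    have e1 : ∫ x in Ω, (fderiv ℝ φ x (EuclideanSpace.single i 1)) • (0 : L2 Ω) x = 0 :=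
      integral_eq_zero_of_ae (by filter_upwards [h0] with x hx; rw [hx]; simp)
    have e2 : ∫ x in Ω, φ x • (0 : L2 Ω) x = 0 :=
      integral_eq_zero_of_ae (by filter_upwards [h0] with x hx; rw [hx]; simp)
    change ∫ x in Ω, (fderiv ℝ φ x (EuclideanSpace.single i 1)) • (0 : L2 Ω) x
      = -∫ x in Ω, φ x • (0 : L2 Ω) x
    rw [e1, e2, neg_zero]
  add_mem' := by
    intro U V hU hV i φ hφ hc hs
    have hd : Continuous fun x => fderiv ℝ φ x (EuclideanSpace.single i 1) :=
      (hφ.continuous_fderiv (by simp)).clm_apply continuous_const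
    have hdc : HasCompactSupport fun x => fderiv ℝ φ x (EuclideanSpace.single i 1) :=
      hc.fderiv_apply ℝ _
    have key : ∀ (ψ : R3 → ℝ), Continuous ψ → HasCompactSupport ψ → ∀ u v : L2 Ω,
        ∫ x in Ω, ψ x • (u + v : L2 Ω) x
          = (∫ x in Ω, ψ x • u x) + ∫ x in Ω, ψ x • v x := by
      intro ψ h1 h2 u v
      rw [← integral_add (integrable_smul_L2 h1 h2 u) (integrable_smul_L2 h1 h2 v)]
      refine integral_congr_ae ?_
      filter_upwards [Lp.coeFn_add u v] with x hx
      rw [hx, Pi.add_apply, smul_add]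
    have a := hU i φ hφ hc hs
    have b := hV i φ hφ hc hs
    change ∫ x in Ω, (fderiv ℝ φ x (EuclideanSpace.single i 1)) • (U.fst + V.fst : L2 Ω) x
      = -∫ x in Ω, φ x • (U.snd i + V.snd i : L2 Ω) x
    rw [key _ hd hdc, key _ hφ.continuous hc, a, b, neg_add]
  smul_mem' := by
    intro c U hU i φ hφ hc hs
    have key : ∀ (ψ : R3 → ℝ) (u : L2 Ω),
        ∫ x in Ω, ψ x • (c • u : L2 Ω) x = c • ∫ x in Ω, ψ x • u x := by
      intro ψ u
      rw [← integral_smul]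
      refine integral_congr_ae ?_
      filter_upwards [Lp.coeFn_smul c u] with x hx
      rw [hx, Pi.smul_apply]
      exact smul_comm _ _ _
    have a := hU i φ hφ hc hs
    change ∫ x in Ω, (fderiv ℝ φ x (EuclideanSpace.single i 1)) • (c • U.fst : L2 Ω) x
      = -∫ x in Ω, φ x • (c • U.snd i : L2 Ω) x
    rw [key, key, a, smul_neg]

/-- The function underlying an element of `W^{1,2}(Ω; ℝ³)`. -/
def W12.toL2 {Ω : Set R3} (U : W12 Ω) : L2 Ω := U.1.fst

/-- The weak partial derivative `∂ᵢ` of an element of `W^{1,2}(Ω; ℝ³)`. -/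
def W12.partialDeriv {Ω : Set R3} (U : W12 Ω) (i : Fin 3) : L2 Ω := U.1.snd i

/-- Weak convergence of a sequence in `W^{1,2}(Ω; ℝ³)`. -/
def W12.TendstoWeakly {Ω : Set R3} (U : ℕ → W12 Ω) (V : W12 Ω) : Prop :=
  Tendsto (fun j => toWeakSpace ℝ (W12 Ω) (U j)) atTop (𝓝 (toWeakSpace ℝ (W12 Ω) V))

/-- `𝒲₁ = {v ∈ W^{1,2}((0, L); ℝ³) : |v'| ≤ 1 a.e.}`, as a subset of `L²(Ω; ℝ³)`: functions of
the first variable only. -/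
def limitClass (L : ℝ) (D : Set R2) : Set (L2 (cyl L D)) :=
  {u | ∃ v v' : ℝ → R3, MemLp v 2 (volume.restrict (Ioo 0 L)) ∧
    MemLp v' 2 (volume.restrict (Ioo 0 L)) ∧ HasWeakDeriv (Ioo 0 L) 1 v v' ∧
    (∀ᵐ s ∂volume.restrict (Ioo 0 L), ‖v' s‖ ≤ 1) ∧
    u =ᵐ[volume.restrict (cyl L D)] fun z => v (z 0)}

/-! ### The energy -/

/-- `Ψ^{(h)}(s, ξ, ζ) = γ(s) + h ξ ν₂(s) + h ζ ν₃(s)`. -/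
def psi (γ : ℝ → R3) (R₀ : ℝ → M3) (h : ℝ) (z : R3) : R3 :=
  γ (z 0) + (h * z 1) • frameVec R₀ 1 (z 0) + (h * z 2) • frameVec R₀ 2 (z 0)

/-- The matrix `(p₀ | h⁻¹ p₁ | h⁻¹ p₂)`; for `pᵢ = ∂ᵢ v` this is the scaled gradient `∇ₕ v`. -/
def scaledColumns (h : ℝ) (p : Fin 3 → R3) : M3 :=
  Matrix.of fun i j => (![1, h⁻¹, h⁻¹] : Fin 3 → ℝ) j * p j i

/-- `∇ₕ Ψ^{(h)}`. -/
def gradPsi (γ : ℝ → R3) (R₀ : ℝ → M3) (h : ℝ) (z : R3) : M3 :=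
  scaledColumns h fun i => fderiv ℝ (psi γ R₀ h) z (EuclideanSpace.single i 1)

/-- `J̃^{(h)}(v) = ∫_Ω W(s, ∇ₕv (∇ₕΨ^{(h)})⁻¹) det ∇ₕΨ^{(h)}` for `v ∈ W^{1,2}(Ω; ℝ³)`.  For small
`h > 0`, the only relevant ones, `∇ₕΨ^{(h)}` is invertible with positive determinant on `Ω`. -/
def sobolevEnergy (L : ℝ) (D : Set R2) (γ : ℝ → R3) (R₀ : ℝ → M3) (W : ℝ → M3 → ℝ≥0∞)
    (h : ℝ) (U : W12 (cyl L D)) : ℝ≥0∞ :=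
  ∫⁻ z in cyl L D,
    W (z 0) (scaledColumns h (fun i => W12.partialDeriv U i z) * (gradPsi γ R₀ h z)⁻¹)
      * ENNReal.ofReal (gradPsi γ R₀ h z).det

/-- `J^{(h)}` on `L²(Ω; ℝ³)`: it is `J̃^{(h)}(v)` if `v ∈ W^{1,2}(Ω; ℝ³)` and `+∞` otherwise.
The infimum runs over the representations of `v` as an element of `W^{1,2}`, of which there is
exactly one if `v ∈ W^{1,2}` and none otherwise. -/
def energy (L : ℝ) (D : Set R2) (γ : ℝ → R3) (R₀ : ℝ → M3) (W : ℝ → M3 → ℝ≥0∞)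
    (h : ℝ) (v : L2 (cyl L D)) : ℝ≥0∞ :=
  ⨅ (U : W12 (cyl L D)) (_ : W12.toL2 U = v), sobolevEnergy L D γ R₀ W h U

/-- The scaled energy `h^{-α} J^{(h)}`. -/
def scaledEnergy (L : ℝ) (D : Set R2) (γ : ℝ → R3) (R₀ : ℝ → M3) (W : ℝ → M3 → ℝ≥0∞)
    (α h : ℝ) (v : L2 (cyl L D)) : ℝ≥0∞ :=
  energy L D γ R₀ W h v / ENNReal.ofReal (h ^ α)

open Classical in
/-- The functional equal to `0` on `𝒲₁` and to `+∞` elsewhere in `L²(Ω; ℝ³)`. -/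
def limitEnergy (L : ℝ) (D : Set R2) (v : L2 (cyl L D)) : ℝ≥0∞ :=
  if v ∈ limitClass L D then 0 else ⊤

/-- `Γ`-convergence along a filter `l`, in the sense of the liminf inequality for every
convergent family and the existence of a recovery family. -/
def GammaTendsto {ι X : Type*} [TopologicalSpace X] (l : Filter ι) (F : ι → X → ℝ≥0∞)
    (F₀ : X → ℝ≥0∞) : Prop :=
  (∀ (x : X) (u : ι → X), Tendsto u l (𝓝 x) → F₀ x ≤ liminf (fun i => F i (u i)) l) ∧
  (∀ x : X, ∃ u : ι → X, Tendsto u l (𝓝 x) ∧ limsup (fun i => F i (u i)) l ≤ F₀ x)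

end CurvedRod

end

namespace CurvedRod

/-! ### Oscillation kernels and an abstract Poincaré inequality -/

section Kernel

variable {X : Type*} [NormedAddCommGroup X] [NormedSpace ℝ X] [FiniteDimensional ℝ X]
  [MeasureSpace X] [BorelSpace X] [(volume : Measure X).IsAddHaarMeasure]

/-! Lower bound and compactness. Since `gradPsi` stays within `O(h)` of the rotation `R₀`, an energy
of order `h ^ α` makes the `L²` distance of `∇ₕv (∇ₕΨ)⁻¹` from `SO3` of order at most `h ^ (α / 2)`.
Read column by column, this says that the cross-sectional derivatives are `O(h)` in `L²`, that `∂ₛv`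
is bounded there, and that the positive part of `|∂ₛv| - 1` tends to zero in `L²`
(`exists_energy_bounds`). After a constant is subtracted, the Poincaré inequality `exists_poincare`
bounds the sequence in `W^{1,2}`, and a subsequence converges weakly. The limit has no
cross-sectional derivatives, so it depends on `s` alone, and a duality argument
(`norm_le_one_of_weak_limit`) shows that its derivative has length at most one. This core is
`exists_weak_limit`, and it needs only `0 < α`. The liminf inequality is the same argument along a
sequence of bounded energy, where strong convergence takes the place of the Poincaré inequality.

The Poincaré inequality comes from translations: for a weakly differentiable `u`, the difference `u
(x + w) - u x` is controlled by the gradient as long as the segment stays in the domain. This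
settles balls. Chains of balls join interior points, small inward shifts treat the points near a
Lipschitz boundary (`oscBounded_self`), and a two-leg path handles the product `(0, L) × D`.

Upper bound. A curve with `|v'| ≤ 1` is a uniform limit of smooth curves `w` with `|w'| = 1`: on
short intervals the mean of `v'` is the midpoint of two unit vectors, and a tangent alternating
between them has nearly the same primitive (`exists_direction_step`). Smoothing is done on the
spherical angles of the tangent, which keeps its length equal to one and supplies a smooth frame as
well (`exists_smooth_direction`, `angleFrame`). The rod `psi w R h` built on such a curve has scaled
gradient within `O(h)` of a rotation, hence energy `O(h²)`, which is negligible against `h ^ α`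
because `α < 2` (`exists_energy_upper_bound`). The recovery family is then selected by nearly
minimizing distance plus energy (`exists_recovery_of_approximate`). -/

/-- A kernel `N x y` that behaves like `|u x - u y|²`, where `E` is the Dirichlet energy of `u`
on `D`. -/
structure IsOscKernel (D : Set X) (N : X → X → ℝ≥0∞) (E : ℝ≥0∞) : Prop where
  measurable : Measurable (Function.uncurry N)
  symm : ∀ x y, N x y = N y x
  triangle : ∀ x y z, N x z ≤ 2 * (N x y + N y z)
  shift : ∀ (A : Set X) (w : X), IsOpen A → (∀ x ∈ A, ∀ t ∈ Icc (0 : ℝ) 1, x + t • w ∈ D) →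
    ∫⁻ x in A, N x (x + w) ≤ ‖w‖ₑ ^ 2 * E

/-- The mean oscillation between `A` and `B` is controlled by the energy on `D`. -/
def OscBounded (D A B : Set X) : Prop :=
  ∃ C : ℝ≥0, ∀ (N : X → X → ℝ≥0∞) (E : ℝ≥0∞), IsOscKernel D N E →
    ∫⁻ x in A, ∫⁻ y in B, N x y ≤ C * E

theorem IsOscKernel.measurable_right {D : Set X} {N : X → X → ℝ≥0∞} {E : ℝ≥0∞}
    (h : IsOscKernel D N E) (x : X) : Measurable (N x) :=
  h.measurable.comp measurable_prodMk_left

theorem OscBounded.mono {D A B A' B' : Set X} (h : OscBounded D A B) (hA : A' ⊆ A)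
    (hB : B' ⊆ B) : OscBounded D A' B' := by
  obtain ⟨C, hC⟩ := h
  refine ⟨C, fun N E hN => le_trans ?_ (hC N E hN)⟩
  exact (lintegral_mono fun x => lintegral_mono_set hB).trans (lintegral_mono_set hA)

theorem OscBounded.symm {D A B : Set X} (h : OscBounded D A B) : OscBounded D B A := by
  obtain ⟨C, hC⟩ := h
  refine ⟨C, fun N E hN => le_trans (le_of_eq ?_) (hC N E hN)⟩
  rw [lintegral_lintegral_swap hN.measurable.aemeasurable]
  simp_rw [fun x y => hN.symm x y]

theorem OscBounded.union {D A A' B : Set X} (h : OscBounded D A B) (h' : OscBounded D A' B) :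
    OscBounded D (A ∪ A') B := by
  obtain ⟨C, hC⟩ := h
  obtain ⟨C', hC'⟩ := h'
  refine ⟨C + C', fun N E hN => (lintegral_union_le _ _ _).trans ?_⟩
  rw [ENNReal.coe_add, add_mul]
  exact add_le_add (hC N E hN) (hC' N E hN)

/-- The quasi-triangle inequality is averaged over an intermediate point in `B`, and the volume of
`B`, positive and finite, is divided out. This is what allows bounds to be chained. -/
theorem OscBounded.trans {D A B B' : Set X} (h : OscBounded D A B) (h' : OscBounded D B B')
    (hA : volume A ≠ ⊤) (hB : volume B ≠ 0) (hB' : volume B ≠ ⊤) (hC : volume B' ≠ ⊤) :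
    OscBounded D A B' := by
  obtain ⟨C₁, h₁⟩ := h
  obtain ⟨C₂, h₂⟩ := h'
  refine ⟨((volume B)⁻¹ * (2 * (volume B' * C₁ + volume A * C₂))).toNNReal, fun N E hN => ?_⟩
  rw [ENNReal.coe_toNNReal (by finiteness), mul_assoc, ← ENNReal.mul_le_iff_le_inv hB hB']
  calc volume B * ∫⁻ x in A, ∫⁻ z in B', N x z
      = ∫⁻ x in A, ∫⁻ y in B, ∫⁻ z in B', N x z := by
        simp_rw [setLIntegral_const]
        rw [lintegral_mul_const' _ _ hB', mul_comm]
    _ ≤ ∫⁻ x in A, ∫⁻ y in B, 2 * (N x y * volume B' + ∫⁻ z in B', N y z) := by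
        gcongr with x y
        calc ∫⁻ z in B', N x z ≤ ∫⁻ z in B', 2 * (N x y + N y z) :=
              lintegral_mono fun z => hN.triangle x y z
          _ = _ := by
              rw [lintegral_const_mul' _ _ (by simp), lintegral_add_left measurable_const, setLIntegral_const]
    _ = 2 * ((∫⁻ x in A, ∫⁻ y in B, N x y) * volume B'
          + volume A * ∫⁻ y in B, ∫⁻ z in B', N y z) := by
        simp_rw [lintegral_const_mul' _ _ ENNReal.ofNat_ne_top]
        congr 1
        have e : ∀ x, ∫⁻ y in B, (N x y * volume B' + ∫⁻ z in B', N y z)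
            = (∫⁻ y in B, N x y) * volume B' + ∫⁻ y in B, ∫⁻ z in B', N y z := fun x => by
          rw [lintegral_add_left ((hN.measurable_right x).mul_const _),
            lintegral_mul_const' _ _ hC]
        simp_rw [e]
        rw [lintegral_add_right _ measurable_const, lintegral_mul_const' _ _ hC,
          setLIntegral_const, mul_comm (volume A)]
    _ ≤ 2 * (C₁ * E * volume B' + volume A * (C₂ * E)) := by
        gcongr
        · exact h₁ N E hN
        · exact h₂ N E hN
    _ = _ := by ring

/-- Writing `y = x + w` turns the double integral into an integral over `w` of translation
differences. Convexity keeps the segments in the ball, and only `‖w‖ < 2 * r` contributes. -/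
theorem oscBounded_ball {D : Set X} {p : X} {r : ℝ} (h : Metric.ball p r ⊆ D) :
    OscBounded D (Metric.ball p r) (Metric.ball p r) := by
  set B := Metric.ball p r with hBdef
  refine ⟨(ENNReal.ofReal (2 * r) ^ 2 * volume (Metric.ball (0 : X) (2 * r))).toNNReal,
    fun N E hN => ?_⟩
  rw [ENNReal.coe_toNNReal (by
    have h0 : volume (Metric.ball (0 : X) (2 * r)) ≠ ⊤ := measure_ball_lt_top.ne
    finiteness)]
  have hB : MeasurableSet B := Metric.isOpen_ball.measurableSet
  have hg : Measurable fun q : X × X => B.indicator (1 : X → ℝ≥0∞) q.1 *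
      (B.indicator (1 : X → ℝ≥0∞) (q.1 + q.2) * N q.1 (q.1 + q.2)) := by
    have h1 : Measurable (B.indicator (1 : X → ℝ≥0∞)) := measurable_one.indicator hB
    exact (h1.comp measurable_fst).mul ((h1.comp (measurable_fst.add measurable_snd)).mul
      (hN.measurable.comp (measurable_fst.prodMk (measurable_fst.add measurable_snd))))
  calc ∫⁻ x in B, ∫⁻ y in B, N x y
      = ∫⁻ x, B.indicator (1 : X → ℝ≥0∞) x * ∫⁻ y, B.indicator (1 : X → ℝ≥0∞) y * N x y := by
        rw [← lintegral_indicator hB]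
        refine lintegral_congr fun x => ?_
        by_cases hx : x ∈ B
        · simp only [hx, indicator_of_mem, Pi.one_apply, one_mul]
          rw [← lintegral_indicator hB]
          refine lintegral_congr fun y => ?_
          by_cases hy : y ∈ B <;> simp [hy]
        · simp [hx]
    _ = ∫⁻ x, ∫⁻ w, B.indicator (1 : X → ℝ≥0∞) x *
          (B.indicator (1 : X → ℝ≥0∞) (x + w) * N x (x + w)) := by
        refine lintegral_congr fun x => ?_
        rw [lintegral_const_mul' _ _ (by by_cases hx : x ∈ B <;> simp [hx])]
        rw [lintegral_add_left_eq_self (fun y => B.indicator (1 : X → ℝ≥0∞) y * N x y) x]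
    _ = ∫⁻ w, ∫⁻ x, B.indicator (1 : X → ℝ≥0∞) x *
          (B.indicator (1 : X → ℝ≥0∞) (x + w) * N x (x + w)) :=
        lintegral_lintegral_swap hg.aemeasurable
    _ ≤ ∫⁻ w in Metric.ball (0 : X) (2 * r), ENNReal.ofReal (2 * r) ^ 2 * E := by
        rw [← lintegral_indicator Metric.isOpen_ball.measurableSet]
        refine lintegral_mono fun w => ?_
        set A := B ∩ (fun x => x + w) ⁻¹' B with hA
        have hAo : IsOpen A := Metric.isOpen_ball.inter
          (Metric.isOpen_ball.preimage (continuous_id.add continuous_const))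
        have e : ∀ x, B.indicator (1 : X → ℝ≥0∞) x *
            (B.indicator (1 : X → ℝ≥0∞) (x + w) * N x (x + w))
            = A.indicator (fun x => N x (x + w)) x := by
          intro x
          by_cases h1 : x ∈ B <;> by_cases h2 : x + w ∈ B <;> simp [h1, h2, hA]
        simp_rw [e]
        rw [lintegral_indicator hAo.measurableSet]
        by_cases hw : w ∈ Metric.ball (0 : X) (2 * r)
        · rw [indicator_of_mem hw]
          refine (hN.shift A w hAo ?_).trans ?_
          · rintro x ⟨h1, h2⟩ t ht
            refine h ?_
            have := (convex_ball p r).add_smul_mem h1 (show x + w ∈ _ from h2) ht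
            exact this
          · gcongr
            rw [← ofReal_norm]
            exact ENNReal.ofReal_le_ofReal (by simpa using (Metric.mem_ball.1 hw).le)
        · have : A = ∅ := by
            rw [eq_empty_iff_forall_notMem]
            rintro x ⟨h1, h2⟩
            apply hw
            have h1 := Metric.mem_ball.1 h1
            have h2 := Metric.mem_ball.1 (show x + w ∈ Metric.ball p r from h2)
            rw [mem_ball_zero_iff]
            rw [dist_eq_norm] at h1 h2
            calc ‖w‖ = ‖(x + w - p) - (x - p)‖ := by congr 1; abel
              _ ≤ ‖x + w - p‖ + ‖x - p‖ := norm_sub_le _ _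
              _ < 2 * r := by linarith
          simp [this]
    _ = _ := by rw [setLIntegral_const]; ring

/-- `D` can be pushed into itself near each point of its closure. -/
def HasInwardShifts (D : Set X) : Prop :=
  ∀ p ∈ closure D, ∃ (w : X) (r : ℝ), 0 < r ∧ p + w ∈ D ∧
    ∀ x ∈ Metric.ball p r ∩ D, ∀ t ∈ Icc (0 : ℝ) 1, x + t • w ∈ D

/-- A point `x` is compared with `y ∈ B` through `x + w`: the first leg is a translation difference,
and the second takes place inside `B`. -/
theorem oscBounded_of_shift {D A B : Set X} {w : X} (hA : IsOpen A)
    (hw : ∀ x ∈ A, ∀ t ∈ Icc (0 : ℝ) 1, x + t • w ∈ D) (hwB : ∀ x ∈ A, x + w ∈ B)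
    (hBo : MeasurableSet B) (hB : volume B ≠ ⊤) (hBB : OscBounded D B B) : OscBounded D A B := by
  obtain ⟨C, hC⟩ := hBB
  refine ⟨2 * ((volume B).toNNReal * ‖w‖₊ ^ 2 + C), fun N E hN => ?_⟩
  have hm : Measurable fun x => N x (x + w) :=
    hN.measurable.comp (measurable_id.prodMk (measurable_id.add_const w))
  calc ∫⁻ x in A, ∫⁻ y in B, N x y
      ≤ ∫⁻ x in A, 2 * (N x (x + w) * volume B + ∫⁻ y in B, N (x + w) y) := by
        gcongr with x
        calc ∫⁻ y in B, N x y ≤ ∫⁻ y in B, 2 * (N x (x + w) + N (x + w) y) :=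
              lintegral_mono fun z => hN.triangle _ _ _
          _ = _ := by
              rw [lintegral_const_mul' _ _ (by simp), lintegral_add_left measurable_const,
                setLIntegral_const]
    _ = 2 * ((∫⁻ x in A, N x (x + w)) * volume B + ∫⁻ x in A, ∫⁻ y in B, N (x + w) y) := by
        rw [lintegral_const_mul' _ _ (by simp), lintegral_add_left (hm.mul_const _),
          lintegral_mul_const' _ _ hB]
    _ ≤ 2 * (‖w‖ₑ ^ 2 * E * volume B + C * E) := by
        gcongr
        · exact hN.shift A w hA hw
        · refine le_trans ?_ (hC N E hN)
          rw [← lintegral_indicator hA.measurableSet, ← lintegral_indicator hBo,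
            ← lintegral_add_right_eq_self (B.indicator fun x => ∫⁻ y in B, N x y) w]
          refine lintegral_mono fun x => ?_
          by_cases hx : x ∈ A
          · simp [hx, hwB x hx]
          · simp [hx]
    _ = _ := by
        push_cast
        rw [ENNReal.coe_toNNReal hB, enorm_eq_nnnorm]
        ring

/-- Small balls around any two points of `D` are linked by connectedness. By compactness of the
closure, finitely many patches cover `D`, each of which can be shifted into an interior ball; all of
them are linked to one fixed ball, through which `D` is compared with itself. -/
theorem oscBounded_self {D : Set X} (hD : IsOpen D) (hb : Bornology.IsBounded D)
    (hc : IsConnected D) (hs : HasInwardShifts D) : OscBounded D D D := by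
  have hfin : ∀ x : X, ∀ r : ℝ, volume (Metric.ball x r) ≠ ⊤ := fun x r => measure_ball_lt_top.ne
  have hpos : ∀ x : X, ∀ r : ℝ, 0 < r → volume (Metric.ball x r) ≠ 0 := fun x r hr =>
    (Metric.measure_ball_pos _ _ hr).ne'
  have hDfin : volume D ≠ ⊤ := hb.measure_lt_top.ne
  have link : ∀ x ∈ D, ∀ y ∈ D, ∃ r > 0, OscBounded D (Metric.ball x r) (Metric.ball y r) := by
    intro x hx y hy
    -- Being linked holds locally, because nearby small balls lie in a common ball inside `D`, and
    -- it is transitive after shrinking the radii.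
    refine hc.isPreconnected.induction₂'
      (fun x y => ∃ r > 0, OscBounded D (Metric.ball x r) (Metric.ball y r)) ?_ ?_ hx hy
    · intro x hx
      obtain ⟨r, hr, hrD⟩ := Metric.isOpen_iff.1 hD x hx
      refine mem_nhdsWithin_of_mem_nhds ?_
      filter_upwards [Metric.ball_mem_nhds x (half_pos hr)] with y hy
      have h1 : Metric.ball y (r / 2) ⊆ Metric.ball x r :=
        Metric.ball_subset_ball' (by rw [Metric.mem_ball] at hy; linarith)
      have h2 : Metric.ball x (r / 2) ⊆ Metric.ball x r := Metric.ball_subset_ball (by linarith)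
      exact ⟨⟨r / 2, half_pos hr, (oscBounded_ball hrD).mono h2 h1⟩,
        ⟨r / 2, half_pos hr, (oscBounded_ball hrD).mono h1 h2⟩⟩
    · rintro x y z - - - ⟨r, hr, h⟩ ⟨r', hr', h'⟩
      have e1 : ∀ q : X, Metric.ball q (min r r') ⊆ Metric.ball q r := fun q =>
        Metric.ball_subset_ball (min_le_left _ _)
      have e2 : ∀ q : X, Metric.ball q (min r r') ⊆ Metric.ball q r' := fun q =>
        Metric.ball_subset_ball (min_le_right _ _)
      exact ⟨min r r', lt_min hr hr', (h.mono (e1 x) (e1 y)).trans (h'.mono (e2 y) (e2 z))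
        (hfin _ _) (hpos _ _ (lt_min hr hr')) (hfin _ _) (hfin _ _)⟩
  obtain ⟨x₀, hx₀⟩ := hc.nonempty
  -- The induction runs over subsets of the compact set `closure D`, intersected with `D`, so that
  -- neighbourhoods of boundary points are included.
  have cover : ∀ y₀ ∈ D, ∃ r > 0, OscBounded D (closure D ∩ D) (Metric.ball y₀ r) := by
    intro y₀ hy₀
    refine IsCompact.induction_on (p := fun S => ∃ r > 0, OscBounded D (S ∩ D) (Metric.ball y₀ r))
      hb.isCompact_closure ?_ ?_ ?_ ?_
    · exact ⟨1, one_pos, 0, fun N E hN => by simp⟩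
    · rintro s t hst ⟨r, hr, h⟩
      exact ⟨r, hr, h.mono (inter_subset_inter_left _ hst) subset_rfl⟩
    · rintro s t ⟨r, hr, h⟩ ⟨r', hr', h'⟩
      refine ⟨min r r', lt_min hr hr', ?_⟩
      rw [union_inter_distrib_right]
      exact (h.mono subset_rfl (Metric.ball_subset_ball (min_le_left _ _))).union
        (h'.mono subset_rfl (Metric.ball_subset_ball (min_le_right _ _)))
    · intro p hp
      obtain ⟨w, r, hr, hpw, hw⟩ := hs p hp
      obtain ⟨ρ, hρ, hlink⟩ := link _ hpw _ hy₀
      obtain ⟨ρ', hρ', hball⟩ := Metric.isOpen_iff.1 hD _ hpw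
      set m := min r (min ρ ρ') with hm
      have hm0 : 0 < m := lt_min hr (lt_min hρ hρ')
      refine ⟨Metric.ball p m, mem_nhdsWithin_of_mem_nhds (Metric.ball_mem_nhds _ hm0), ρ, hρ, ?_⟩
      have h1 : m ≤ r := min_le_left _ _
      have h2 : m ≤ ρ := (min_le_right _ _).trans (min_le_left _ _)
      have h3 : m ≤ ρ' := (min_le_right _ _).trans (min_le_right _ _)
      have hbb : OscBounded D (Metric.ball (p + w) m) (Metric.ball (p + w) m) :=
        oscBounded_ball ((Metric.ball_subset_ball h3).trans hball)
      have hfin' : volume (Metric.ball p m ∩ D) ≠ ⊤ :=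
        (measure_mono_top inter_subset_left).mt (hfin _ _)
      refine (oscBounded_of_shift (w := w) (Metric.isOpen_ball.inter hD) ?_ ?_
        Metric.isOpen_ball.measurableSet (hfin _ _) hbb).trans
        (hlink.mono (Metric.ball_subset_ball h2) subset_rfl) hfin' (hpos _ _ hm0) (hfin _ _)
        (hfin _ _)
      · intro x hx
        exact hw x ⟨Metric.ball_subset_ball h1 hx.1, hx.2⟩
      · intro x hx
        simpa [Metric.mem_ball] using hx.1
  obtain ⟨r, hr, h⟩ := cover x₀ hx₀
  rw [inter_eq_right.2 subset_closure] at h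
  exact h.trans h.symm hDfin (hpos _ _ hr) (hfin _ _) hDfin

end Kernel

/-- In the coordinates `T`, moving up fixes the abscissa and raises the height, so a point above the
graph stays above it. A boundary point satisfies only the non-strict inequality, by closedness, and
the upward shift makes it strict. The shift and the radius are both `r / 2`, so nothing leaves the
ball where the graph description is valid. -/
theorem HasLipschitzBoundary.hasInwardShifts {D : Set R2} (hD : IsOpen D)
    (h : HasLipschitzBoundary D) : HasInwardShifts D := by
  intro p hp
  by_cases hpD : p ∈ D
  · exact ⟨0, 1, one_pos, by simpa using hpD, fun x hx t _ => by simpa using hx.2⟩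
  have hpf : p ∈ frontier D := by rw [hD.frontier_eq]; exact ⟨hp, hpD⟩
  obtain ⟨T, K, f, r, hf, hr, hT⟩ := h p hpf
  have hle : f (T p 0) ≤ T p 1 := by
    have hcl : p ∈ closure (Metric.ball p r ∩ D) :=
      mem_closure_iff_nhds.2 fun t ht => by
        obtain ⟨x, hx, hxD⟩ := mem_closure_iff_nhds.1 hp _
          (inter_mem ht (Metric.ball_mem_nhds p hr))
        exact ⟨x, hx.1, hx.2, hxD⟩
    have hclosed : IsClosed {x : R2 | f (T x 0) ≤ T x 1} := by
      refine isClosed_le (hf.continuous.comp ?_) ?_ <;> fun_prop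
    exact closure_minimal (fun x hx => ((hT x hx.1).1 hx.2).le) hclosed hcl
  set w : R2 := T.symm (EuclideanSpace.single 1 (r / 2)) with hw
  have hTw : T w = EuclideanSpace.single 1 (r / 2) := by rw [hw, T.apply_symm_apply]
  have hwn : ‖w‖ = r / 2 := by
    rw [hw, T.symm.norm_map, PiLp.norm_single, Real.norm_eq_abs,
      abs_of_pos (half_pos hr)]
  have key : ∀ x (t : ℝ), T (x + t • w) 0 = T x 0 ∧ T (x + t • w) 1 = T x 1 + t * (r / 2) := by
    intro x t
    rw [map_add, map_smul, hTw]
    simp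
  refine ⟨w, r / 2, half_pos hr, ?_, ?_⟩
  · have h1 : p + w ∈ Metric.ball p r := by
      rw [Metric.mem_ball, dist_eq_norm, add_sub_cancel_left, hwn]; linarith
    have k := key p 1
    rw [one_smul] at k
    rw [hT _ h1, k.1, k.2]
    linarith
  · rintro x ⟨hx, hxD⟩ t ⟨ht0, ht1⟩
    have h0 : x ∈ Metric.ball p r := Metric.ball_subset_ball (by linarith) hx
    have h1 : x + t • w ∈ Metric.ball p r := by
      rw [Metric.mem_ball, dist_eq_norm] at hx ⊢
      calc ‖x + t • w - p‖ = ‖(x - p) + t • w‖ := by congr 1; abel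
        _ ≤ ‖x - p‖ + ‖t • w‖ := norm_add_le _ _
        _ = ‖x - p‖ + t * (r / 2) := by rw [norm_smul, hwn, Real.norm_of_nonneg ht0]
        _ < r := by nlinarith
    rw [hT _ h1, (key x t).1, (key x t).2]
    have := (hT _ h0).1 hxD
    nlinarith

end CurvedRod

namespace CurvedRod

/-! ### Difference quotients of weakly differentiable functions -/

section Translation

variable {X : Type*} [NormedAddCommGroup X] [NormedSpace ℝ X] [FiniteDimensional ℝ X]
  [MeasureSpace X] [BorelSpace X] [(volume : Measure X).IsAddHaarMeasure]

theorem integrable_smul_of_hasCompactSupport {ψ : X → ℝ} (hψ : Continuous ψ)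
    (hc : HasCompactSupport ψ) {u : X → R3} (hu : Integrable u) :
    Integrable fun x => ψ x • u x := by
  obtain ⟨C, hC⟩ := hψ.bounded_above_of_compact_support hc
  exact hu.bdd_smul (C := C) hψ.aestronglyMeasurable (Eventually.of_forall hC)

theorem hasDerivAt_integral_translate_smul {ψ : X → ℝ} (hψ : ContDiff ℝ ∞ ψ)
    (hc : HasCompactSupport ψ) {u : X → R3} (hu : Integrable u) (w : X) (t : ℝ) :
    HasDerivAt (fun t : ℝ => ∫ x, ψ (x - t • w) • u x)
      (∫ x, (-(fderiv ℝ ψ (x - t • w) w)) • u x) t := by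
  have hd : Continuous fun x => fderiv ℝ ψ x w :=
    (hψ.continuous_fderiv (by simp)).clm_apply continuous_const
  have hdc : HasCompactSupport fun x => fderiv ℝ ψ x w := hc.fderiv_apply ℝ _
  obtain ⟨C, hC⟩ := hd.bounded_above_of_compact_support hdc
  obtain ⟨C', hC'⟩ := hψ.continuous.bounded_above_of_compact_support hc
  have hsub : ∀ t : ℝ, Continuous fun x : X => x - t • w := fun t =>
    continuous_id.sub continuous_const
  refine (hasDerivAt_integral_of_dominated_loc_of_deriv_le (s := univ)
    (bound := fun x => C * ‖u x‖) (F' := fun t x => (-(fderiv ℝ ψ (x - t • w) w)) • u x)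
    univ_mem ?_ ?_ ?_ ?_ ?_ ?_).2
  · exact Eventually.of_forall fun t =>
      ((hψ.continuous.comp (hsub t)).aestronglyMeasurable).smul hu.aestronglyMeasurable
  · exact hu.bdd_smul (C := C') (hψ.continuous.comp (hsub t)).aestronglyMeasurable
      (Eventually.of_forall fun x => hC' _)
  · exact (((hd.comp (hsub t)).neg).aestronglyMeasurable).smul hu.aestronglyMeasurable
  · refine Eventually.of_forall fun x t _ => ?_
    rw [norm_smul, norm_neg]
    gcongr
    exact hC _
  · exact hu.norm.const_mul C
  · refine Eventually.of_forall fun x t _ => HasDerivAt.smul_const ?_ (u x)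
    have h1 : HasDerivAt (fun t : ℝ => x - t • w) (-w) t := by
      simpa using ((hasDerivAt_id t).smul_const w).const_sub x
    have h2 : HasFDerivAt ψ (fderiv ℝ ψ (x - t • w)) (x - t • w) :=
      (hψ.differentiable (by simp)).differentiableAt.hasFDerivAt
    simpa [Function.comp_def] using! h2.comp_hasDerivAt t h1

/-- The fundamental theorem of calculus along `w`, proved by duality. For a test function `ψ`
supported in `A`, the translate `ψ (x - t • w)` is still supported in `Ω`, so the `t`-derivative of
its pairing with `u` is the pairing of `ψ` with `g (x + t • w)`; integrate over `t ∈ [0, 1]`. -/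
theorem HasWeakDeriv.sub_translate_ae_eq {Ω A : Set X} {u g : X → R3} {w : X} (hΩ : IsOpen Ω)
    (hu : IntegrableOn u Ω) (hg : IntegrableOn g Ω) (hgm : StronglyMeasurable g)
    (h : HasWeakDeriv Ω w u g) (hA : IsOpen A)
    (hw : ∀ x ∈ A, ∀ t ∈ Icc (0 : ℝ) 1, x + t • w ∈ Ω) :
    ∀ᵐ x, x ∈ A → u (x + w) - u x = ∫ t in (0 : ℝ)..1, g (x + t • w) := by
  -- Extension by zero makes every translate integrable on the whole space; the values off `Ω` are
  -- never seen by the test functions.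
  set u' := Ω.indicator u with hu'
  set g' := Ω.indicator g with hg'
  have iu : Integrable u' := (integrable_indicator_iff hΩ.measurableSet).2 hu
  have ig : Integrable g' := (integrable_indicator_iff hΩ.measurableSet).2 hg
  have mg : StronglyMeasurable g' := hgm.indicator hΩ.measurableSet
  have igt : ∀ t : ℝ, Integrable fun x => g' (x + t • w) := fun t => ig.comp_add_right _
  have iprod : Integrable (fun q : ℝ × X => g' (q.2 + q.1 • w))
      ((volume.restrict (Ioc (0 : ℝ) 1)).prod volume) := by
    have hm : StronglyMeasurable fun q : ℝ × X => g' (q.2 + q.1 • w) :=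
      mg.comp_measurable (by fun_prop)
    rw [integrable_prod_iff hm.aestronglyMeasurable]
    refine ⟨Eventually.of_forall igt, ?_⟩
    have e : ∀ t : ℝ, ∫ x, ‖g' (x + t • w)‖ = ∫ x, ‖g' x‖ := fun t =>
      integral_add_right_eq_self (fun x => ‖g' x‖) (t • w)
    simp_rw [e]
    exact integrable_const _
  have key : ∀ᵐ x, x ∈ A → u' (x + w) - u' x - ∫ t in (0 : ℝ)..1, g' (x + t • w) = 0 := by
    have i3 : Integrable fun x => ∫ t in (0 : ℝ)..1, g' (x + t • w) := by
      simp_rw [intervalIntegral.integral_of_le zero_le_one]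
      exact iprod.integral_prod_right
    have i12 : Integrable fun x => u' (x + w) - u' x := (iu.comp_add_right w).sub iu
    refine hA.ae_eq_zero_of_integral_contDiff_smul_eq_zero
      ((i12.sub i3).locallyIntegrable.locallyIntegrableOn _) fun ψ hψ hc hs => ?_
    have e1 : ∀ t ∈ uIcc (0 : ℝ) 1, ∫ x, (-(fderiv ℝ ψ (x - t • w) w)) • u' x
        = ∫ x, ψ x • g' (x + t • w) := by
      intro t ht
      rw [uIcc_of_le zero_le_one] at ht
      have hφ : ContDiff ℝ ∞ fun x => ψ (x - t • w) := hψ.comp (contDiff_id.sub contDiff_const)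
      have hφc : HasCompactSupport fun x => ψ (x - t • w) := by
        have := hc.comp_homeomorph (Homeomorph.addRight (-(t • w)))
        simpa [Function.comp_def, sub_eq_add_neg] using this
      have hφs : tsupport (fun x => ψ (x - t • w)) ⊆ Ω := by
        intro x hx
        have h1 : x - t • w ∈ tsupport ψ :=
          tsupport_comp_subset_preimage ψ (f := fun x => x - t • w)
            (continuous_id.sub continuous_const) hx
        simpa using hw _ (hs h1) t ht
      have h2 := h _ hφ hφc hφs
      have h3 : ∀ x, fderiv ℝ (fun x => ψ (x - t • w)) x w = fderiv ℝ ψ (x - t • w) w := by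
        intro x
        simp_rw [sub_eq_add_neg]
        rw [fderiv_comp_add_right]
      simp_rw [h3] at h2
      have h4 : ∫ x, (-(fderiv ℝ ψ (x - t • w) w)) • u' x
          = -∫ x in Ω, (fderiv ℝ ψ (x - t • w) w) • u x := by
        rw [← integral_indicator hΩ.measurableSet, ← integral_neg]
        refine integral_congr_ae (Eventually.of_forall fun x => ?_)
        by_cases hx : x ∈ Ω <;> simp [hu', hx]
      have h5 : ∫ x, ψ x • g' (x + t • w) = ∫ x in Ω, ψ (x - t • w) • g x := by
        rw [← integral_indicator hΩ.measurableSet,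
          ← integral_sub_right_eq_self (fun x => ψ x • g' (x + t • w)) (t • w)]
        refine integral_congr_ae (Eventually.of_forall fun x => ?_)
        by_cases hx : x ∈ Ω <;> simp [hg', hx]
      rw [h4, h2, neg_neg, h5]
    have hcont : Continuous fun t : ℝ => ∫ x, ψ x • g' (x + t • w) := by
      obtain ⟨C, hC⟩ := hψ.continuous.bounded_above_of_compact_support hc
      have : (fun t : ℝ => ∫ x, ψ x • g' (x + t • w))
          = fun t : ℝ => ∫ x, ψ (x - t • w) • g' x := by
        funext t
        rw [← integral_sub_right_eq_self (fun x => ψ x • g' (x + t • w)) (t • w)]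
        simp
      rw [this]
      refine continuous_of_dominated (bound := fun x => C * ‖g' x‖) (fun t => ?_) (fun t => ?_)
        (ig.norm.const_mul C) ?_
      · exact ((hψ.continuous.comp (continuous_id.sub continuous_const)).aestronglyMeasurable).smul
          ig.aestronglyMeasurable
      · refine Eventually.of_forall fun x => ?_
        rw [norm_smul]
        gcongr
        exact hC _
      · refine Eventually.of_forall fun x => ?_
        have : Continuous fun t : ℝ => ψ (x - t • w) := hψ.continuous.comp (by fun_prop)
        exact this.smul continuous_const
    have ftc : ∫ t in (0 : ℝ)..1, ∫ x, ψ x • g' (x + t • w)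
        = (∫ x, ψ (x - (1 : ℝ) • w) • u' x) - ∫ x, ψ (x - (0 : ℝ) • w) • u' x := by
      refine intervalIntegral.integral_eq_sub_of_hasDerivAt
        (f := fun t : ℝ => ∫ x, ψ (x - t • w) • u' x) (fun t ht => ?_)
        (hcont.intervalIntegrable _ _)
      rw [← e1 t ht]
      exact hasDerivAt_integral_translate_smul hψ hc iu w t
    have e2 : ∫ x, ψ (x - (1 : ℝ) • w) • u' x = ∫ x, ψ x • u' (x + w) := by
      rw [← integral_sub_right_eq_self (fun x => ψ x • u' (x + w)) w]
      simp
    have e3 : ∫ t in (0 : ℝ)..1, ∫ x, ψ x • g' (x + t • w)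
        = ∫ x, ψ x • ∫ t in (0 : ℝ)..1, g' (x + t • w) := by
      simp_rw [intervalIntegral.integral_of_le zero_le_one]
      rw [integral_integral_swap]
      · simp_rw [integral_smul]
      · obtain ⟨C, hC⟩ := hψ.continuous.bounded_above_of_compact_support hc
        exact iprod.bdd_smul (C := C)
          (φ := fun q : ℝ × X => ψ q.2) (hψ.continuous.comp continuous_snd).aestronglyMeasurable
          (Eventually.of_forall fun q => hC (Prod.snd q))
    have j1 := integrable_smul_of_hasCompactSupport hψ.continuous hc (iu.comp_add_right w)
    have j2 := integrable_smul_of_hasCompactSupport hψ.continuous hc iu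
    have j3 := integrable_smul_of_hasCompactSupport hψ.continuous hc i3
    simp_rw [smul_sub]
    have e4 := integral_sub (j1.sub j2) j3
    have e5 := integral_sub j1 j2
    simp only [Pi.sub_apply] at e4
    rw [e4, e5, ← e3, ftc, e2]
    simp
  filter_upwards [key] with x hx hxA
  have h0 : x ∈ Ω := by simpa using hw x hxA 0 (by simp)
  have h1 : x + w ∈ Ω := by simpa using hw x hxA 1 (by simp)
  have h2 : ∫ t in (0 : ℝ)..1, g' (x + t • w) = ∫ t in (0 : ℝ)..1, g (x + t • w) := by
    refine intervalIntegral.integral_congr fun t ht => ?_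
    rw [uIcc_of_le zero_le_one] at ht
    simp [hg', hw x hxA t ht]
  have := hx hxA
  rw [h2, hu', indicator_of_mem h0, indicator_of_mem h1] at this
  exact sub_eq_zero.1 this

theorem enorm_integral_sq_le (f : ℝ → R3) (hf : StronglyMeasurable f) :
    ‖∫ t in (0 : ℝ)..1, f t‖ₑ ^ 2 ≤ ∫⁻ t in Ioc (0 : ℝ) 1, ‖f t‖ₑ ^ 2 := by
  have hp : IsProbabilityMeasure (volume.restrict (Ioc (0 : ℝ) 1)) := ⟨by simp⟩
  have h1 : ‖∫ t in (0 : ℝ)..1, f t‖ₑ ≤ eLpNorm f 2 (volume.restrict (Ioc (0 : ℝ) 1)) := by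
    rw [intervalIntegral.integral_of_le zero_le_one]
    refine (enorm_integral_le_lintegral_enorm _).trans ?_
    rw [← eLpNorm_one_eq_lintegral_enorm]
    exact eLpNorm_le_eLpNorm_of_exponent_le (by norm_num) hf.aestronglyMeasurable
  calc _ ≤ eLpNorm f 2 (volume.restrict (Ioc (0 : ℝ) 1)) ^ 2 := by gcongr
    _ = _ := by
      have := eLpNorm_nnreal_pow_eq_lintegral (f := f) (μ := volume.restrict (Ioc (0 : ℝ) 1))
        (p := 2) (by norm_num)
      simpa using this

/-- Jensen's inequality in `t`, Tonelli and translation invariance. The factor `‖w‖ₑ ^ 2` of the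
field `shift` appears once `g` is written as a combination of partial derivatives with the
components of `w` as coefficients. -/
theorem HasWeakDeriv.lintegral_sub_translate_le {Ω A : Set X} {u g : X → R3} {w : X}
    (hΩ : IsOpen Ω) (hu : IntegrableOn u Ω) (hg : IntegrableOn g Ω) (hgm : StronglyMeasurable g)
    (h : HasWeakDeriv Ω w u g) (hA : IsOpen A)
    (hw : ∀ x ∈ A, ∀ t ∈ Icc (0 : ℝ) 1, x + t • w ∈ Ω) :
    ∫⁻ x in A, ‖u (x + w) - u x‖ₑ ^ 2 ≤ ∫⁻ x in Ω, ‖g x‖ₑ ^ 2 := by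
  have hgt : Measurable fun q : X × ℝ => ‖g (q.1 + q.2 • w)‖ₑ ^ 2 :=
    ((hgm.comp_measurable (by fun_prop : Measurable fun q : X × ℝ => q.1 + q.2 • w)).enorm).pow_const
      2
  calc ∫⁻ x in A, ‖u (x + w) - u x‖ₑ ^ 2
      ≤ ∫⁻ x in A, ∫⁻ t in Ioc (0 : ℝ) 1, ‖g (x + t • w)‖ₑ ^ 2 := by
        refine lintegral_mono_ae ?_
        rw [ae_restrict_iff' hA.measurableSet]
        filter_upwards [h.sub_translate_ae_eq hΩ hu hg hgm hA hw] with x hx hxA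
        rw [hx hxA]
        exact enorm_integral_sq_le _ (hgm.comp_measurable (by fun_prop))
    _ = ∫⁻ t in Ioc (0 : ℝ) 1, ∫⁻ x in A, ‖g (x + t • w)‖ₑ ^ 2 :=
        lintegral_lintegral_swap hgt.aemeasurable
    _ ≤ ∫⁻ t in Ioc (0 : ℝ) 1, ∫⁻ x in Ω, ‖g x‖ₑ ^ 2 := by
        refine setLIntegral_mono' measurableSet_Ioc fun t ht => ?_
        rw [← lintegral_indicator hA.measurableSet, ← lintegral_indicator hΩ.measurableSet,
          ← lintegral_add_right_eq_self (Ω.indicator fun x => ‖g x‖ₑ ^ 2) (t • w)]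
        refine lintegral_mono fun x => ?_
        by_cases hx : x ∈ A
        · simp [hx, hw x hx t ⟨ht.1.le, ht.2⟩]
        · simp [hx]
    _ = _ := by simp

end Translation

end CurvedRod

namespace CurvedRod

/-! ### Poincaré inequalities on the product domain -/

/-- Translations in arbitrary directions need derivatives in arbitrary directions. Scalar multiples
are obtained with `b = 0`. -/
theorem HasWeakDeriv.linearCombination {X : Type*} [NormedAddCommGroup X] [NormedSpace ℝ X]
    [FiniteDimensional ℝ X] [MeasureSpace X] [BorelSpace X] {Ω : Set X} {e₁ e₂ : X}
    {u g₁ g₂ : X → R3} (hu : IntegrableOn u Ω) (hg₁ : IntegrableOn g₁ Ω) (hg₂ : IntegrableOn g₂ Ω)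
    (h₁ : HasWeakDeriv Ω e₁ u g₁) (h₂ : HasWeakDeriv Ω e₂ u g₂) (a b : ℝ) :
    HasWeakDeriv Ω (a • e₁ + b • e₂) u (fun x => a • g₁ x + b • g₂ x) := by
  intro φ hφ hc hs
  have hd : ∀ e, Continuous fun x => fderiv ℝ φ x e := fun e =>
    (hφ.continuous_fderiv (by simp)).clm_apply continuous_const
  have key : ∀ (ψ : X → ℝ), Continuous ψ → HasCompactSupport ψ → ∀ f : X → R3,
      IntegrableOn f Ω → IntegrableOn (fun x => ψ x • f x) Ω := by
    intro ψ hψ hψc f hf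
    obtain ⟨C, hC⟩ := hψ.bounded_above_of_compact_support hψc
    exact hf.bdd_smul (C := C) hψ.aestronglyMeasurable (Eventually.of_forall hC)
  have i1 := key _ (hd e₁) (hc.fderiv_apply ℝ _) u hu
  have i2 := key _ (hd e₂) (hc.fderiv_apply ℝ _) u hu
  have j1 := key φ hφ.continuous hc g₁ hg₁
  have j2 := key φ hφ.continuous hc g₂ hg₂
  have e1 : ∀ x, fderiv ℝ φ x (a • e₁ + b • e₂) • u x
      = a • (fderiv ℝ φ x e₁ • u x) + b • (fderiv ℝ φ x e₂ • u x) := fun x => by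
    simp [add_smul, mul_smul]
  have e2 : ∀ x, φ x • (a • g₁ x + b • g₂ x) = a • (φ x • g₁ x) + b • (φ x • g₂ x) := fun x => by
    rw [smul_add, smul_comm (φ x) a, smul_comm (φ x) b]
  simp_rw [e1, e2]
  have s1 := integral_add (i1.smul a) (i2.smul b)
  have s2 := integral_add (j1.smul a) (j2.smul b)
  simp only [Pi.smul_apply] at s1 s2
  rw [s1, s2]
  simp_rw [integral_smul]
  rw [h₁ φ hφ hc hs, h₂ φ hφ hc hs]
  simp only [smul_neg, neg_add]

/-- A function on `(0, L) × D` with its three weak partial derivatives. -/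
structure IsSobolevOn (L : ℝ) (D : Set R2) (u : ℝ × R2 → R3) (g : Fin 3 → ℝ × R2 → R3) :
    Prop where
  meas : StronglyMeasurable u
  meas_deriv : ∀ i, StronglyMeasurable (g i)
  integrable : IntegrableOn u (Ioo 0 L ×ˢ D)
  integrable_deriv : ∀ i, IntegrableOn (g i) (Ioo 0 L ×ˢ D)
  deriv_axis : HasWeakDeriv (Ioo 0 L ×ˢ D) (1, 0) u (g 0)
  deriv_fst : HasWeakDeriv (Ioo 0 L ×ˢ D) (0, EuclideanSpace.single 0 1) u (g 1)
  deriv_snd : HasWeakDeriv (Ioo 0 L ×ˢ D) (0, EuclideanSpace.single 1 1) u (g 2)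

theorem enorm_add_sq_le {E : Type*} [NormedAddCommGroup E] (a b : E) :
    ‖a + b‖ₑ ^ 2 ≤ 2 * (‖a‖ₑ ^ 2 + ‖b‖ₑ ^ 2) := by
  calc ‖a + b‖ₑ ^ 2 ≤ (‖a‖ₑ + ‖b‖ₑ) ^ 2 := by gcongr; exact enorm_add_le a b
    _ ≤ 2 * (‖a‖ₑ ^ 2 + ‖b‖ₑ ^ 2) := by
      simp only [enorm_eq_nnnorm]
      norm_cast
      exact add_sq_le

theorem enorm_sub_sq_triangle {E : Type*} [NormedAddCommGroup E] (a b c : E) :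
    ‖a - c‖ₑ ^ 2 ≤ 2 * (‖a - b‖ₑ ^ 2 + ‖b - c‖ₑ ^ 2) := by
  rw [← sub_add_sub_cancel a b c]
  exact enorm_add_sq_le _ _

theorem enorm_smul_add_smul_sq_le (w : R2) (a b : R3) :
    ‖w 0 • a + w 1 • b‖ₑ ^ 2 ≤ ‖w‖ₑ ^ 2 * (2 * (‖a‖ₑ ^ 2 + ‖b‖ₑ ^ 2)) := by
  have h : ∀ i, ‖w i‖ₑ ≤ ‖w‖ₑ := fun i => by
    simp only [enorm_eq_nnnorm, ENNReal.coe_le_coe]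
    exact PiLp.nnnorm_apply_le w i
  calc ‖w 0 • a + w 1 • b‖ₑ ^ 2 ≤ 2 * (‖w 0 • a‖ₑ ^ 2 + ‖w 1 • b‖ₑ ^ 2) := enorm_add_sq_le _ _
    _ ≤ 2 * ((‖w‖ₑ * ‖a‖ₑ) ^ 2 + (‖w‖ₑ * ‖b‖ₑ) ^ 2) := by
        rw [enorm_smul, enorm_smul]
        gcongr <;> exact h _
    _ = _ := by ring

section

variable {L : ℝ} {D : Set R2} {u : ℝ × R2 → R3} {g : Fin 3 → ℝ × R2 → R3}

theorem IsSobolevOn.measurable_osc_comp (h : IsSobolevOn L D u g) {Y : Type*} [MeasurableSpace Y]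
    {a b : Y → ℝ × R2} (ha : Measurable a) (hb : Measurable b) :
    Measurable fun y => ‖u (a y) - u (b y)‖ₑ ^ 2 := by
  have h1 : Measurable fun y => u (a y) - u (b y) :=
    (h.meas.measurable.comp ha).sub (h.meas.measurable.comp hb)
  exact h1.enorm.pow_const 2

theorem restrict_prod_eq (L : ℝ) (D : Set R2) :
    volume.restrict (Ioo 0 L ×ˢ D) = (volume.restrict (Ioo 0 L)).prod (volume.restrict D) := by
  rw [Measure.prod_restrict, Measure.volume_eq_prod]

instance : (volume : Measure (ℝ × R2)).IsAddHaarMeasure := by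
  rw [Measure.volume_eq_prod]; infer_instance

/-- The axial variable is integrated out, so that translations by `(0, w)` act on the whole cylinder
and `u` is never restricted to a single cross section. -/
theorem IsSobolevOn.isOscKernel_slice (h : IsSobolevOn L D u g) (hD : IsOpen D) :
    IsOscKernel D (fun x y => ∫⁻ s in Ioo 0 L, ‖u (s, x) - u (s, y)‖ₑ ^ 2)
      (2 * ∫⁻ z in Ioo 0 L ×ˢ D, (‖g 1 z‖ₑ ^ 2 + ‖g 2 z‖ₑ ^ 2)) where
  measurable := by
    refine Measurable.lintegral_prod_right'
      (f := fun q : (R2 × R2) × ℝ => ‖u (q.2, q.1.1) - u (q.2, q.1.2)‖ₑ ^ 2) ?_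
    exact h.measurable_osc_comp (by fun_prop) (by fun_prop)
  symm x y := by simp_rw [← enorm_neg (u (_, x) - u (_, y)), neg_sub]
  triangle x y z := by
    rw [← lintegral_add_left (h.measurable_osc_comp (by fun_prop) (by fun_prop)),
      ← lintegral_const_mul' _ _ (by simp)]
    exact lintegral_mono fun s => enorm_sub_sq_triangle _ _ _
  shift A w hA hw := by
    have hweak := HasWeakDeriv.linearCombination h.integrable (h.integrable_deriv 1)
      (h.integrable_deriv 2) h.deriv_fst h.deriv_snd (w 0) (w 1)
    have e : (w 0 • (0, EuclideanSpace.single 0 1) + w 1 • (0, EuclideanSpace.single 1 1)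
        : ℝ × R2) = (0, w) := by
      refine Prod.ext (by simp) ?_
      ext i
      fin_cases i <;> simp
    rw [e] at hweak
    have key := hweak.lintegral_sub_translate_le (isOpen_Ioo.prod hD) h.integrable
      (((h.integrable_deriv 1).smul (w 0)).add ((h.integrable_deriv 2).smul (w 1)))
      (((h.meas_deriv 1).const_smul (w 0)).add ((h.meas_deriv 2).const_smul (w 1)))
      (A := Ioo 0 L ×ˢ A) (isOpen_Ioo.prod hA)
      (by
        rintro ⟨s, x⟩ ⟨hs, hx⟩ t ht
        exact ⟨by simpa using hs, hw x hx t ht⟩)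
    calc ∫⁻ x in A, ∫⁻ s in Ioo 0 L, ‖u (s, x) - u (s, x + w)‖ₑ ^ 2
        = ∫⁻ z in Ioo 0 L ×ˢ A, ‖u (z + (0, w)) - u z‖ₑ ^ 2 := by
          rw [restrict_prod_eq, lintegral_prod_symm]
          · refine lintegral_congr fun x => lintegral_congr fun s => ?_
            rw [← enorm_neg, neg_sub]
            simp
          · exact (h.measurable_osc_comp (by fun_prop) (by fun_prop)).aemeasurable
      _ ≤ _ := key
      _ ≤ ∫⁻ z in Ioo 0 L ×ˢ D, ‖w‖ₑ ^ 2 * (2 * (‖g 1 z‖ₑ ^ 2 + ‖g 2 z‖ₑ ^ 2)) :=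
          lintegral_mono fun z => enorm_smul_add_smul_sq_le w _ _
      _ = _ := by
          rw [lintegral_const_mul' _ _ (by finiteness), lintegral_const_mul' _ _ (by finiteness)]

theorem IsSobolevOn.isOscKernel_axis (h : IsSobolevOn L D u g) (hD : IsOpen D) :
    IsOscKernel (Ioo 0 L) (fun s t => ∫⁻ x in D, ‖u (s, x) - u (t, x)‖ₑ ^ 2)
      (∫⁻ z in Ioo 0 L ×ˢ D, ‖g 0 z‖ₑ ^ 2) where
  measurable := by
    refine Measurable.lintegral_prod_right'
      (f := fun q : (ℝ × ℝ) × R2 => ‖u (q.1.1, q.2) - u (q.1.2, q.2)‖ₑ ^ 2) ?_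
    exact h.measurable_osc_comp (by fun_prop) (by fun_prop)
  symm x y := by simp_rw [← enorm_neg (u (x, _) - u (y, _)), neg_sub]
  triangle x y z := by
    rw [← lintegral_add_left (h.measurable_osc_comp (by fun_prop) (by fun_prop)),
      ← lintegral_const_mul' _ _ (by simp)]
    exact lintegral_mono fun s => enorm_sub_sq_triangle _ _ _
  shift A w hA hw := by
    have hweak := HasWeakDeriv.linearCombination h.integrable (h.integrable_deriv 0)
      (h.integrable_deriv 0) h.deriv_axis h.deriv_axis w 0
    have e : (w • (1, 0) + (0 : ℝ) • (1, 0) : ℝ × R2) = (w, 0) := by simp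
    rw [e] at hweak
    have key := hweak.lintegral_sub_translate_le (isOpen_Ioo.prod hD) h.integrable
      (((h.integrable_deriv 0).smul w).add ((h.integrable_deriv 0).smul (0 : ℝ)))
      (((h.meas_deriv 0).const_smul w).add ((h.meas_deriv 0).const_smul (0 : ℝ)))
      (A := A ×ˢ D) (hA.prod hD)
      (by
        rintro ⟨s, x⟩ ⟨hs, hx⟩ t ht
        exact ⟨hw s hs t ht, by simpa using hx⟩)
    calc ∫⁻ s in A, ∫⁻ x in D, ‖u (s, x) - u (s + w, x)‖ₑ ^ 2
        = ∫⁻ z in A ×ˢ D, ‖u (z + (w, 0)) - u z‖ₑ ^ 2 := by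
          rw [Measure.volume_eq_prod, ← Measure.prod_restrict, lintegral_prod]
          · refine lintegral_congr fun x => lintegral_congr fun s => ?_
            rw [← enorm_neg, neg_sub]
            simp
          · exact (h.measurable_osc_comp (by fun_prop) (by fun_prop)).aemeasurable
      _ ≤ _ := key
      _ = ∫⁻ z in Ioo 0 L ×ˢ D, ‖w‖ₑ ^ 2 * ‖g 0 z‖ₑ ^ 2 := by
          refine lintegral_congr fun z => ?_
          simp [enorm_smul, mul_pow]
      _ = _ := by rw [lintegral_const_mul' _ _ (by finiteness)]

theorem oscBounded_Ioo (L : ℝ) : OscBounded (Ioo 0 L) (Ioo 0 L) (Ioo 0 L) := by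
  have h : Metric.ball (L / 2) (L / 2) = Ioo 0 L := by
    rw [Real.ball_eq_Ioo]; congr 1 <;> ring
  have := oscBounded_ball (D := Ioo 0 L) (p := L / 2) (r := L / 2) h.subset
  rwa [h] at this

theorem IsCrossSection.oscBounded (hD : IsCrossSection D) : OscBounded D D D :=
  oscBounded_self hD.isOpen hD.bounded hD.connected (hD.lipschitz.hasInwardShifts hD.isOpen)

/-- Two points `p` and `q` are compared through the corner `(p.1, q.2)`: one leg lies in a cross
section, the other along the axis, and each is covered by its own kernel. -/
theorem exists_poincare (hL : 0 < L) (hD : IsCrossSection D) :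
    ∃ C : ℝ≥0, ∀ (u : ℝ × R2 → R3) (g : Fin 3 → ℝ × R2 → R3), IsSobolevOn L D u g →
      ∃ a : R3, ∫⁻ z in Ioo 0 L ×ˢ D, ‖u z - a‖ₑ ^ 2
        ≤ C * ∑ i, ∫⁻ z in Ioo 0 L ×ˢ D, ‖g i z‖ₑ ^ 2 := by
  obtain ⟨C₁, h₁⟩ := oscBounded_Ioo L
  obtain ⟨C₂, h₂⟩ := hD.oscBounded
  set μ : Measure ℝ := volume.restrict (Ioo 0 L) with hμ
  set ν : Measure R2 := volume.restrict D with hν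
  have μu : μ univ = ENNReal.ofReal L := by simp [hμ]
  have νu : ν univ = 1 := by simp [hν, hD.area]
  have νp : IsProbabilityMeasure ν := ⟨νu⟩
  have μf : IsFiniteMeasure μ := ⟨by simp [μu]⟩
  refine ⟨((ENNReal.ofReal L)⁻¹ * (2 * (ENNReal.ofReal L * (2 * C₂) + C₁))).toNNReal,
    fun u g h => ?_⟩
  have hL0 : ENNReal.ofReal L ≠ 0 := by simpa using hL
  rw [restrict_prod_eq, ENNReal.coe_toNNReal (by finiteness)]
  set G : Fin 3 → ℝ≥0∞ := fun i => ∫⁻ z, ‖g i z‖ₑ ^ 2 ∂μ.prod ν with hG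
  have k₁ : ∫⁻ s, ∫⁻ t, ∫⁻ x, ‖u (s, x) - u (t, x)‖ₑ ^ 2 ∂ν ∂μ ∂μ ≤ C₁ * G 0 := by
    have := h₁ _ _ (h.isOscKernel_axis hD.isOpen)
    rwa [restrict_prod_eq] at this
  have k₂ : ∫⁻ x, ∫⁻ y, ∫⁻ s, ‖u (s, x) - u (s, y)‖ₑ ^ 2 ∂μ ∂ν ∂ν ≤ C₂ * (2 * (G 1 + G 2)) := by
    have := h₂ _ _ (h.isOscKernel_slice hD.isOpen)
    rwa [restrict_prod_eq, lintegral_add_left ((h.meas_deriv 1).enorm.pow_const 2)] at this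
  have hfm : Measurable fun q => ∫⁻ p, ‖u p - u q‖ₑ ^ 2 ∂μ.prod ν :=
    Measurable.lintegral_prod_right' (f := fun q : (ℝ × R2) × (ℝ × R2) => ‖u q.2 - u q.1‖ₑ ^ 2)
      (h.measurable_osc_comp (by fun_prop) (by fun_prop))
  have total : ∫⁻ q, ∫⁻ p, ‖u p - u q‖ₑ ^ 2 ∂μ.prod ν ∂μ.prod ν
      ≤ 2 * (ENNReal.ofReal L * (C₂ * (2 * (G 1 + G 2))) + C₁ * G 0) := by
    calc ∫⁻ q, ∫⁻ p, ‖u p - u q‖ₑ ^ 2 ∂μ.prod ν ∂μ.prod ν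
        ≤ ∫⁻ q, ∫⁻ p, 2 * (‖u p - u (p.1, q.2)‖ₑ ^ 2 + ‖u (p.1, q.2) - u q‖ₑ ^ 2)
            ∂μ.prod ν ∂μ.prod ν :=
          lintegral_mono fun q => lintegral_mono fun p => enorm_sub_sq_triangle _ _ _
      _ = 2 * ((∫⁻ q, ∫⁻ p, ‖u p - u (p.1, q.2)‖ₑ ^ 2 ∂μ.prod ν ∂μ.prod ν)
            + ∫⁻ q, ∫⁻ p, ‖u (p.1, q.2) - u q‖ₑ ^ 2 ∂μ.prod ν ∂μ.prod ν) := by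
          simp_rw [lintegral_const_mul' _ _ ENNReal.ofNat_ne_top]
          congr 1
          rw [← lintegral_add_left]
          · refine lintegral_congr fun q => ?_
            rw [lintegral_add_left (h.measurable_osc_comp (by fun_prop) (by fun_prop))]
          · exact Measurable.lintegral_prod_right'
              (f := fun q : (ℝ × R2) × (ℝ × R2) => ‖u q.2 - u (q.2.1, q.1.2)‖ₑ ^ 2)
              (h.measurable_osc_comp (by fun_prop) (by fun_prop))
      _ ≤ _ := by
          gcongr
          · rw [lintegral_prod _ (Measurable.aemeasurable (Measurable.lintegral_prod_right'
              (f := fun q : (ℝ × R2) × (ℝ × R2) => ‖u q.2 - u (q.2.1, q.1.2)‖ₑ ^ 2)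
              (h.measurable_osc_comp (by fun_prop) (by fun_prop))))]
            simp only [lintegral_const, μu]
            rw [mul_comm]
            gcongr
            refine le_trans (le_of_eq ?_) k₂
            refine lintegral_congr fun y => ?_
            rw [lintegral_prod_symm _
              (h.measurable_osc_comp (by fun_prop) (by fun_prop)).aemeasurable]
            refine lintegral_congr fun x => lintegral_congr fun s => ?_
            rw [← enorm_neg, neg_sub]
          · refine le_trans (le_of_eq ?_) k₁
            rw [lintegral_prod _ (Measurable.aemeasurable (Measurable.lintegral_prod_right'
              (f := fun q : (ℝ × R2) × (ℝ × R2) => ‖u (q.2.1, q.1.2) - u q.1‖ₑ ^ 2)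
              (h.measurable_osc_comp (by fun_prop) (by fun_prop))))]
            rw [lintegral_lintegral_swap (f := fun s t => ∫⁻ x, ‖u (s, x) - u (t, x)‖ₑ ^ 2 ∂ν)]
            · refine lintegral_congr fun t => ?_
              rw [lintegral_lintegral_swap (f := fun s x => ‖u (s, x) - u (t, x)‖ₑ ^ 2)]
              · refine lintegral_congr fun y => ?_
                rw [lintegral_prod _
                  (h.measurable_osc_comp (by fun_prop) (by fun_prop)).aemeasurable]
                simp [νu]
              · exact (h.measurable_osc_comp (by fun_prop) (by fun_prop)).aemeasurable
            · exact (h.isOscKernel_axis hD.isOpen).measurable.aemeasurable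
  have hne : (μ.prod ν) ≠ 0 := by
    intro h0
    have : (μ.prod ν) univ = 0 := by rw [h0]; rfl
    rw [← univ_prod_univ, Measure.prod_prod, μu, νu, mul_one] at this
    exact hL0 this
  -- Some `q` does no worse than the average over `q` of the inner integral, so the constant can be
  -- the value `u q` and no mean of `u` is required.
  obtain ⟨q, hq⟩ := exists_le_laverage hne hfm.aemeasurable
  refine ⟨u q, hq.trans ?_⟩
  rw [laverage_eq, ENNReal.div_eq_inv_mul, ← univ_prod_univ, Measure.prod_prod, μu, νu, mul_one,
    mul_assoc]
  gcongr
  refine total.trans ?_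
  rw [mul_assoc, Fin.sum_univ_three]
  gcongr 2 * ?_
  calc ENNReal.ofReal L * (C₂ * (2 * (G 1 + G 2))) + C₁ * G 0
      = (ENNReal.ofReal L * (2 * C₂)) * (G 1 + G 2) + C₁ * G 0 := by ring
    _ ≤ (ENNReal.ofReal L * (2 * C₂)) * (G 0 + G 1 + G 2) + C₁ * (G 0 + G 1 + G 2) := by
        gcongr
        · exact le_add_self
        · rw [add_assoc]; exact le_self_add
    _ = _ := by ring

/-- With zero cross-sectional energy the total oscillation over `D` vanishes, so `u` agrees almost
everywhere with its slice through a suitable point `y`. -/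
theorem IsSobolevOn.exists_ae_eq_comp_fst (h : IsSobolevOn L D u g) (hD : IsCrossSection D)
    (h1 : g 1 =ᵐ[volume.restrict (Ioo 0 L ×ˢ D)] 0) (h2 : g 2 =ᵐ[volume.restrict (Ioo 0 L ×ˢ D)] 0) :
    ∃ v : ℝ → R3, StronglyMeasurable v ∧
      u =ᵐ[volume.restrict (Ioo 0 L ×ˢ D)] fun z => v z.1 := by
  obtain ⟨C, hC⟩ := hD.oscBounded
  have key := hC _ _ (h.isOscKernel_slice hD.isOpen)
  have e : ∫⁻ z in Ioo 0 L ×ˢ D, (‖g 1 z‖ₑ ^ 2 + ‖g 2 z‖ₑ ^ 2) = 0 := by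
    refine lintegral_eq_zero_of_ae_eq_zero ?_
    filter_upwards [h1, h2] with z h1 h2
    simp [h1, h2]
  have hk := h.isOscKernel_slice hD.isOpen
  rw [e, mul_zero, mul_zero, nonpos_iff_eq_zero] at key
  have key := (lintegral_eq_zero_iff (hk.measurable.lintegral_prod_right'
    (ν := volume.restrict D))).1 key
  have hne : volume.restrict D ≠ 0 := by
    intro h0
    have : volume.restrict D univ = 0 := by rw [h0]; rfl
    simp [hD.area] at this
  have : NeBot (ae (volume.restrict D)) := ae_neBot.2 hne
  obtain ⟨y, hy⟩ := key.exists
  refine ⟨fun s => u (s, y), h.meas.comp_measurable (by fun_prop), ?_⟩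
  have hy : ∫⁻ x in D, ∫⁻ s in Ioo 0 L, ‖u (s, y) - u (s, x)‖ₑ ^ 2 = 0 := hy
  rw [← lintegral_prod_symm' (fun z : ℝ × R2 => ‖u (z.1, y) - u (z.1, z.2)‖ₑ ^ 2)
    (h.measurable_osc_comp (by fun_prop) (by fun_prop)), ← restrict_prod_eq,
    lintegral_eq_zero_iff (h.measurable_osc_comp (by fun_prop) (by fun_prop))] at hy
  filter_upwards [hy] with z hz
  have : u (z.1, y) - u (z.1, z.2) = 0 := by simpa using hz
  exact (sub_eq_zero.1 this).symm

end

end CurvedRod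

namespace CurvedRod

/-! ### Functions of the axial variable -/

/-- Testing with `φ s * ρ x`, where `ρ` is a bump of unit mass supported in `D`, exhibits the
`ρ`-weighted mean of `g` over the cross section as the derivative of `v`. A weighted mean with
nonnegative weights of total mass one preserves the bound by one. -/
theorem HasWeakDeriv.exists_axial {L : ℝ} {D : Set R2} (hD : IsCrossSection D)
    {u g : ℝ × R2 → R3} {v : ℝ → R3} (hu : IntegrableOn u (Ioo 0 L ×ˢ D))
    (hgm : StronglyMeasurable g) (hg : IntegrableOn g (Ioo 0 L ×ˢ D))
    (h : HasWeakDeriv (Ioo 0 L ×ˢ D) (1, 0) u g)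
    (hg1 : ∀ᵐ z ∂volume.restrict (Ioo 0 L ×ˢ D), ‖g z‖ ≤ 1)
    (huv : u =ᵐ[volume.restrict (Ioo 0 L ×ˢ D)] fun z => v z.1) :
    ∃ v' : ℝ → R3, StronglyMeasurable v' ∧ HasWeakDeriv (Ioo 0 L) 1 v v' ∧
      ∀ᵐ s ∂volume.restrict (Ioo 0 L), ‖v' s‖ ≤ 1 := by
  obtain ⟨x₀, hx₀⟩ := hD.connected.nonempty
  obtain ⟨r, hr, hrD⟩ := Metric.isOpen_iff.1 hD.isOpen x₀ hx₀
  let f : ContDiffBump x₀ := ⟨r / 4, r / 2, by positivity, by linarith⟩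
  set ρ : R2 → ℝ := f.normed volume with hρ
  have ρsmooth : ContDiff ℝ ∞ ρ := f.contDiff_normed
  have ρcomp : HasCompactSupport ρ := f.hasCompactSupport_normed
  have ρsupp : tsupport ρ ⊆ D := by
    rw [hρ, f.tsupport_normed_eq]
    exact (Metric.closedBall_subset_ball (by simp only [f]; linarith)).trans hrD
  have ρnn : ∀ x, 0 ≤ ρ x := f.nonneg_normed
  have ρint : ∫ x in D, ρ x = 1 := by
    rw [setIntegral_eq_integral_of_forall_compl_eq_zero, f.integral_normed]
    intro x hx
    exact image_eq_zero_of_notMem_tsupport fun h => hx (ρsupp h)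
  have ρi : IntegrableOn ρ D := f.integrable_normed.integrableOn
  refine ⟨fun s => ∫ x in D, ρ x • g (s, x), ?_, ?_, ?_⟩
  · exact StronglyMeasurable.integral_prod_right'
      (f := fun z : ℝ × R2 => ρ z.2 • g z)
      (((ρsmooth.continuous.comp continuous_snd).stronglyMeasurable).smul hgm)
  · intro φ hφ hc hs
    set Φ : ℝ × R2 → ℝ := fun z => φ z.1 * ρ z.2 with hΦ
    have hΦd : ContDiff ℝ ∞ Φ := (hφ.comp contDiff_fst).mul (ρsmooth.comp contDiff_snd)
    have hz : ∀ z ∉ tsupport φ ×ˢ tsupport ρ, Φ z = 0 := by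
      intro z hz
      by_cases h1 : z.1 ∈ tsupport φ
      · have h2 : z.2 ∉ tsupport ρ := fun h2 => hz ⟨h1, h2⟩
        simp [hΦ, image_eq_zero_of_notMem_tsupport h2]
      · simp [hΦ, image_eq_zero_of_notMem_tsupport h1]
    have hΦc : HasCompactSupport Φ := HasCompactSupport.intro (hc.isCompact.prod ρcomp.isCompact) hz
    have hΦs : tsupport Φ ⊆ Ioo 0 L ×ˢ D := by
      refine (closure_minimal (fun z hz' => ?_) ((isClosed_tsupport φ).prod (isClosed_tsupport ρ))).trans
        (prod_mono hs ρsupp)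
      by_contra hn
      exact hz' (hz z hn)
    have hder : ∀ z : ℝ × R2, fderiv ℝ Φ z (1, 0) = fderiv ℝ φ z.1 1 * ρ z.2 := by
      intro z
      have h1 : HasFDerivAt (fun z : ℝ × R2 => φ z.1)
          ((fderiv ℝ φ z.1).comp (ContinuousLinearMap.fst ℝ ℝ R2)) z :=
        ((hφ.differentiable (by simp)).differentiableAt.hasFDerivAt).comp z hasFDerivAt_fst
      have h2 : HasFDerivAt (fun z : ℝ × R2 => ρ z.2)
          ((fderiv ℝ ρ z.2).comp (ContinuousLinearMap.snd ℝ ℝ R2)) z :=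
        ((ρsmooth.differentiable (by simp)).differentiableAt.hasFDerivAt).comp z hasFDerivAt_snd
      have h3 : HasFDerivAt Φ _ z := h1.mul h2
      rw [h3.fderiv]
      simp [mul_comm]
    have key := h Φ hΦd hΦc hΦs
    have hd : Continuous fun s => fderiv ℝ φ s 1 :=
      (hφ.continuous_fderiv (by simp)).clm_apply continuous_const
    have bdd : ∀ (ψ : ℝ → ℝ), Continuous ψ → HasCompactSupport ψ → ∀ w : ℝ × R2 → R3,
        IntegrableOn w (Ioo 0 L ×ˢ D) →
        IntegrableOn (fun z => (ψ z.1 * ρ z.2) • w z) (Ioo 0 L ×ˢ D) := by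
      intro ψ hψ hψc w hw
      obtain ⟨C, hC⟩ := hψ.bounded_above_of_compact_support hψc
      obtain ⟨C', hC'⟩ := ρsmooth.continuous.bounded_above_of_compact_support ρcomp
      have hC0 : 0 ≤ C := (norm_nonneg _).trans (hC 0)
      refine hw.bdd_smul (C := C * C') (φ := fun z : ℝ × R2 => ψ z.1 * ρ z.2)
        ((hψ.comp continuous_fst).mul
          (ρsmooth.continuous.comp continuous_snd)).aestronglyMeasurable
        (Eventually.of_forall fun z => ?_)
      rw [norm_mul]
      exact mul_le_mul (hC _) (hC' _) (norm_nonneg _) hC0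
    have e1 : ∫ z in Ioo 0 L ×ˢ D, fderiv ℝ Φ z (1, 0) • u z
        = ∫ s in Ioo 0 L, fderiv ℝ φ s 1 • v s := by
      have hae : ∫ z in Ioo 0 L ×ˢ D, fderiv ℝ Φ z (1, 0) • u z
          = ∫ z in Ioo 0 L ×ˢ D, (fderiv ℝ φ z.1 1 * ρ z.2) • v z.1 := by
        refine integral_congr_ae ?_
        filter_upwards [huv] with z hz
        rw [hz, hder]
      have hi : IntegrableOn (fun z : ℝ × R2 => (fderiv ℝ φ z.1 1 * ρ z.2) • v z.1)
          (Ioo 0 L ×ˢ D) :=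
        bdd _ hd (hc.fderiv_apply ℝ 1) _ (hu.congr huv)
      rw [hae, restrict_prod_eq, integral_prod _ (by rwa [← restrict_prod_eq])]
      refine integral_congr_ae (Eventually.of_forall fun s => ?_)
      simp_rw [mul_smul, smul_comm _ (ρ _)]
      rw [integral_smul_const, ρint, one_smul]
    have e2 : ∫ z in Ioo 0 L ×ˢ D, Φ z • g z
        = ∫ s in Ioo 0 L, φ s • ∫ x in D, ρ x • g (s, x) := by
      have hi := bdd φ hφ.continuous hc g hg
      rw [restrict_prod_eq, integral_prod _ (by rwa [← restrict_prod_eq])]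
      refine integral_congr_ae (Eventually.of_forall fun s => ?_)
      simp_rw [hΦ, mul_smul]
      rw [integral_smul]
    rw [e1, e2] at key
    exact key
  · rw [restrict_prod_eq] at hg1
    filter_upwards [Measure.ae_ae_of_ae_prod hg1] with s hs
    rw [← ρint]
    refine norm_integral_le_of_norm_le ρi ?_
    filter_upwards [hs] with x hx
    rw [norm_smul, Real.norm_of_nonneg (ρnn x)]
    exact mul_le_of_le_one_right (ρnn x) hx

/-! ### Splitting off the axial variable -/

/-- `ℝ³ ≃ ℝ × ℝ²`, `(s, ξ, ζ) ↦ (s, (ξ, ζ))`. -/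
noncomputable def axisEquiv : R3 ≃L[ℝ] ℝ × R2 :=
  LinearEquiv.toContinuousLinearEquiv
    { toFun := fun z => (z 0, !₂[z 1, z 2])
      invFun := fun q => !₂[q.1, q.2 0, q.2 1]
      map_add' := fun x y => by
        refine Prod.ext (by simp) ?_
        ext i
        fin_cases i <;> simp
      map_smul' := fun c x => by
        refine Prod.ext (by simp) ?_
        ext i
        fin_cases i <;> simp
      left_inv := fun z => by
        ext i
        fin_cases i <;> simp
      right_inv := fun q => by
        refine Prod.ext (by simp) ?_
        ext i
        fin_cases i <;> simp }

theorem axisEquiv_apply (z : R3) : axisEquiv z = (z 0, !₂[z 1, z 2]) := rfl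

theorem measurePreserving_axisEquiv : MeasurePreserving axisEquiv := by
  have h1 : MeasurePreserving (fun z : R3 => (z.ofLp : Fin 3 → ℝ)) :=
    PiLp.volume_preserving_ofLp (Fin 3)
  have h2 := (volume_preserving_piFinSuccAbove (fun _ : Fin 3 => ℝ) 0).comp h1
  have h3 := ((MeasurePreserving.id (volume : Measure ℝ)).prod
    (PiLp.volume_preserving_toLp (Fin 2))).comp h2
  convert! h3 using 1
  funext z
  refine Prod.ext ?_ ?_
  · rfl
  · ext i
    fin_cases i <;> rfl

theorem measurableEmbedding_axisEquiv : MeasurableEmbedding axisEquiv :=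
  axisEquiv.toHomeomorph.measurableEmbedding

theorem cyl_eq_preimage (L : ℝ) (D : Set R2) : cyl L D = axisEquiv ⁻¹' (Ioo 0 L ×ˢ D) := rfl

theorem measurePreserving_axisEquiv_cyl (L : ℝ) (D : Set R2) :
    MeasurePreserving axisEquiv (volume.restrict (cyl L D)) (volume.restrict (Ioo 0 L ×ˢ D)) :=
  measurePreserving_axisEquiv.restrict_preimage_emb measurableEmbedding_axisEquiv (Ioo 0 L ×ˢ D)

theorem IsCrossSection.measurePreserving_axis {D : Set R2} (hD : IsCrossSection D) (L : ℝ) :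
    MeasurePreserving (fun z : R3 => z 0) (volume.restrict (cyl L D))
      (volume.restrict (Ioo 0 L)) := by
  have νp : IsProbabilityMeasure (volume.restrict D) := ⟨by simp [hD.area]⟩
  have := (measurePreserving_fst (μ := volume.restrict (Ioo 0 L)) (ν := volume.restrict D))
  rw [← restrict_prod_eq] at this
  exact this.comp (measurePreserving_axisEquiv_cyl L D)

theorem isOpen_cyl {L : ℝ} {D : Set R2} (hD : IsOpen D) : IsOpen (cyl L D) :=
  (isOpen_Ioo.prod hD).preimage axisEquiv.continuous

theorem volume_cyl (L : ℝ) {D : Set R2} (hD : IsCrossSection D) :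
    volume (cyl L D) = ENNReal.ofReal L := by
  rw [cyl_eq_preimage, measurePreserving_axisEquiv.measure_preimage_emb
    measurableEmbedding_axisEquiv, Measure.volume_eq_prod, Measure.prod_prod, hD.area]
  simp

theorem HasWeakDeriv.comp_axisEquiv_symm {L : ℝ} {D : Set R2} {u g : R3 → R3} {e : R3}
    (h : HasWeakDeriv (cyl L D) e u g) :
    HasWeakDeriv (Ioo 0 L ×ˢ D) (axisEquiv e) (fun q => u (axisEquiv.symm q))
      (fun q => g (axisEquiv.symm q)) := by
  intro φ hφ hc hs
  have h1 : HasCompactSupport fun z => φ (axisEquiv z) :=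
    hc.comp_homeomorph axisEquiv.toHomeomorph
  have h2 : tsupport (fun z => φ (axisEquiv z)) ⊆ cyl L D := fun z hz =>
    hs (tsupport_comp_subset_preimage φ axisEquiv.continuous hz)
  have key := h (fun z => φ (axisEquiv z)) (hφ.comp axisEquiv.contDiff) h1 h2
  have hder : ∀ z, fderiv ℝ (fun z => φ (axisEquiv z)) z e = fderiv ℝ φ (axisEquiv z) (axisEquiv e) := by
    intro z
    have := ((hφ.differentiable (by simp)).differentiableAt.hasFDerivAt
      (x := axisEquiv z)).comp z axisEquiv.hasFDerivAt
    have h3 := this.fderiv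
    simp only [Function.comp_def] at h3
    rw [h3]
    rfl
  have e1 := (measurePreserving_axisEquiv_cyl L D).integral_comp measurableEmbedding_axisEquiv
    (fun q => fderiv ℝ φ q (axisEquiv e) • u (axisEquiv.symm q))
  have e2 := (measurePreserving_axisEquiv_cyl L D).integral_comp measurableEmbedding_axisEquiv
    (fun q => φ q • g (axisEquiv.symm q))
  rw [← e1, ← e2]
  simp only [ContinuousLinearEquiv.symm_apply_apply]
  simp_rw [hder] at key
  exact key

theorem W12.isSobolevOn {L : ℝ} {D : Set R2} (hD : IsCrossSection D) (U : W12 (cyl L D)) :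
    IsSobolevOn L D (fun q => W12.toL2 U (axisEquiv.symm q))
      (fun i q => W12.partialDeriv U i (axisEquiv.symm q)) := by
  have hm : Measurable axisEquiv.symm := axisEquiv.symm.continuous.measurable
  have hfin : IsFiniteMeasure (volume.restrict (cyl L D)) := ⟨by simp [volume_cyl L hD]⟩
  have hi : ∀ f : L2 (cyl L D), IntegrableOn (fun q => f (axisEquiv.symm q)) (Ioo 0 L ×ˢ D) := by
    intro f
    have h1 : Integrable f (volume.restrict (cyl L D)) := (Lp.memLp f).integrable (by norm_num)
    have := (measurePreserving_axisEquiv_cyl L D).integrable_comp_emb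
      measurableEmbedding_axisEquiv (g := fun q => f (axisEquiv.symm q))
    refine this.1 ?_
    simpa [Function.comp_def] using h1
  have e0 : axisEquiv (EuclideanSpace.single 0 1) = (1, 0) := by
    rw [axisEquiv_apply]
    refine Prod.ext (by simp) ?_
    ext i
    fin_cases i <;> simp
  have e1 : axisEquiv (EuclideanSpace.single 1 1) = (0, EuclideanSpace.single 0 1) := by
    rw [axisEquiv_apply]
    refine Prod.ext (by simp) ?_
    ext i
    fin_cases i <;> simp
  have e2 : axisEquiv (EuclideanSpace.single 2 1) = (0, EuclideanSpace.single 1 1) := by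
    rw [axisEquiv_apply]
    refine Prod.ext (by simp) ?_
    ext i
    fin_cases i <;> simp
  refine ⟨(Lp.stronglyMeasurable _).comp_measurable hm,
    fun i => (Lp.stronglyMeasurable _).comp_measurable hm, hi _, fun i => hi _, ?_, ?_, ?_⟩
  · rw [← e0]; exact (U.2 0).comp_axisEquiv_symm
  · rw [← e1]; exact (U.2 1).comp_axisEquiv_symm
  · rw [← e2]; exact (U.2 2).comp_axisEquiv_symm

theorem lintegral_cyl_eq (L : ℝ) (D : Set R2) (f : R3 → ℝ≥0∞) :
    ∫⁻ q in Ioo 0 L ×ˢ D, f (axisEquiv.symm q) = ∫⁻ z in cyl L D, f z := by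
  rw [← (measurePreserving_axisEquiv_cyl L D).lintegral_comp_emb measurableEmbedding_axisEquiv]
  simp

theorem ae_cyl_iff (L : ℝ) (D : Set R2) (p : R3 → Prop) :
    (∀ᵐ q ∂volume.restrict (Ioo 0 L ×ˢ D), p (axisEquiv.symm q))
      ↔ ∀ᵐ z ∂volume.restrict (cyl L D), p z := by
  rw [← (measurePreserving_axisEquiv_cyl L D).map_eq,
    measurableEmbedding_axisEquiv.ae_map_iff]
  simp

theorem W12.exists_poincare {L : ℝ} {D : Set R2} (hL : 0 < L) (hD : IsCrossSection D) :
    ∃ C : ℝ≥0, ∀ U : W12 (cyl L D), ∃ a : R3,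
      ∫⁻ z in cyl L D, ‖W12.toL2 U z - a‖ₑ ^ 2
        ≤ C * ∑ i, ∫⁻ z in cyl L D, ‖W12.partialDeriv U i z‖ₑ ^ 2 := by
  obtain ⟨C, hC⟩ := CurvedRod.exists_poincare hL hD
  refine ⟨C, fun U => ?_⟩
  obtain ⟨a, ha⟩ := hC _ _ (W12.isSobolevOn hD U)
  refine ⟨a, ?_⟩
  rw [← lintegral_cyl_eq]
  refine ha.trans (le_of_eq ?_)
  congr 1
  refine Finset.sum_congr rfl fun i _ => ?_
  rw [← lintegral_cyl_eq]

theorem W12.toL2_mem_limitClass {L : ℝ} {D : Set R2} (hD : IsCrossSection D) (U : W12 (cyl L D))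
    (h1 : W12.partialDeriv U 1 = 0) (h2 : W12.partialDeriv U 2 = 0)
    (h0 : ∀ᵐ z ∂volume.restrict (cyl L D), ‖W12.partialDeriv U 0 z‖ ≤ 1) :
    W12.toL2 U ∈ limitClass L D := by
  have h := W12.isSobolevOn hD U
  have hz : ∀ i, W12.partialDeriv U i = 0 →
      (fun q => W12.partialDeriv U i (axisEquiv.symm q)) =ᵐ[volume.restrict (Ioo 0 L ×ˢ D)] 0 := by
    intro i hi
    refine (ae_cyl_iff L D (fun z => W12.partialDeriv U i z = 0)).2 ?_
    rw [hi]
    exact Lp.coeFn_zero _ _ _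
  obtain ⟨v, hvm, hv⟩ := h.exists_ae_eq_comp_fst hD (hz 1 h1) (hz 2 h2)
  obtain ⟨v', hvm', hweak, hle⟩ := h.deriv_axis.exists_axial hD h.integrable (h.meas_deriv 0)
    (h.integrable_deriv 0) ((ae_cyl_iff L D (fun z => ‖W12.partialDeriv U 0 z‖ ≤ 1)).2 h0) hv
  have hae : W12.toL2 U =ᵐ[volume.restrict (cyl L D)] fun z => v (z 0) :=
    (ae_cyl_iff L D (fun z => W12.toL2 U z = v (z 0))).1 hv
  refine ⟨v, v', ?_, ?_, hweak, hle, hae⟩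
  · have hmp := hD.measurePreserving_axis L
    have h3 : MemLp (fun z : R3 => v (z 0)) 2 (volume.restrict (cyl L D)) :=
      (memLp_congr_ae hae).1 (Lp.memLp _)
    rw [← hmp.map_eq, memLp_map_measure_iff hvm.aestronglyMeasurable hmp.measurable.aemeasurable]
    exact h3
  · exact MemLp.of_bound hvm'.aestronglyMeasurable 1 hle

end CurvedRod

namespace CurvedRod

/-! ### Weak sequential compactness -/

theorem tendsto_toWeakSpace_iff {H : Type*} [NormedAddCommGroup H] [NormedSpace ℝ H]
    {ι : Type*} {l : Filter ι} {u : ι → H} {v : H} :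
    Tendsto (fun j => toWeakSpace ℝ H (u j)) l (𝓝 (toWeakSpace ℝ H v)) ↔
      ∀ f : StrongDual ℝ H, Tendsto (fun j => f (u j)) l (𝓝 (f v)) := by
  have hinj : Function.Injective (topDualPairing ℝ H).flip := by
    intro x y hxy
    refine (SeparatingDual.eq_iff_forall_dual_eq (R := ℝ)).2 fun f => ?_
    exact LinearMap.congr_fun hxy f
  exact WeakBilin.tendsto_iff_forall_eval_tendsto _ hinj

/-- The Riesz isomorphism turns weak convergence in a Hilbert space into weak-* convergence in its
dual, where closed balls are sequentially compact by separability. -/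
theorem exists_weakly_convergent_subseq {H : Type*} [NormedAddCommGroup H] [InnerProductSpace ℝ H]
    [CompleteSpace H] [TopologicalSpace.SeparableSpace H] {u : ℕ → H} {M : ℝ}
    (hu : ∀ j, ‖u j‖ ≤ M) :
    ∃ (σ : ℕ → ℕ) (v : H), StrictMono σ ∧
      Tendsto (fun j => toWeakSpace ℝ H (u (σ j))) atTop (𝓝 (toWeakSpace ℝ H v)) := by
  have hc := WeakDual.isSeqCompact_closedBall ℝ H 0 M
  obtain ⟨a, -, σ, hσ, ha⟩ := hc (x := fun j => StrongDual.toWeakDual (InnerProductSpace.toDual ℝ H (u j)))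
    (fun j => by
      simp only [mem_preimage, mem_closedBall_zero_iff]
      change ‖InnerProductSpace.toDual ℝ H (u j)‖ ≤ M
      rw [LinearIsometryEquiv.norm_map]
      exact hu j)
  refine ⟨σ, (InnerProductSpace.toDual ℝ H).symm (WeakDual.toStrongDual a), hσ, ?_⟩
  rw [tendsto_toWeakSpace_iff]
  intro f
  have h1 := tendsto_iff_forall_eval_tendsto_topDualPairing.1 ha
    ((InnerProductSpace.toDual ℝ H).symm f)
  have e1 : ∀ x : H, f x = inner ℝ x ((InnerProductSpace.toDual ℝ H).symm f) := fun x => by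
    rw [real_inner_comm, InnerProductSpace.toDual_symm_apply]
  have e2 : f ((InnerProductSpace.toDual ℝ H).symm (WeakDual.toStrongDual a))
      = a ((InnerProductSpace.toDual ℝ H).symm f) := by
    rw [e1, InnerProductSpace.toDual_symm_apply]
    rfl
  rw [e2]
  refine h1.congr fun j => ?_
  rw [e1]
  rfl

/-! ### The Hilbert space structure of `W^{1,2}` -/

theorem enorm_sq_eq_lintegral {Ω : Set R3} (f : L2 Ω) : ‖f‖ₑ ^ 2 = ∫⁻ z in Ω, ‖f z‖ₑ ^ 2 := by
  rw [Lp.enorm_def]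
  have := eLpNorm_nnreal_pow_eq_lintegral (f := f) (μ := volume.restrict Ω) (p := 2) (by norm_num)
  simpa using this

theorem norm_le_of_lintegral_le {Ω : Set R3} {f : L2 Ω} {M : ℝ≥0}
    (h : ∫⁻ z in Ω, ‖f z‖ₑ ^ 2 ≤ (M : ℝ≥0∞) ^ 2) : ‖f‖ ≤ M := by
  rw [← enorm_sq_eq_lintegral, ENNReal.pow_le_pow_left_iff (by norm_num), enorm_eq_nnnorm,
    ENNReal.coe_le_coe] at h
  exact h

/-- Each scalar component of a pairing with a test function is an `L²` inner product, hence
continuous in `u`. -/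
theorem exists_test_inner {Ω : Set R3} {ψ : R3 → ℝ} (hψ : Continuous ψ) (hc : HasCompactSupport ψ)
    (c : R3) : ∃ T : L2 Ω, ∀ u : L2 Ω, inner ℝ T u = inner ℝ c (∫ x in Ω, ψ x • u x) := by
  have h1 : MemLp (fun x => ψ x • c) 2 (volume.restrict Ω) :=
    (hψ.smul continuous_const).memLp_of_hasCompactSupport hc.smul_right
  refine ⟨h1.toLp _, fun u => ?_⟩
  rw [L2.inner_def, ← integral_inner (integrable_smul_L2 hψ hc u)]
  refine integral_congr_ae ?_
  filter_upwards [h1.coeFn_toLp] with x hx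
  rw [hx, real_inner_smul_left, real_inner_smul_right]

/-- Tested against every vector `c`, the weak-derivative condition becomes an intersection of
equalities between continuous functionals. Closedness gives completeness, which the weak compactness
argument requires. -/
theorem isClosed_W12 (Ω : Set R3) :
    IsClosed (W12 Ω : Set (WithLp 2 (L2 Ω × PiLp 2 fun _ : Fin 3 => L2 Ω))) := by
  have hfst : Continuous fun U : WithLp 2 (L2 Ω × PiLp 2 fun _ : Fin 3 => L2 Ω) => U.fst :=
    WithLp.continuous_fst 2 _ _
  have hsnd : ∀ i, Continuous fun U : WithLp 2 (L2 Ω × PiLp 2 fun _ : Fin 3 => L2 Ω) => U.snd i :=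
    fun i => (PiLp.continuous_apply 2 _ i).comp (WithLp.continuous_snd 2 _ _)
  have e : (W12 Ω : Set (WithLp 2 (L2 Ω × PiLp 2 fun _ : Fin 3 => L2 Ω)))
      = {U | ∀ (i : Fin 3) (φ : R3 → ℝ), ContDiff ℝ ∞ φ → HasCompactSupport φ → tsupport φ ⊆ Ω →
        ∀ c : R3, inner ℝ c (∫ x in Ω, (fderiv ℝ φ x (EuclideanSpace.single i 1)) • U.fst x)
          = -inner ℝ c (∫ x in Ω, φ x • U.snd i x)} := by
    ext U
    constructor
    · intro hU i φ h1 h2 h3 c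
      rw [hU i φ h1 h2 h3, inner_neg_right]
    · intro hU i φ h1 h2 h3
      refine ext_inner_left ℝ fun c => ?_
      rw [hU i φ h1 h2 h3 c, inner_neg_right]
  rw [e]
  simp only [ofPred_forall]
  refine isClosed_iInter fun i => isClosed_iInter fun φ => isClosed_iInter fun h1 =>
    isClosed_iInter fun h2 => isClosed_iInter fun h3 => isClosed_iInter fun c => ?_
  have hd : Continuous fun x => fderiv ℝ φ x (EuclideanSpace.single i 1) :=
    (h1.continuous_fderiv (by simp)).clm_apply continuous_const
  obtain ⟨T, hT⟩ := exists_test_inner (Ω := Ω) hd (h2.fderiv_apply ℝ _) c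
  obtain ⟨S, hS⟩ := exists_test_inner (Ω := Ω) h1.continuous h2 c
  simp_rw [← hT, ← hS]
  exact isClosed_eq (continuous_const.inner hfst) (continuous_const.inner (hsnd i)).neg

noncomputable instance (Ω : Set R3) : CompleteSpace (W12 Ω) := (isClosed_W12 Ω).completeSpace_coe

instance (Ω : Set R3) : TopologicalSpace.SeparableSpace (W12 Ω) := by
  have : Fact ((2 : ℝ≥0∞) ≠ ⊤) := ⟨by norm_num⟩
  have h0 : SecondCountableTopology (L2 Ω) := inferInstance
  have h1 : SecondCountableTopology (PiLp 2 fun _ : Fin 3 => L2 Ω) :=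
    (PiLp.homeomorph 2 fun _ : Fin 3 => L2 Ω).secondCountableTopology
  have h2 : SecondCountableTopology (WithLp 2 (L2 Ω × PiLp 2 fun _ : Fin 3 => L2 Ω)) :=
    (WithLp.homeomorphProd 2 (L2 Ω) (PiLp 2 fun _ : Fin 3 => L2 Ω)).secondCountableTopology
  infer_instance

theorem W12.norm_sq_eq {Ω : Set R3} (U : W12 Ω) :
    ‖U‖ ^ 2 = ‖W12.toL2 U‖ ^ 2 + ∑ i, ‖W12.partialDeriv U i‖ ^ 2 := by
  change ‖U.1‖ ^ 2 = _
  rw [WithLp.prod_norm_sq_eq_of_L2, PiLp.norm_sq_eq_of_L2]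
  rfl

theorem W12.norm_le {Ω : Set R3} {U : W12 Ω} {M : ℝ} (h0 : ‖W12.toL2 U‖ ≤ M)
    (h : ∀ i, ‖W12.partialDeriv U i‖ ≤ M) : ‖U‖ ≤ 2 * M := by
  have hM : 0 ≤ M := (norm_nonneg _).trans h0
  refine abs_le_of_sq_le_sq' ?_ (by positivity) |>.2
  rw [W12.norm_sq_eq, Fin.sum_univ_three]
  have h1 : ∀ f : L2 Ω, ‖f‖ ≤ M → ‖f‖ ^ 2 ≤ M ^ 2 := fun f hf => by gcongr
  nlinarith [h1 _ h0, h1 _ (h 0), h1 _ (h 1), h1 _ (h 2)]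

/-- `W^{1,2} → L²` as a continuous linear map. -/
noncomputable def toL2L (Ω : Set R3) : W12 Ω →L[ℝ] L2 Ω :=
  (WithLp.fstL 2 ℝ (L2 Ω) (PiLp 2 fun _ : Fin 3 => L2 Ω)).comp (W12 Ω).subtypeL

/-- The weak partial derivative as a continuous linear map. -/
noncomputable def partialDerivL (Ω : Set R3) (i : Fin 3) : W12 Ω →L[ℝ] L2 Ω :=
  (PiLp.proj 2 (fun _ : Fin 3 => L2 Ω) i).comp
    ((WithLp.sndL 2 ℝ (L2 Ω) (PiLp 2 fun _ : Fin 3 => L2 Ω)).comp (W12 Ω).subtypeL)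

theorem W12.TendstoWeakly.inner_clm {Ω : Set R3} {U : ℕ → W12 Ω} {V : W12 Ω}
    (h : W12.TendstoWeakly U V) (T : W12 Ω →L[ℝ] L2 Ω) (y : L2 Ω) :
    Tendsto (fun j => inner ℝ y (T (U j))) atTop (𝓝 (inner ℝ y (T V))) :=
  tendsto_toWeakSpace_iff.1 h ((innerSL ℝ y).comp T)

theorem W12.TendstoWeakly.toL2_eq {Ω : Set R3} {U : ℕ → W12 Ω} {V : W12 Ω}
    (h : W12.TendstoWeakly U V) {v : L2 Ω} (hv : Tendsto (fun j => W12.toL2 (U j)) atTop (𝓝 v)) :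
    W12.toL2 V = v := by
  refine ext_inner_left ℝ fun y => ?_
  exact tendsto_nhds_unique (h.inner_clm (toL2L Ω) y) (tendsto_const_nhds.inner hv)

theorem W12.TendstoWeakly.partialDeriv_eq_zero {Ω : Set R3} {U : ℕ → W12 Ω} {V : W12 Ω}
    (h : W12.TendstoWeakly U V) {i : Fin 3}
    (h0 : Tendsto (fun j => ‖W12.partialDeriv (U j) i‖) atTop (𝓝 0)) :
    W12.partialDeriv V i = 0 := by
  refine ext_inner_left ℝ fun y => ?_
  exact tendsto_nhds_unique (h.inner_clm (partialDerivL Ω i) y)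
    (tendsto_const_nhds.inner (tendsto_zero_iff_norm_tendsto_zero.2 h0))

/-- Test with `G / |G|` on `A = {|G| > 1}`. The limit of the pairings is the integral of `|G|` over
`A`, while each pairing is at most `μ A` plus the integral of the positive part of `|g j| - 1`.
Hence `|G| - 1`, which is positive on `A`, has zero integral there, and `A` is null. -/
theorem norm_le_one_of_weak_limit {Ω : Set R3} (hΩ : volume Ω ≠ ⊤) {g : ℕ → L2 Ω} {G : L2 Ω}
    (hg : ∀ y : L2 Ω, Tendsto (fun j => inner ℝ y (g j)) atTop (𝓝 (inner ℝ y G)))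
    (he : Tendsto (fun j => ∫⁻ z in Ω, (‖g j z‖ₑ - 1) ^ 2) atTop (𝓝 0)) :
    ∀ᵐ z ∂volume.restrict Ω, ‖G z‖ ≤ 1 := by
  set μ : Measure R3 := volume.restrict Ω with hμ
  have hμf : IsFiniteMeasure μ := ⟨by simpa [hμ] using hΩ.lt_top⟩
  have hGm : StronglyMeasurable G := Lp.stronglyMeasurable G
  set A : Set R3 := {z | 1 < ‖G z‖} with hA
  have hAm : MeasurableSet A := measurableSet_lt measurable_const hGm.norm.measurable
  set ψ : R3 → R3 := A.indicator fun z => ‖G z‖⁻¹ • G z with hψ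
  have hψm : StronglyMeasurable ψ :=
    ((hGm.norm.measurable.inv.stronglyMeasurable).smul hGm).indicator hAm
  have hψ1 : ∀ z, ‖ψ z‖ ≤ A.indicator 1 z := by
    intro z
    by_cases hz : z ∈ A
    · have h0 : ‖G z‖ ≠ 0 := (zero_lt_one.trans hz).ne'
      simp [hψ, hz, norm_smul, h0]
    · simp [hψ, hz]
  have hψL : MemLp ψ 2 μ := by
    refine MemLp.of_bound hψm.aestronglyMeasurable 1 (Eventually.of_forall fun z => (hψ1 z).trans ?_)
    exact indicator_le_self' (fun _ _ => zero_le_one) z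
  set y : L2 Ω := hψL.toLp ψ with hy
  have hyc : y =ᵐ[μ] ψ := hψL.coeFn_toLp
  have hAfin : μ A ≠ ⊤ := measure_ne_top _ _
  -- Subtraction in `ℝ≥0∞` is truncated, so this integrand is the positive part; Cauchy–Schwarz on
  -- the finite measure passes from `L²` to `L¹`.
  have err : Tendsto (fun j => ∫⁻ z, (‖g j z‖ₑ - 1) ∂μ) atTop (𝓝 0) := by
    have hm : ∀ j, Measurable fun z => ‖g j z‖ₑ - 1 := fun j =>
      (Lp.stronglyMeasurable (g j)).enorm.sub_const 1
    have hle : ∀ j, ∫⁻ z, (‖g j z‖ₑ - 1) ∂μ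
        ≤ (∫⁻ z, (‖g j z‖ₑ - 1) ^ 2 ∂μ) ^ (1 / 2 : ℝ) * μ univ ^ (1 / 2 : ℝ) := by
      intro j
      have := ENNReal.lintegral_mul_le_Lp_mul_Lq μ Real.HolderConjugate.two_two
        (hm j).aemeasurable (aemeasurable_const (b := (1 : ℝ≥0∞)))
      simpa using this
    refine tendsto_of_tendsto_of_tendsto_of_le_of_le tendsto_const_nhds ?_
      (fun j => zero_le) hle
    have h1 : Tendsto (fun j => (∫⁻ z, (‖g j z‖ₑ - 1) ^ 2 ∂μ) ^ (1 / 2 : ℝ)) atTop (𝓝 0) := by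
      have := (ENNReal.continuous_rpow_const (y := (1 / 2 : ℝ))).tendsto 0 |>.comp he
      simpa [Function.comp_def] using this
    have h2 := ENNReal.Tendsto.mul_const (b := μ univ ^ (1 / 2 : ℝ)) h1
      (Or.inr (ENNReal.rpow_ne_top_of_nonneg (by norm_num) (measure_ne_top _ _)))
    simpa using h2
  have upper : ∀ j, ENNReal.ofReal (inner ℝ y (g j)) ≤ μ A + ∫⁻ z, (‖g j z‖ₑ - 1) ∂μ := by
    intro j
    calc ENNReal.ofReal (inner ℝ y (g j)) ≤ ∫⁻ z, ‖(inner ℝ (y z) (g j z) : ℝ)‖ₑ ∂μ := by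
          rw [L2.inner_def]
          refine (ENNReal.ofReal_le_ofReal (Real.le_norm_self _)).trans ?_
          rw [ofReal_norm]
          exact enorm_integral_le_lintegral_enorm _
      _ ≤ ∫⁻ z, (A.indicator 1 z + (‖g j z‖ₑ - 1)) ∂μ := by
          refine lintegral_mono_ae ?_
          filter_upwards [hyc] with z hz
          rw [hz, ← ofReal_norm]
          by_cases hzA : z ∈ A
          · have h1 : ‖(inner ℝ (ψ z) (g j z) : ℝ)‖ ≤ ‖g j z‖ := by
              refine (norm_inner_le_norm _ _).trans ?_
              have := hψ1 z
              rw [indicator_of_mem hzA] at this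
              exact mul_le_of_le_one_left (norm_nonneg _) this
            refine (ENNReal.ofReal_le_ofReal h1).trans ?_
            rw [ofReal_norm, indicator_of_mem hzA]
            exact le_add_tsub
          · simp [hψ, hzA]
      _ = _ := by
          rw [lintegral_add_left (measurable_one.indicator hAm), lintegral_indicator_one hAm]
  have lim : ENNReal.ofReal (inner ℝ y G) ≤ μ A := by
    refine le_of_tendsto_of_tendsto' ((ENNReal.continuous_ofReal.tendsto _).comp (hg y)) ?_ upper
    simpa only [add_zero] using err.const_add (μ A)
  have eqG : ENNReal.ofReal (inner ℝ y G) = ∫⁻ z in A, ‖G z‖ₑ ∂μ := by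
    have h1 : inner ℝ y G = ∫ z, A.indicator (fun z => ‖G z‖) z ∂μ := by
      rw [L2.inner_def]
      refine integral_congr_ae ?_
      filter_upwards [hyc] with z hz
      rw [hz]
      by_cases hzA : z ∈ A
      · have h0 : ‖G z‖ ≠ 0 := (zero_lt_one.trans hzA).ne'
        simp only [hψ, hzA, indicator_of_mem, real_inner_smul_left, real_inner_self_eq_norm_sq]
        field_simp
      · simp [hψ, hzA]
    have hi : Integrable G μ := (Lp.memLp G).integrable (by norm_num)
    rw [h1, integral_indicator hAm, ofReal_integral_eq_lintegral_ofReal hi.norm.integrableOn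
      (Eventually.of_forall fun z => norm_nonneg _)]
    simp_rw [ofReal_norm]
  rw [eqG] at lim
  have hsub : ∫⁻ z in A, (‖G z‖ₑ - 1) ∂μ = 0 := by
    have h1 : ∫⁻ z in A, (‖G z‖ₑ - 1) ∂μ ≤ ∫⁻ z in A, ‖G z‖ₑ ∂μ - ∫⁻ z in A, 1 ∂μ := by
      rw [lintegral_sub measurable_const (by simp [hAfin])]
      rw [Filter.EventuallyLE, ae_restrict_iff' hAm]
      refine Eventually.of_forall fun z hz => ?_
      rw [← ofReal_norm, ENNReal.one_le_ofReal]
      exact hz.le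
    have h2 : ∫⁻ z in A, ‖G z‖ₑ ∂μ - ∫⁻ z in A, 1 ∂μ = 0 := by
      rw [setLIntegral_one]
      exact tsub_eq_zero_of_le lim
    exact nonpos_iff_eq_zero.1 (h1.trans h2.le)
  rw [lintegral_eq_zero_iff (hGm.enorm.sub_const 1), Filter.EventuallyEq,
    ae_restrict_iff' hAm] at hsub
  filter_upwards [hsub] with z hz
  by_contra hn
  have hzA : z ∈ A := not_le.1 hn
  have h1 : ‖G z‖ₑ ≤ 1 := tsub_eq_zero_iff_le.1 (hz hzA)
  rw [← ofReal_norm, ENNReal.ofReal_le_one] at h1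
  exact hn h1

/-! ### Smooth functions as elements of `W^{1,2}` -/

theorem IsCrossSection.isBounded_cyl {D : Set R2} (hD : IsCrossSection D) (L : ℝ) :
    Bornology.IsBounded (cyl L D) := by
  have h1 : cyl L D = axisEquiv.symm '' (Ioo 0 L ×ˢ D) := by
    rw [cyl_eq_preimage, ← ContinuousLinearEquiv.image_symm_eq_preimage]
  rw [h1]
  exact axisEquiv.symm.lipschitz.isBounded_image ((Metric.isBounded_Ioo _ _).prod hD.bounded)

theorem IsCrossSection.memLp_of_continuous {D : Set R2} (hD : IsCrossSection D) (L : ℝ)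
    {f : R3 → R3} (hf : Continuous f) : MemLp f 2 (volume.restrict (cyl L D)) := by
  have hfin : IsFiniteMeasure (volume.restrict (cyl L D)) := ⟨by simp [volume_cyl L hD]⟩
  obtain ⟨C, hC⟩ := (hD.isBounded_cyl L).isCompact_closure.exists_bound_of_continuousOn
    hf.continuousOn
  refine MemLp.of_bound hf.aestronglyMeasurable C ?_
  filter_upwards [ae_restrict_mem (isOpen_cyl hD.isOpen).measurableSet] with z hz
  exact hC z (subset_closure hz)

/-- The function is `C¹` on all of `ℝ³` and test functions vanish off `Ω`, so integration by parts
takes place on the whole space and the boundary of `Ω` plays no role. -/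
theorem exists_W12_of_contDiff {L : ℝ} {D : Set R2} (hD : IsCrossSection D) {f : R3 → R3}
    (hf : ContDiff ℝ 1 f) :
    ∃ U : W12 (cyl L D), W12.toL2 U =ᵐ[volume.restrict (cyl L D)] f ∧
      ∀ i, W12.partialDeriv U i =ᵐ[volume.restrict (cyl L D)]
        fun z => fderiv ℝ f z (EuclideanSpace.single i 1) := by
  have hd : ∀ i, Continuous fun z => fderiv ℝ f z (EuclideanSpace.single i 1) := fun i =>
    (hf.continuous_fderiv (by simp)).clm_apply continuous_const
  have m0 := hD.memLp_of_continuous L hf.continuous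
  have m1 := fun i => hD.memLp_of_continuous L (hd i)
  refine ⟨⟨WithLp.toLp 2 (m0.toLp f, WithLp.toLp 2 fun i => (m1 i).toLp _), ?_⟩,
    m0.coeFn_toLp, fun i => (m1 i).coeFn_toLp⟩
  intro i φ hφ hc hs
  change ∫ x in cyl L D, (fderiv ℝ φ x (EuclideanSpace.single i 1)) • (m0.toLp f : L2 (cyl L D)) x
      = -∫ x in cyl L D, φ x • ((m1 i).toLp _ : L2 (cyl L D)) x
  have hφd : Continuous fun x => fderiv ℝ φ x (EuclideanSpace.single i 1) :=
    (hφ.continuous_fderiv (by simp)).clm_apply continuous_const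
  have hcd : HasCompactSupport fun x => fderiv ℝ φ x (EuclideanSpace.single i 1) :=
    hc.fderiv_apply ℝ _
  have e1 : ∫ x in cyl L D, (fderiv ℝ φ x (EuclideanSpace.single i 1)) • (m0.toLp f : L2 (cyl L D)) x
      = ∫ x, (fderiv ℝ φ x (EuclideanSpace.single i 1)) • f x := by
    rw [← setIntegral_eq_integral_of_forall_compl_eq_zero (s := cyl L D)
      (f := fun x => (fderiv ℝ φ x (EuclideanSpace.single i 1)) • f x)]
    · refine integral_congr_ae ?_
      filter_upwards [m0.coeFn_toLp] with x hx
      rw [hx]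
    · intro x hx
      have : x ∉ tsupport φ := fun h => hx (hs h)
      have h0 : fderiv ℝ φ x = 0 := fderiv_of_notMem_tsupport ℝ this
      simp [h0]
  have e2 : ∫ x in cyl L D, φ x • ((m1 i).toLp _ : L2 (cyl L D)) x
      = ∫ x, φ x • fderiv ℝ f x (EuclideanSpace.single i 1) := by
    rw [← setIntegral_eq_integral_of_forall_compl_eq_zero (s := cyl L D)
      (f := fun x => φ x • fderiv ℝ f x (EuclideanSpace.single i 1))]
    · refine integral_congr_ae ?_
      filter_upwards [(m1 i).coeFn_toLp] with x hx
      rw [hx]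
    · intro x hx
      have : x ∉ tsupport φ := fun h => hx (hs h)
      rw [image_eq_zero_of_notMem_tsupport this, zero_smul]
  rw [e1, e2, integral_smul_fderiv_eq_neg_fderiv_smul_of_integrable, neg_neg]
  · exact (hφd.smul hf.continuous).integrable_of_hasCompactSupport hcd.smul_right
  · exact (hφ.continuous.smul (hd i)).integrable_of_hasCompactSupport hc.smul_right
  · exact (hφ.continuous.smul hf.continuous).integrable_of_hasCompactSupport hc.smul_right
  · exact fun x _ => (hφ.differentiable (by simp)).differentiableAt
  · exact fun x _ => (hf.differentiable (by simp)).differentiableAt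

end CurvedRod

namespace CurvedRod

/-! ### Matrices near the rotation group -/

/-- The columns of a matrix as Euclidean vectors, as a continuous linear map. -/
noncomputable def columnL (k : Fin 3) : M3 →L[ℝ] R3 :=
  LinearMap.toContinuousLinearMap
    { toFun := fun A => WithLp.toLp 2 fun i => A i k
      map_add' := fun A B => by ext i; simp
      map_smul' := fun c A => by ext i; simp }

theorem columnL_apply (k : Fin 3) (A : M3) : columnL k A = WithLp.toLp 2 fun i => A i k := rfl

theorem frobenius_norm_sq (A : M3) : ‖A‖ ^ 2 = ∑ k, ‖columnL k A‖ ^ 2 := by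
  rw [Matrix.frobenius_norm_def, ← Real.sqrt_eq_rpow, Real.sq_sqrt (by positivity),
    Finset.sum_comm]
  refine Finset.sum_congr rfl fun k _ => ?_
  rw [EuclideanSpace.norm_sq_eq]
  simp [columnL_apply]

theorem norm_columnL_le (k : Fin 3) (A : M3) : ‖columnL k A‖ ≤ ‖A‖ := by
  refine abs_le_of_sq_le_sq' ?_ (norm_nonneg _) |>.2
  rw [frobenius_norm_sq]
  exact Finset.single_le_sum (f := fun k => ‖columnL k A‖ ^ 2) (fun i _ => by positivity)
    (Finset.mem_univ k)

theorem norm_mul_le_frobenius (A B : M3) : ‖A * B‖ ≤ ‖A‖ * ‖B‖ := Matrix.frobenius_norm_mul A B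

theorem columnL_mul (k : Fin 3) (A B : M3) :
    columnL k (A * B) = WithLp.toLp 2 (A.mulVec (columnL k B).ofLp) := rfl

theorem norm_mulVec_le (A : M3) (x : R3) : ‖(WithLp.toLp 2 (A.mulVec x.ofLp) : R3)‖ ≤ ‖A‖ * ‖x‖ := by
  -- The vector becomes the first column of an otherwise zero matrix, which reduces the claim to
  -- submultiplicativity of the Frobenius norm.
  have h := norm_mul_le_frobenius A (Matrix.of fun i k => if k = 0 then x i else 0)
  have h0 : columnL 0 (Matrix.of fun i k => if k = 0 then x i else 0 : M3) = x := by
    ext i; simp [columnL_apply]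
  have h1 : ‖(Matrix.of fun i k => if k = 0 then x i else 0 : M3)‖ = ‖x‖ := by
    refine (sq_eq_sq₀ (norm_nonneg _) (norm_nonneg _)).1 ?_
    rw [frobenius_norm_sq, Fin.sum_univ_three, h0]
    have h2 : ∀ k : Fin 3, k ≠ 0 → columnL k (Matrix.of fun i k => if k = 0 then x i else 0 : M3) = 0 := by
      intro k hk
      ext i
      simp [columnL_apply, hk]
    rw [h2 1 (by decide), h2 2 (by decide)]
    simp
  rw [h1] at h
  refine le_trans (le_of_eq ?_) ((norm_columnL_le 0 _).trans h)
  rw [columnL_mul, h0]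

theorem one_mem_SO3 : (1 : M3) ∈ SO3 := by simp [SO3]

theorem transpose_mem_SO3 {R : M3} (hR : R ∈ SO3) : R.transpose ∈ SO3 := by
  refine ⟨?_, by rw [Matrix.det_transpose]; exact hR.2⟩
  rw [Matrix.transpose_transpose]
  exact mul_eq_one_comm.1 hR.1

theorem mul_mem_SO3 {R S : M3} (hR : R ∈ SO3) (hS : S ∈ SO3) : R * S ∈ SO3 := by
  refine ⟨?_, by rw [Matrix.det_mul, hR.2, hS.2, one_mul]⟩
  rw [Matrix.transpose_mul, mul_assoc, ← mul_assoc R.transpose, hR.1, one_mul, hS.1]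

theorem norm_mulVec_of_mem_SO3 {R : M3} (hR : R ∈ SO3) (x : R3) :
    ‖(WithLp.toLp 2 (R.mulVec x.ofLp) : R3)‖ = ‖x‖ := by
  refine (sq_eq_sq₀ (norm_nonneg _) (norm_nonneg _)).1 ?_
  have h : ∀ y : R3, ‖y‖ ^ 2 = y.ofLp ⬝ᵥ y.ofLp := fun y => by
    rw [EuclideanSpace.norm_sq_eq]
    simp [dotProduct, sq]
  rw [h, h]
  change R.mulVec x.ofLp ⬝ᵥ R.mulVec x.ofLp = _
  rw [Matrix.dotProduct_mulVec, ← Matrix.mulVec_transpose, Matrix.mulVec_mulVec, hR.1,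
    Matrix.one_mulVec]

theorem norm_columnL_of_mem_SO3 {R : M3} (hR : R ∈ SO3) (k : Fin 3) : ‖columnL k R‖ = 1 := by
  have h := columnL_mul k R 1
  rw [mul_one] at h
  rw [h, norm_mulVec_of_mem_SO3 hR]
  have : columnL k (1 : M3) = EuclideanSpace.single k 1 := by
    ext i
    simp [columnL_apply, Matrix.one_apply]
  rw [this]
  simp

theorem norm_le_two_of_mem_SO3 {R : M3} (hR : R ∈ SO3) : ‖R‖ ≤ 2 := by
  refine abs_le_of_sq_le_sq' ?_ (by norm_num) |>.2
  rw [frobenius_norm_sq]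
  simp_rw [norm_columnL_of_mem_SO3 hR]
  norm_num

theorem norm_le_two_add_infDist (F : M3) : ‖F‖ ≤ 2 + Metric.infDist F SO3 := by
  rw [← sub_le_iff_le_add', Metric.le_infDist ⟨1, one_mem_SO3⟩]
  intro R hR
  rw [dist_eq_norm]
  have h1 := norm_sub_norm_le F R
  have h2 := norm_le_two_of_mem_SO3 hR
  linarith

/-- A rotation preserves lengths, so the leading constant is exactly one, unlike in the Frobenius
bound `norm_le_two_add_infDist`. This sharpness is what yields `|v'| ≤ 1` in the limit. -/
theorem norm_mulVec_le_one_add_infDist (F : M3) (x : R3) :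
    ‖(WithLp.toLp 2 (F.mulVec x.ofLp) : R3)‖ ≤ (1 + Metric.infDist F SO3) * ‖x‖ := by
  rcases eq_or_ne x 0 with rfl | hx
  · simp
  have hx0 : 0 < ‖x‖ := norm_pos_iff.2 hx
  rw [← div_le_iff₀ hx0, ← sub_le_iff_le_add', Metric.le_infDist ⟨1, one_mem_SO3⟩]
  intro R hR
  rw [dist_eq_norm, sub_le_iff_le_add', div_le_iff₀ hx0]
  have e : (WithLp.toLp 2 (F.mulVec x.ofLp) : R3)
      = WithLp.toLp 2 (R.mulVec x.ofLp) + WithLp.toLp 2 ((F - R).mulVec x.ofLp) := by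
    rw [← WithLp.toLp_add, Matrix.sub_mulVec, add_sub_cancel]
  rw [e, add_mul, one_mul]
  refine (norm_add_le _ _).trans (add_le_add (norm_mulVec_of_mem_SO3 hR x).le (norm_mulVec_le _ _))

/-- Matrices close to a rotation are uniformly invertible. -/
theorem exists_near_SO3 : ∃ η > 0, ∃ M : ℝ, ∀ R ∈ SO3, ∀ B : M3, ‖B - R‖ < η →
    1 / 2 ≤ B.det ∧ B.det ≤ 2 ∧ ‖B⁻¹‖ ≤ M := by
  have h1 : ∀ᶠ B in 𝓝 (1 : M3), Matrix.det B ∈ Ioo (1 / 2 : ℝ) 2 := by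
    have hc : Continuous fun B : M3 => B.det := continuous_id.matrix_det
    refine hc.continuousAt (Ioo_mem_nhds ?_ ?_) <;> norm_num
  have h2 : ∀ᶠ B in 𝓝 (1 : M3), ‖Matrix.adjugate B‖ < 3 := by
    have hc : Continuous fun B : M3 => ‖B.adjugate‖ := continuous_id.matrix_adjugate.norm
    refine hc.continuousAt (Iio_mem_nhds ?_)
    have := norm_le_two_of_mem_SO3 one_mem_SO3
    simp only [Matrix.adjugate_one]
    linarith
  obtain ⟨ε, hε, hball⟩ := Metric.eventually_nhds_iff.1 (h1.and h2)
  -- Uniformity in `R` comes from continuity at the identity alone: multiplication by `R.transpose`,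
  -- of norm at most `2`, brings `B` within `ε` of `1`. The bound `12` is `2` for the rotation times
  -- `2 * 3` for the inverse determinant and the adjugate.
  refine ⟨ε / 2, half_pos hε, 12, fun R hR B hB => ?_⟩
  have hRt := transpose_mem_SO3 hR
  have hB' : dist (B * R.transpose) 1 < ε := by
    rw [dist_eq_norm]
    have e : B * R.transpose - 1 = (B - R) * R.transpose := by
      rw [sub_mul, mul_eq_one_comm.1 hR.1]
    rw [e]
    have := norm_mul_le_frobenius (B - R) R.transpose
    have := norm_le_two_of_mem_SO3 hRt
    nlinarith [norm_nonneg (B - R)]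
  obtain ⟨⟨hd1, hd2⟩, ha⟩ := hball hB'
  set N := B * R.transpose with hN
  have hBN : B = N * R := by rw [hN, mul_assoc, hR.1, mul_one]
  have hdet : B.det = N.det := by rw [hBN, Matrix.det_mul, hR.2, mul_one]
  refine ⟨hdet ▸ hd1.le, hdet ▸ hd2.le, ?_⟩
  have hRinv : R⁻¹ = R.transpose := Matrix.inv_eq_left_inv hR.1
  have hNinv : ‖N⁻¹‖ ≤ 6 := by
    rw [Matrix.inv_def, Ring.inverse_eq_inv', norm_smul, norm_inv,
      Real.norm_of_nonneg (by linarith : (0 : ℝ) ≤ N.det)]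
    have : N.det⁻¹ ≤ 2 := by
      rw [inv_le_comm₀ (by linarith) (by norm_num)]; linarith
    calc N.det⁻¹ * ‖N.adjugate‖ ≤ 2 * 3 := by gcongr
      _ = 6 := by norm_num
  rw [hBN, Matrix.mul_inv_rev, hRinv]
  calc ‖R.transpose * N⁻¹‖ ≤ ‖R.transpose‖ * ‖N⁻¹‖ := norm_mul_le_frobenius _ _
    _ ≤ 2 * 6 := by gcongr; exact norm_le_two_of_mem_SO3 hRt
    _ = 12 := by norm_num

/-! ### The scaled gradient of `Ψ` -/

theorem columnL_scaledColumns (h : ℝ) (p : Fin 3 → R3) (k : Fin 3) :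
    columnL k (scaledColumns h p) = (![1, h⁻¹, h⁻¹] : Fin 3 → ℝ) k • p k := by
  ext i
  simp [columnL_apply, scaledColumns]

theorem frameVec_eq_columnL (R : ℝ → M3) (k : Fin 3) (s : ℝ) :
    frameVec R k s = columnL k (R s) := rfl

theorem hasFDerivAt_psi {γ : ℝ → R3} {R : ℝ → M3} {h : ℝ} {z a b c : R3}
    (hc : HasDerivAt γ c (z 0)) (ha : HasDerivAt (frameVec R 1) a (z 0))
    (hb : HasDerivAt (frameVec R 2) b (z 0)) :
    ∃ T : R3 →L[ℝ] R3, HasFDerivAt (psi γ R h) T z ∧ ∀ y : R3,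
      T y = y 0 • c + ((h * z 1) • y 0 • a + (h * y 1) • frameVec R 1 (z 0))
        + ((h * z 2) • y 0 • b + (h * y 2) • frameVec R 2 (z 0)) := by
  have hp : ∀ i : Fin 3, HasFDerivAt (fun z : R3 => z i) (EuclideanSpace.proj i : R3 →L[ℝ] ℝ) z :=
    fun i => (EuclideanSpace.proj i : R3 →L[ℝ] ℝ).hasFDerivAt
  have h0 := hc.hasFDerivAt.comp z (hp 0)
  have h1 := ((hp 1).const_mul h).smul (ha.hasFDerivAt.comp z (hp 0))
  have h2 := ((hp 2).const_mul h).smul (hb.hasFDerivAt.comp z (hp 0))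
  refine ⟨_, (h0.add h1).add h2, fun y => ?_⟩
  simp

/-- The scaling `h⁻¹` cancels the thickness `h` in the last two columns, which are exactly those of
the frame. Only the first column has an error, caused by the derivatives of the normals. -/
theorem gradPsi_sub_norm_le {γ : ℝ → R3} {R : ℝ → M3} {h : ℝ} (hh : 0 < h) {z a b : R3}
    (hc : HasDerivAt γ (frameVec R 0 (z 0)) (z 0)) (ha : HasDerivAt (frameVec R 1) a (z 0))
    (hb : HasDerivAt (frameVec R 2) b (z 0)) :
    ‖gradPsi γ R h z - R (z 0)‖ ≤ h * (‖z‖ * (‖a‖ + ‖b‖)) := by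
  obtain ⟨T, hT, hTy⟩ := hasFDerivAt_psi (h := h) hc ha hb
  have hcol : ∀ k, columnL k (gradPsi γ R h z) = (![1, h⁻¹, h⁻¹] : Fin 3 → ℝ) k •
      T (EuclideanSpace.single k 1) := fun k => by
    rw [gradPsi, hT.fderiv, columnL_scaledColumns]
  have c0 : columnL 0 (gradPsi γ R h z - R (z 0)) = h • (z 1 • a + z 2 • b) := by
    rw [map_sub, hcol, hTy, ← frameVec_eq_columnL]
    simp [smul_smul]
    abel
  have c1 : columnL 1 (gradPsi γ R h z - R (z 0)) = 0 := by
    rw [map_sub, hcol, hTy, ← frameVec_eq_columnL]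
    simp [smul_smul, hh.ne']
  have c2 : columnL 2 (gradPsi γ R h z - R (z 0)) = 0 := by
    rw [map_sub, hcol, hTy, ← frameVec_eq_columnL]
    simp [smul_smul, hh.ne']
  have hz : ∀ i, ‖z i‖ ≤ ‖z‖ := fun i => PiLp.norm_apply_le z i
  have e : ‖gradPsi γ R h z - R (z 0)‖ = ‖columnL 0 (gradPsi γ R h z - R (z 0))‖ := by
    refine (sq_eq_sq₀ (norm_nonneg _) (norm_nonneg _)).1 ?_
    rw [frobenius_norm_sq, Fin.sum_univ_three, c1, c2]
    simp
  rw [e, c0, norm_smul, Real.norm_of_nonneg hh.le]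
  gcongr
  refine (norm_add_le _ _).trans ?_
  rw [norm_smul, norm_smul, mul_add]
  gcongr <;> exact hz _

/-- Kept general in the curve and frame because it serves twice: for the reference rod and for the
rods of the recovery family. -/
theorem exists_gradPsi_bound {L : ℝ} (hL : 0 < L) {γ : ℝ → R3} {R : ℝ → M3} {D : Set R2}
    (hD : IsCrossSection D) (hfr : ∀ k, ContDiffOn ℝ 1 (frameVec R k) (Icc 0 L))
    (hγ : ∀ s ∈ Ioo 0 L, HasDerivAt γ (frameVec R 0 s) s) :
    ∃ K > 0, ∀ h > 0, ∀ z ∈ cyl L D, ‖gradPsi γ R h z - R (z 0)‖ ≤ K * h := by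
  have hu : UniqueDiffOn ℝ (Icc 0 L) := uniqueDiffOn_Icc hL
  have hbd : ∀ k, ∃ C, ∀ s ∈ Icc 0 L, ‖derivWithin (frameVec R k) (Icc 0 L) s‖ ≤ C := fun k =>
    isCompact_Icc.exists_bound_of_continuousOn
      ((hfr k).continuousOn_derivWithin hu le_rfl)
  obtain ⟨C₁, h₁⟩ := hbd 1
  obtain ⟨C₂, h₂⟩ := hbd 2
  obtain ⟨M, hM⟩ := (hD.isBounded_cyl L).exists_norm_le
  have hderiv : ∀ k, ∀ s ∈ Ioo 0 L,
      HasDerivAt (frameVec R k) (derivWithin (frameVec R k) (Icc 0 L) s) s := fun k s hs =>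
    (((hfr k).differentiableOn (by norm_num) s
      (Ioo_subset_Icc_self hs)).hasDerivWithinAt).hasDerivAt (Icc_mem_nhds hs.1 hs.2)
  refine ⟨|M| * (|C₁| + |C₂|) + 1, by positivity, fun h hh z hz => ?_⟩
  have hz0 : z 0 ∈ Ioo 0 L := hz.1
  have hz1 := Ioo_subset_Icc_self hz0
  refine (gradPsi_sub_norm_le hh (hγ _ hz0) (hderiv 1 _ hz0) (hderiv 2 _ hz0)).trans ?_
  rw [mul_comm]
  gcongr
  have b0 : ‖z‖ ≤ |M| := (hM z hz).trans (le_abs_self _)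
  have b1 := (h₁ _ hz1).trans (le_abs_self _)
  have b2 := (h₂ _ hz1).trans (le_abs_self _)
  calc _ ≤ |M| * (|C₁| + |C₂|) := by gcongr
    _ ≤ _ := by linarith

theorem IsFramedCurve.exists_gradPsi_bound {L : ℝ} (hL : 0 < L) {γ : ℝ → R3} {R₀ : ℝ → M3}
    (hγ : IsFramedCurve L γ R₀) {D : Set R2} (hD : IsCrossSection D) :
    ∃ K > 0, ∀ h > 0, ∀ z ∈ cyl L D, ‖gradPsi γ R₀ h z - R₀ (z 0)‖ ≤ K * h := by
  refine CurvedRod.exists_gradPsi_bound hL hD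
    (fun k => (columnL k).contDiff.comp_contDiffOn hγ.contDiff_frame) fun s hs => ?_
  rw [hγ.frame_tangent _ (Ioo_subset_Icc_self hs)]
  exact ((hγ.contDiff_curve.differentiableOn (by norm_num) s
    (Ioo_subset_Icc_self hs)).hasDerivWithinAt).hasDerivAt (Icc_mem_nhds hs.1 hs.2)

end CurvedRod

namespace CurvedRod

/-! ### Coercivity of the energy -/

/-- The scaled gradient is `F * B`, with `F` at distance `d` from `SO3`. Its first column is `F`
applied to a vector of length at most `1 + K * h`, which gives the sharp bound. The other columns
are only bounded crudely, but they carry the factor `h⁻¹`, so `p i` gains a factor `h`. -/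
theorem scaledColumns_bounds {h K : ℝ} (hh : 0 < h) (hh1 : h ≤ 1) (hK : 0 < K) {p : Fin 3 → R3}
    {R B : M3} (hR : R ∈ SO3) (hB : ‖B - R‖ ≤ K * h) (hdet : 1 / 2 ≤ B.det) {d : ℝ}
    (hd : d = Metric.infDist (scaledColumns h p * B⁻¹) SO3) :
    ‖p 0‖ ≤ (1 + d) * (1 + K * h) ∧ ∀ i, i ≠ 0 → ‖p i‖ ≤ h * ((2 + d) * (2 + K)) := by
  have hd0 : 0 ≤ d := hd ▸ Metric.infDist_nonneg
  set F := scaledColumns h p * B⁻¹ with hF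
  have hS : scaledColumns h p = F * B := by
    rw [hF, mul_assoc, Matrix.nonsing_inv_mul _ (isUnit_iff_ne_zero.2 (by linarith)), mul_one]
  have hKh : K * h ≤ K := mul_le_of_le_one_right hK.le hh1
  have e : B = R + (B - R) := by abel
  constructor
  · have h0 := columnL_scaledColumns h p 0
    have h1 : ‖columnL 0 B‖ ≤ 1 + K * h := by
      rw [e, map_add]
      refine (norm_add_le _ _).trans (add_le_add (norm_columnL_of_mem_SO3 hR 0).le ?_)
      exact (norm_columnL_le _ _).trans hB
    have h2 : p 0 = columnL 0 (scaledColumns h p) := by rw [h0]; simp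
    rw [h2, hS, columnL_mul]
    refine (norm_mulVec_le_one_add_infDist F _).trans ?_
    rw [← hd]
    gcongr
  · intro i hi
    have h1 : ‖B‖ ≤ 2 + K := by
      rw [e]
      refine (norm_add_le _ _).trans (add_le_add (norm_le_two_of_mem_SO3 hR) (hB.trans hKh))
    have h2 : ‖columnL i (scaledColumns h p)‖ ≤ (2 + d) * (2 + K) := by
      refine (norm_columnL_le _ _).trans ?_
      rw [hS]
      refine (norm_mul_le_frobenius _ _).trans ?_
      gcongr
      rw [hd]
      exact norm_le_two_add_infDist F
    have h3 : p i = h • columnL i (scaledColumns h p) := by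
      rw [columnL_scaledColumns, smul_smul]
      fin_cases i
      · exact absurd rfl hi
      · simp [hh.ne']
      · simp [hh.ne']
    rw [h3, norm_smul, Real.norm_of_nonneg hh.le]
    gcongr

theorem enorm_sq_le_ofReal {E : Type*} [NormedAddCommGroup E] {x : E} {t : ℝ} (ht : ‖x‖ ≤ t) :
    ‖x‖ₑ ^ 2 ≤ ENNReal.ofReal (t ^ 2) := by
  have h0 : 0 ≤ t := (norm_nonneg _).trans ht
  rw [ENNReal.ofReal_pow h0, ← ofReal_norm]
  gcongr

section

variable {L : ℝ} {γ : ℝ → R3} {R₀ : ℝ → M3} {D : Set R2} {W : ℝ → M3 → ℝ≥0∞}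

/-- The integrand of the energy. -/
noncomputable def energyDensity (γ : ℝ → R3) (R₀ : ℝ → M3) (W : ℝ → M3 → ℝ≥0∞) (h : ℝ)
    (U : W12 (cyl L D)) (z : R3) : ℝ≥0∞ :=
  W (z 0) (scaledColumns h (fun i => W12.partialDeriv U i z) * (gradPsi γ R₀ h z)⁻¹)
    * ENNReal.ofReal (gradPsi γ R₀ h z).det

theorem sobolevEnergy_eq (h : ℝ) (U : W12 (cyl L D)) :
    sobolevEnergy L D γ R₀ W h U = ∫⁻ z in cyl L D, energyDensity γ R₀ W h U z := rfl

theorem IsFramedCurve.exists_gradPsi_regular (hL : 0 < L) (hγ : IsFramedCurve L γ R₀)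
    (hD : IsCrossSection D) :
    ∃ K > 0, ∃ M : ℝ, ∃ h₀ > 0, h₀ ≤ 1 ∧ ∀ h, 0 < h → h < h₀ → ∀ z ∈ cyl L D,
      R₀ (z 0) ∈ SO3 ∧ ‖gradPsi γ R₀ h z - R₀ (z 0)‖ ≤ K * h ∧
      1 / 2 ≤ (gradPsi γ R₀ h z).det ∧ (gradPsi γ R₀ h z).det ≤ 2 ∧
      ‖(gradPsi γ R₀ h z)⁻¹‖ ≤ M := by
  obtain ⟨K, hK, hbound⟩ := hγ.exists_gradPsi_bound hL hD
  obtain ⟨η, hη, M, hM⟩ := exists_near_SO3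
  refine ⟨K, hK, M, min 1 (η / K), by positivity, min_le_left _ _, fun h hh hlt z hz => ?_⟩
  have hR := hγ.frame_mem _ (Ioo_subset_Icc_self hz.1)
  have h1 := hbound h hh z hz
  refine ⟨hR, h1, hM _ hR _ (h1.trans_lt ?_)⟩
  have := (lt_min_iff.1 hlt).2
  rwa [lt_div_iff₀' hK] at this

/-- Coercivity of `W` and the lower bound `1 / 2` on the determinant control `d ^ 2` by the energy
density. The third estimate, free of any additive term of order one, is what forces the limit curve
to be short. -/
theorem exists_pointwise_coercivity (hL : 0 < L) (hγ : IsFramedCurve L γ R₀)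
    (hD : IsCrossSection D) (hW : IsEnergyDensity L W) :
    ∃ h₀ > 0, h₀ ≤ 1 ∧ ∃ C : ℝ≥0, ∀ h, 0 < h → h < h₀ → ∀ U : W12 (cyl L D),
      ∀ᵐ z ∂volume.restrict (cyl L D),
        ‖W12.partialDeriv U 0 z‖ₑ ^ 2 ≤ C * (1 + energyDensity γ R₀ W h U z) ∧
        (∀ i, i ≠ 0 → ‖W12.partialDeriv U i z‖ₑ ^ 2
          ≤ ENNReal.ofReal (h ^ 2) * (C * (1 + energyDensity γ R₀ W h U z))) ∧
        (‖W12.partialDeriv U 0 z‖ₑ - 1) ^ 2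
          ≤ C * (ENNReal.ofReal (h ^ 2) + energyDensity γ R₀ W h U z) := by
  obtain ⟨K, hK, M, h₀, hh₀, hh₀1, hreg⟩ := hγ.exists_gradPsi_regular hL hD
  obtain ⟨C₂, hC₂, hcoer⟩ := hW.coercive
  -- One constant for all three bounds: `8` suffices to pass from `(1 + d) ^ 2`, `(2 + d) ^ 2` and
  -- `(d + h) ^ 2` to sums of squares.
  set A : ℝ := 8 * (2 + K) ^ 2 with hA
  have hA0 : 0 ≤ A := by positivity
  have hq0 : 0 ≤ 2 / C₂ := by positivity
  refine ⟨h₀, hh₀, hh₀1, (A * (1 + 2 / C₂)).toNNReal, fun h hh hlt U => ?_⟩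
  have hcoer' := (hD.measurePreserving_axis L).quasiMeasurePreserving.ae hcoer
  filter_upwards [hcoer', ae_restrict_mem (isOpen_cyl hD.isOpen).measurableSet] with z hz hzc
  obtain ⟨hR, hB, hdet, -, -⟩ := hreg h hh hlt z hzc
  set B := gradPsi γ R₀ h z with hBdef
  set p : Fin 3 → R3 := fun i => W12.partialDeriv U i z with hp
  set d := Metric.infDist (scaledColumns h p * B⁻¹) SO3 with hd
  have hd0 : 0 ≤ d := Metric.infDist_nonneg
  have hh1 : h ≤ 1 := hlt.le.trans hh₀1
  obtain ⟨b0, bi⟩ := scaledColumns_bounds hh hh1 hK hR hB hdet hd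
  set X := energyDensity γ R₀ W h U z with hX
  have hdX : ENNReal.ofReal (d ^ 2) ≤ ENNReal.ofReal (2 / C₂) * X := by
    calc ENNReal.ofReal (d ^ 2) = ENNReal.ofReal (2 / C₂) *
          (ENNReal.ofReal (C₂ * d ^ 2) * ENNReal.ofReal (1 / 2)) := by
          rw [← ENNReal.ofReal_mul (by positivity), ← ENNReal.ofReal_mul (by positivity)]
          congr 1
          field_simp
      _ ≤ _ := by
          rw [hX, energyDensity]
          gcongr
          exact hz _
  have hKh : K * h ≤ K := mul_le_of_le_one_right hK.le hh1
  have hC : ((A * (1 + 2 / C₂)).toNNReal : ℝ≥0∞)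
      = ENNReal.ofReal A * (1 + ENNReal.ofReal (2 / C₂)) := by
    change ENNReal.ofReal _ = _
    rw [ENNReal.ofReal_mul hA0, ENNReal.ofReal_add zero_le_one hq0, ENNReal.ofReal_one]
  -- Used with `t = 1` for the boundedness estimates and with `t = h ^ 2` for the excess of `|∂ₛv|`
  -- over one.
  have conv : ∀ t : ℝ, 0 ≤ t → ENNReal.ofReal (A * (t + d ^ 2))
      ≤ ((A * (1 + 2 / C₂)).toNNReal : ℝ≥0∞) * (ENNReal.ofReal t + X) := by
    intro t ht
    rw [hC, ENNReal.ofReal_mul hA0, ENNReal.ofReal_add ht (by positivity), mul_assoc]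
    gcongr
    rw [add_mul, one_mul, add_comm]
    calc ENNReal.ofReal (d ^ 2) + ENNReal.ofReal t
        ≤ ENNReal.ofReal (2 / C₂) * X + ENNReal.ofReal t := by gcongr
      _ ≤ (ENNReal.ofReal (2 / C₂) * (ENNReal.ofReal t + X)) + (ENNReal.ofReal t + X) := by
          gcongr
          · exact le_add_self
          · exact le_self_add
      _ = _ := add_comm _ _
  have conv1 := conv 1 zero_le_one
  rw [ENNReal.ofReal_one] at conv1
  refine ⟨(enorm_sq_le_ofReal b0).trans (le_trans (ENNReal.ofReal_le_ofReal ?_) conv1),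
    fun i hi => (enorm_sq_le_ofReal (bi i hi)).trans ?_, ?_⟩
  · calc ((1 + d) * (1 + K * h)) ^ 2 ≤ ((1 + d) * (2 + K)) ^ 2 := by gcongr; linarith
      _ ≤ A * (1 + d ^ 2) := by
          rw [hA, mul_pow]
          nlinarith [sq_nonneg (1 - d), sq_nonneg ((2 + K) * (1 - d)), sq_nonneg (2 + K),
            mul_nonneg (sq_nonneg (2 + K)) (sq_nonneg d)]
  · rw [mul_pow, ENNReal.ofReal_mul (by positivity)]
    gcongr
    refine le_trans (ENNReal.ofReal_le_ofReal ?_) conv1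
    rw [hA, mul_pow]
    nlinarith [mul_nonneg (sq_nonneg (2 + K)) (sq_nonneg (2 - d)), sq_nonneg (2 + K),
      mul_nonneg (sq_nonneg (2 + K)) (sq_nonneg d)]
  · have h1 : ‖p 0‖ₑ - 1 ≤ ENNReal.ofReal ((1 + K) * d + K * h) := by
      rw [tsub_le_iff_right, ← ENNReal.ofReal_one, ← ENNReal.ofReal_add (by positivity) zero_le_one,
        ← ofReal_norm]
      refine ENNReal.ofReal_le_ofReal (b0.trans ?_)
      nlinarith
    calc (‖p 0‖ₑ - 1) ^ 2 ≤ ENNReal.ofReal ((1 + K) * d + K * h) ^ 2 := by gcongr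
      _ = ENNReal.ofReal (((1 + K) * d + K * h) ^ 2) := by
          rw [ENNReal.ofReal_pow (by positivity)]
      _ ≤ ENNReal.ofReal (A * (h ^ 2 + d ^ 2)) := by
          refine ENNReal.ofReal_le_ofReal ?_
          calc ((1 + K) * d + K * h) ^ 2 ≤ ((2 + K) * d + (2 + K) * h) ^ 2 := by
                gcongr <;> linarith
            _ = (2 + K) ^ 2 * (d + h) ^ 2 := by ring
            _ ≤ A * (h ^ 2 + d ^ 2) := by
                rw [hA]
                nlinarith [mul_nonneg (sq_nonneg (2 + K)) (sq_nonneg (d - h)),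
                  mul_nonneg (sq_nonneg (2 + K)) (add_nonneg (sq_nonneg d) (sq_nonneg h))]
      _ ≤ _ := conv _ (by positivity)

theorem exists_energy_bounds (hL : 0 < L) (hγ : IsFramedCurve L γ R₀)
    (hD : IsCrossSection D) (hW : IsEnergyDensity L W) :
    ∃ h₀ > 0, h₀ ≤ 1 ∧ ∃ C : ℝ≥0, ∀ h, 0 < h → h < h₀ → ∀ (U : W12 (cyl L D)) (e : ℝ≥0),
      sobolevEnergy L D γ R₀ W h U ≤ e →
        ∫⁻ z in cyl L D, ‖W12.partialDeriv U 0 z‖ₑ ^ 2 ≤ C * (1 + e) ∧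
        (∀ i, i ≠ 0 → ∫⁻ z in cyl L D, ‖W12.partialDeriv U i z‖ₑ ^ 2
          ≤ ENNReal.ofReal (h ^ 2) * (C * (1 + e))) ∧
        ∫⁻ z in cyl L D, (‖W12.partialDeriv U 0 z‖ₑ - 1) ^ 2
          ≤ C * (ENNReal.ofReal (h ^ 2) + e) := by
  obtain ⟨h₀, hh₀, hh₀1, C, hC⟩ := exists_pointwise_coercivity hL hγ hD hW
  refine ⟨h₀, hh₀, hh₀1, C * (L.toNNReal + 1), fun h hh hlt U e he => ?_⟩
  have hae := hC h hh hlt U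
  rw [sobolevEnergy_eq] at he
  have hvol := volume_cyl L hD
  have hint : ∀ t : ℝ≥0∞, ∫⁻ z in cyl L D, C * (t + energyDensity γ R₀ W h U z)
      ≤ (C * (L.toNNReal + 1) : ℝ≥0) * (t + e) := by
    intro t
    rw [lintegral_const_mul' _ _ ENNReal.coe_ne_top, lintegral_add_left measurable_const,
      setLIntegral_const, hvol, ENNReal.coe_mul, mul_assoc]
    gcongr
    calc t * ENNReal.ofReal L + ∫⁻ z in cyl L D, energyDensity γ R₀ W h U z
        ≤ t * (ENNReal.ofReal L + 1) + e * (ENNReal.ofReal L + 1) := by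
          gcongr
          · exact le_self_add
          · exact he.trans (le_mul_of_one_le_right' le_add_self)
      _ = _ := by
          rw [← add_mul, mul_comm]
          rfl
  refine ⟨?_, fun i hi => ?_, ?_⟩
  · exact (lintegral_mono_ae (hae.mono fun z hz => hz.1)).trans (hint 1)
  · refine (lintegral_mono_ae (hae.mono fun z hz => hz.2.1 i hi)).trans ?_
    rw [lintegral_const_mul' _ _ ENNReal.ofReal_ne_top]
    gcongr
    exact hint 1
  · exact (lintegral_mono_ae (hae.mono fun z hz => hz.2.2)).trans (hint _)

/-! ### Compactness -/

/-- The common core of compactness and of the liminf inequality. The gradient bound is stated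
without any `L²` bound on the functions, so that it can feed the Poincaré inequality. The `L²` bound
is a separate input: it comes from Poincaré in one application and from strong convergence in the
other. -/
theorem exists_weak_limit (hL : 0 < L) (hγ : IsFramedCurve L γ R₀)
    (hD : IsCrossSection D) (hW : IsEnergyDensity L W) {α : ℝ} (hα : 0 < α) :
    ∃ h₀ > 0, ∃ P : ℝ≥0, ∀ (h : ℕ → ℝ) (U : ℕ → W12 (cyl L D)) (c : ℝ≥0),
      (∀ j, 0 < h j) → (∀ j, h j < h₀) → Tendsto h atTop (𝓝 0) →
      (∀ j, sobolevEnergy L D γ R₀ W (h j) (U j) ≤ c * ENNReal.ofReal (h j ^ α)) →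
      (∀ j, ∑ i, ∫⁻ z in cyl L D, ‖W12.partialDeriv (U j) i z‖ₑ ^ 2 ≤ P * (1 + c)) ∧
      ∀ M : ℝ, (∀ j, ‖W12.toL2 (U j)‖ ≤ M) →
        ∃ (σ : ℕ → ℕ) (V : W12 (cyl L D)), StrictMono σ ∧
          W12.TendstoWeakly (fun j => U (σ j)) V ∧ W12.toL2 V ∈ limitClass L D := by
  obtain ⟨h₀, hh₀, hh₀1, C, hC⟩ := exists_energy_bounds hL hγ hD hW
  refine ⟨h₀, hh₀, 3 * C, fun h U c hpos hlt hlim hE => ?_⟩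
  have hle1 : ∀ j, h j ≤ 1 := fun j => (hlt j).le.trans hh₀1
  have hα1 : ∀ j, h j ^ α ≤ 1 := fun j => Real.rpow_le_one (hpos j).le (hle1 j) hα.le
  have hbd := fun j => hC (h j) (hpos j) (hlt j) (U j) (c * (h j ^ α).toNNReal)
    (by rw [ENNReal.coe_mul]; exact hE j)
  have hcj : ∀ j, c * (h j ^ α).toNNReal ≤ c := fun j =>
    mul_le_of_le_one_right' (Real.toNNReal_le_one.2 (hα1 j))
  have hh2 : ∀ j, ENNReal.ofReal (h j ^ 2) ≤ 1 := fun j =>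
    ENNReal.ofReal_le_one.2 (pow_le_one₀ (hpos j).le (hle1 j))
  have g0 : ∀ j, ∫⁻ z in cyl L D, ‖W12.partialDeriv (U j) 0 z‖ₑ ^ 2 ≤ C * (1 + c) := fun j =>
    (hbd j).1.trans (by gcongr; exact hcj j)
  have gi : ∀ j i, i ≠ 0 → ∫⁻ z in cyl L D, ‖W12.partialDeriv (U j) i z‖ₑ ^ 2
      ≤ ENNReal.ofReal (h j ^ 2) * (C * (1 + c)) := fun j i hi =>
    ((hbd j).2.1 i hi).trans (by gcongr; exact hcj j)
  have gall : ∀ j i, ∫⁻ z in cyl L D, ‖W12.partialDeriv (U j) i z‖ₑ ^ 2 ≤ C * (1 + c) := by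
    intro j i
    by_cases hi : i = 0
    · rw [hi]; exact g0 j
    · exact (gi j i hi).trans (mul_le_of_le_one_left' (hh2 j))
  refine ⟨fun j => ?_, fun M hM => ?_⟩
  · calc ∑ i, ∫⁻ z in cyl L D, ‖W12.partialDeriv (U j) i z‖ₑ ^ 2
        ≤ ∑ _i : Fin 3, (C * (1 + c) : ℝ≥0∞) := Finset.sum_le_sum fun i _ => gall j i
      _ = _ := by simp [mul_assoc]
  set S : ℝ≥0 := NNReal.sqrt (C * (1 + c)) with hS
  have hS2 : (S : ℝ≥0∞) ^ 2 = C * (1 + c) := by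
    rw [← ENNReal.coe_pow, hS, NNReal.sq_sqrt]
    push_cast
    rfl
  have nall : ∀ j i, ‖W12.partialDeriv (U j) i‖ ≤ S := fun j i =>
    norm_le_of_lintegral_le (by rw [hS2]; exact gall j i)
  have ni : ∀ j i, i ≠ 0 → ‖W12.partialDeriv (U j) i‖ ≤ h j * S := fun j i hi => by
    have := norm_le_of_lintegral_le (M := (h j).toNNReal * S) (f := W12.partialDeriv (U j) i) (by
      rw [ENNReal.coe_mul, mul_pow, hS2]
      change _ ≤ ENNReal.ofReal (h j) ^ 2 * _
      rw [← ENNReal.ofReal_pow (hpos j).le]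
      exact gi j i hi)
    rwa [NNReal.coe_mul, Real.coe_toNNReal _ (hpos j).le] at this
  have nU : ∀ j, ‖U j‖ ≤ 2 * max M S := fun j =>
    W12.norm_le ((hM j).trans (le_max_left _ _)) fun i => (nall j i).trans (le_max_right _ _)
  obtain ⟨σ, V, hσ, hV⟩ := exists_weakly_convergent_subseq nU
  have hV' : W12.TendstoWeakly (fun j => U (σ j)) V := hV
  refine ⟨σ, V, hσ, hV', ?_⟩
  have hzero : ∀ i, i ≠ 0 → W12.partialDeriv V i = 0 := fun i hi => by
    refine hV'.partialDeriv_eq_zero ?_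
    refine squeeze_zero (fun j => norm_nonneg _) (fun j => ni (σ j) i hi) ?_
    simpa using (hlim.comp hσ.tendsto_atTop).mul_const (S : ℝ)
  refine W12.toL2_mem_limitClass hD V (hzero 1 (by decide)) (hzero 2 (by decide)) ?_
  refine norm_le_one_of_weak_limit (by simp [volume_cyl L hD])
    (hV'.inner_clm (partialDerivL _ 0)) ?_
  have hlim' : Tendsto (fun j => (C : ℝ≥0∞) * (ENNReal.ofReal (h (σ j) ^ 2)
      + (c * (h (σ j) ^ α).toNNReal : ℝ≥0))) atTop (𝓝 0) := by
    have hσl := hlim.comp hσ.tendsto_atTop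
    have t1 : Tendsto (fun j => ENNReal.ofReal (h (σ j) ^ 2)) atTop (𝓝 0) := by
      have := ENNReal.tendsto_ofReal (hσl.pow 2)
      simpa [Function.comp_def] using this
    have t2 : Tendsto (fun j => ((c * (h (σ j) ^ α).toNNReal : ℝ≥0) : ℝ≥0∞)) atTop (𝓝 0) := by
      have h1 : Tendsto (fun j => h (σ j) ^ α) atTop (𝓝 0) := by
        have := hσl.rpow_const (p := α) (Or.inr hα.le)
        simpa [Function.comp_def, Real.zero_rpow hα.ne'] using this
      have h2 := ENNReal.Tendsto.const_mul (a := (c : ℝ≥0∞)) (ENNReal.tendsto_ofReal h1)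
        (Or.inr ENNReal.coe_ne_top)
      simpa [ENNReal.ofReal] using h2
    have := ENNReal.Tendsto.const_mul (a := (C : ℝ≥0∞)) (t1.add t2) (Or.inr ENNReal.coe_ne_top)
    simpa only [add_zero, mul_zero] using this
  exact tendsto_of_tendsto_of_tendsto_of_le_of_le tendsto_const_nhds hlim' (fun j => zero_le)
    fun j => (hbd (σ j)).2.2

end

end CurvedRod

namespace CurvedRod

/-! ### Compactness modulo constants and the liminf inequality -/

section

variable {L : ℝ} {γ : ℝ → R3} {R₀ : ℝ → M3} {D : Set R2} {W : ℝ → M3 → ℝ≥0∞}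

/-- The energy is an infimum over representations; raising `c` to `c + 1` makes the inequality
strict, so a representation within the bound exists without any appeal to its uniqueness. -/
theorem exists_competitor {α h : ℝ} (hh : 0 < h) {v : L2 (cyl L D)} {c : ℝ≥0}
    (hv : scaledEnergy L D γ R₀ W α h v ≤ c) :
    ∃ U : W12 (cyl L D), W12.toL2 U = v ∧
      sobolevEnergy L D γ R₀ W h U ≤ (c + 1 : ℝ≥0) * ENNReal.ofReal (h ^ α) := by
  have h0 : ENNReal.ofReal (h ^ α) ≠ 0 := by simpa using Real.rpow_pos_of_pos hh α
  rw [scaledEnergy, ENNReal.div_le_iff h0 ENNReal.ofReal_ne_top] at hv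
  have h1 : energy L D γ R₀ W h v < (c + 1 : ℝ≥0) * ENNReal.ofReal (h ^ α) := by
    refine hv.trans_lt ?_
    rw [ENNReal.mul_lt_mul_iff_left h0 ENNReal.ofReal_ne_top, ENNReal.coe_lt_coe]
    exact lt_add_one c
  simp only [energy, iInf_lt_iff] at h1
  obtain ⟨U, hU, hlt⟩ := h1
  exact ⟨U, hU, hlt.le⟩

theorem exists_const_W12 (hD : IsCrossSection D) (a : R3) :
    ∃ K : W12 (cyl L D), W12.toL2 K =ᵐ[volume.restrict (cyl L D)] (fun _ => a) ∧
      ∀ i, W12.partialDeriv K i = 0 := by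
  obtain ⟨K, hK, hKd⟩ := exists_W12_of_contDiff (L := L) hD (f := fun _ => a) contDiff_const
  refine ⟨K, hK, fun i => Lp.ext ?_⟩
  filter_upwards [hKd i, Lp.coeFn_zero R3 2 (volume.restrict (cyl L D))] with z h1 h2
  rw [h1, h2]
  simp

theorem compactness (hL : 0 < L) (hγ : IsFramedCurve L γ R₀) (hD : IsCrossSection D)
    (hW : IsEnergyDensity L W) {α : ℝ} (hα : 0 < α) (h : ℕ → ℝ) (v : ℕ → L2 (cyl L D)) (c : ℝ≥0)
    (hpos : ∀ j, 0 < h j) (hlim : Tendsto h atTop (𝓝 0))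
    (hE : ∀ j, scaledEnergy L D γ R₀ W α (h j) (v j) ≤ c) :
    ∃ (σ : ℕ → ℕ) (a : ℕ → R3) (U : ℕ → W12 (cyl L D)) (V : W12 (cyl L D)),
      StrictMono σ ∧
      (∀ j, W12.toL2 (U j) =ᵐ[volume.restrict (cyl L D)] fun z => v (σ j) z - a j) ∧
      W12.TendstoWeakly U V ∧ W12.toL2 V ∈ limitClass L D := by
  obtain ⟨h₀, hh₀, P, hP⟩ := exists_weak_limit hL hγ hD hW hα
  obtain ⟨Cp, hCp⟩ := W12.exists_poincare hL hD
  -- The estimates hold only for `h < h₀`, so the first `N` terms are dropped and the final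
  -- subsequence is shifted by `N`.
  obtain ⟨N, hN⟩ := eventually_atTop.1 (hlim.eventually_lt_const hh₀)
  choose U₀ hU₀ hU₀E using fun j => exists_competitor (hpos j) (hE j)
  -- The constants to subtract are those of the Poincaré inequality; subtracting them changes
  -- neither the derivatives nor the energy.
  choose a ha using fun j => hCp (U₀ j)
  choose K hK hKd using fun j => exists_const_W12 (L := L) hD (a j)
  set U : ℕ → W12 (cyl L D) := fun j => U₀ j - K j with hU
  have hUd : ∀ j i, W12.partialDeriv (U j) i = W12.partialDeriv (U₀ j) i := fun j i => by
    have : W12.partialDeriv (U j) i = W12.partialDeriv (U₀ j) i - W12.partialDeriv (K j) i := rfl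
    rw [this, hKd, sub_zero]
  have hUae : ∀ j, W12.toL2 (U j) =ᵐ[volume.restrict (cyl L D)] fun z => W12.toL2 (U₀ j) z - a j := by
    intro j
    have : W12.toL2 (U j) = W12.toL2 (U₀ j) - W12.toL2 (K j) := rfl
    rw [this]
    filter_upwards [Lp.coeFn_sub (W12.toL2 (U₀ j)) (W12.toL2 (K j)), hK j] with z h1 h2
    rw [h1, Pi.sub_apply, h2]
  have hUE : ∀ j, sobolevEnergy L D γ R₀ W (h j) (U j)
      ≤ (c + 1 : ℝ≥0) * ENNReal.ofReal (h j ^ α) := fun j => by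
    have : sobolevEnergy L D γ R₀ W (h j) (U j) = sobolevEnergy L D γ R₀ W (h j) (U₀ j) := by
      unfold sobolevEnergy
      simp_rw [hUd]
    rw [this]
    exact hU₀E j
  have hshift : Tendsto (fun j => N + j) atTop atTop := tendsto_add_atTop_iff_nat N |>.2 tendsto_id |>.congr
    fun j => by simp [add_comm]
  obtain ⟨hgrad, hweak⟩ := hP (fun j => h (N + j)) (fun j => U (N + j)) (c + 1)
    (fun j => hpos _) (fun j => hN _ (Nat.le_add_right N j)) (hlim.comp hshift)
    (fun j => hUE _)
  obtain ⟨σ, V, hσ, hV, hVmem⟩ := hweak (NNReal.sqrt (Cp * (P * (1 + (c + 1))))) (fun j => by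
    refine norm_le_of_lintegral_le ?_
    rw [← ENNReal.coe_pow, NNReal.sq_sqrt]
    calc ∫⁻ z in cyl L D, ‖W12.toL2 (U (N + j)) z‖ₑ ^ 2
        = ∫⁻ z in cyl L D, ‖W12.toL2 (U₀ (N + j)) z - a (N + j)‖ₑ ^ 2 := by
          refine lintegral_congr_ae ?_
          filter_upwards [hUae (N + j)] with z hz
          rw [hz]
      _ ≤ _ := ha _
      _ ≤ Cp * (P * (1 + (c + 1 : ℝ≥0))) := by
          gcongr
          have := hgrad j
          simp_rw [hUd] at this
          exact this
      _ = _ := by push_cast; rfl)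
  refine ⟨fun j => N + σ j, fun j => a (N + σ j), fun j => U (N + σ j), V, ?_, fun j => ?_, hV, hVmem⟩
  · exact fun i j hij => Nat.add_lt_add_left (hσ hij) N
  · rw [← hU₀]
    exact hUae _

/-- If `x` lay outside the class and the liminf were finite, some sequence of thicknesses would have
bounded scaled energy. Strong convergence bounds it in `L²` and identifies its weak limit with `x`,
which would then lie in the class. -/
theorem liminf_inequality (hL : 0 < L) (hγ : IsFramedCurve L γ R₀) (hD : IsCrossSection D)
    (hW : IsEnergyDensity L W) {α : ℝ} (hα : 0 < α) (x : L2 (cyl L D)) (u : ℝ → L2 (cyl L D))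
    (hu : Tendsto u (𝓝[>] 0) (𝓝 x)) :
    limitEnergy L D x ≤ liminf (fun h => scaledEnergy L D γ R₀ W α h (u h)) (𝓝[>] 0) := by
  by_cases hx : x ∈ limitClass L D
  · simp [limitEnergy, hx]
  by_contra hlt
  rw [limitEnergy, if_neg hx, not_le] at hlt
  obtain ⟨h₀, hh₀, P, hP⟩ := exists_weak_limit hL hγ hD hW hα
  obtain ⟨c, hc, -⟩ := ENNReal.lt_iff_exists_nnreal_btwn.1 hlt
  have hfreq := (frequently_lt_of_liminf_lt (by isBoundedDefault) hc).and_eventually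
    (Ioo_mem_nhdsGT hh₀)
  obtain ⟨h, hlim, hh⟩ := exists_seq_forall_of_frequently hfreq
  have hlim0 : Tendsto h atTop (𝓝 0) := tendsto_nhds_of_tendsto_nhdsWithin hlim
  choose U hU hUE using fun j => exists_competitor (hh j).2.1 (hh j).1.le
  have hconv : Tendsto (fun j => W12.toL2 (U j)) atTop (𝓝 x) := by
    simp_rw [hU]
    exact hu.comp hlim
  obtain ⟨M, hM⟩ := (Metric.isBounded_range_of_tendsto _ hconv).exists_norm_le
  obtain ⟨σ, V, hσ, hV, hVmem⟩ := (hP h U (c + 1) (fun j => (hh j).2.1) (fun j => (hh j).2.2) hlim0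
    hUE).2 M (fun j => hM _ (mem_range_self j))
  rw [hV.toL2_eq (hconv.comp hσ.tendsto_atTop)] at hVmem
  exact hx hVmem

end

end CurvedRod

namespace CurvedRod

/-! ### Unit vectors in spherical coordinates -/

/-- The unit vector with longitude `θ.1` and latitude `θ.2`. -/
noncomputable def direction (θ : ℝ × ℝ) : R3 :=
  !₂[Real.cos θ.1 * Real.cos θ.2, Real.sin θ.1 * Real.cos θ.2, Real.sin θ.2]

theorem norm_direction (θ : ℝ × ℝ) : ‖direction θ‖ = 1 := by
  refine (sq_eq_sq₀ (norm_nonneg _) zero_le_one).1 ?_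
  rw [EuclideanSpace.norm_sq_eq, Fin.sum_univ_three]
  simp only [direction, Real.norm_eq_abs, sq_abs]
  simp
  nlinarith [Real.sin_sq_add_cos_sq θ.1, Real.sin_sq_add_cos_sq θ.2]

theorem norm_le_two_mul_of_abs_le {x : R3} {t : ℝ} (ht : 0 ≤ t) (h : ∀ i, |x i| ≤ t) :
    ‖x‖ ≤ 2 * t := by
  refine abs_le_of_sq_le_sq' ?_ (by positivity) |>.2
  rw [EuclideanSpace.norm_sq_eq, Fin.sum_univ_three]
  simp only [Real.norm_eq_abs]
  have h1 : ∀ i, |x i| ^ 2 ≤ t ^ 2 := fun i => by gcongr; exact h i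
  nlinarith [h1 0, h1 1, h1 2, sq_nonneg t]

theorem abs_mul_sub_mul_le {a b c d : ℝ} (ha : |a| ≤ 1) (hd : |d| ≤ 1) :
    |a * b - c * d| ≤ |a - c| + |b - d| := by
  have e : a * b - c * d = a * (b - d) + (a - c) * d := by ring
  rw [e]
  refine (abs_add_le _ _).trans ?_
  rw [abs_mul, abs_mul, add_comm]
  exact add_le_add (mul_le_of_le_one_right (abs_nonneg _) hd)
    (mul_le_of_le_one_left (abs_nonneg _) ha)

/-- Lets `L¹` closeness of angles pass to `L¹` closeness of tangents. -/
theorem norm_direction_sub_le (θ η : ℝ × ℝ) : ‖direction θ - direction η‖ ≤ 4 * ‖θ - η‖ := by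
  have h1 : |θ.1 - η.1| ≤ ‖θ - η‖ := norm_fst_le (θ - η)
  have h2 : |θ.2 - η.2| ≤ ‖θ - η‖ := norm_snd_le (θ - η)
  have h0 := norm_nonneg (θ - η)
  have c1 := Real.abs_cos_sub_cos_le θ.1 η.1
  have c2 := Real.abs_cos_sub_cos_le θ.2 η.2
  have s1 := Real.abs_sin_sub_sin_le θ.1 η.1
  have s2 := Real.abs_sin_sub_sin_le θ.2 η.2
  rw [show 4 * ‖θ - η‖ = 2 * (2 * ‖θ - η‖) by ring]
  refine norm_le_two_mul_of_abs_le (by positivity) fun i => ?_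
  fin_cases i
  · have := abs_mul_sub_mul_le (b := Real.cos θ.2) (c := Real.cos η.1) (Real.abs_cos_le_one θ.1)
      (Real.abs_cos_le_one η.2)
    simp only [direction]
    simp
    linarith
  · have := abs_mul_sub_mul_le (b := Real.cos θ.2) (c := Real.sin η.1) (Real.abs_sin_le_one θ.1)
      (Real.abs_cos_le_one η.2)
    simp only [direction]
    simp
    linarith
  · simp only [direction]
    simp
    linarith

theorem contDiff_direction : ContDiff ℝ ∞ direction := by
  rw [contDiff_euclidean]
  intro i
  fin_cases i
  · exact (Real.contDiff_cos.comp contDiff_fst).mul (Real.contDiff_cos.comp contDiff_snd)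
  · exact (Real.contDiff_sin.comp contDiff_fst).mul (Real.contDiff_cos.comp contDiff_snd)
  · exact Real.contDiff_sin.comp contDiff_snd

/-- The angles are the argument of `p 0 + i p 1` and the arcsine of `p 2`. The bound by `4 > π`
makes angle functions integrable on bounded intervals, so that they can be smoothed. -/
theorem exists_direction_eq {p : R3} (hp : ‖p‖ = 1) : ∃ θ : ℝ × ℝ, ‖θ‖ ≤ 4 ∧ direction θ = p := by
  have hsq : p 0 ^ 2 + p 1 ^ 2 + p 2 ^ 2 = 1 := by
    have := EuclideanSpace.norm_sq_eq p
    rw [hp, Fin.sum_univ_three] at this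
    simp only [Real.norm_eq_abs, sq_abs] at this
    linarith
  set c : ℂ := ⟨p 0, p 1⟩ with hc
  have hcn : ‖c‖ = Real.sqrt (1 - p 2 ^ 2) := by
    rw [Complex.norm_eq_sqrt_sq_add_sq]
    congr 1
    simp only [hc]
    linarith
  have h2 : p 2 ∈ Icc (-1 : ℝ) 1 := by
    constructor <;> nlinarith [sq_nonneg (p 0), sq_nonneg (p 1)]
  refine ⟨(Complex.arg c, Real.arcsin (p 2)), ?_, ?_⟩
  · have hpi := Real.pi_lt_four
    rw [Prod.norm_def]
    refine max_le ?_ ?_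
    · exact (Complex.abs_arg_le_pi c).trans hpi.le
    · rw [Real.norm_eq_abs, abs_le]
      have h1 := Real.neg_pi_div_two_le_arcsin (p 2)
      have h2 := Real.arcsin_le_pi_div_two (p 2)
      have := Real.pi_pos
      constructor <;> simp only <;> linarith
  · ext i
    fin_cases i
    · change Real.cos (Complex.arg c) * Real.cos (Real.arcsin (p 2)) = p 0
      rw [Real.cos_arcsin, ← hcn, mul_comm]
      exact Complex.norm_mul_cos_arg c
    · change Real.sin (Complex.arg c) * Real.cos (Real.arcsin (p 2)) = p 1
      rw [Real.cos_arcsin, ← hcn, mul_comm]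
      exact Complex.norm_mul_sin_arg c
    · simp only [direction]
      simpa using Real.sin_arcsin h2.1 h2.2

theorem exists_unit_orthogonal (m : R3) : ∃ n : R3, ‖n‖ = 1 ∧ inner ℝ m n = 0 := by
  have key : ∃ n : R3, n ≠ 0 ∧ inner ℝ m n = 0 := by
    by_cases h : m 0 = 0
    · refine ⟨EuclideanSpace.single 0 1, by simp, ?_⟩
      rw [EuclideanSpace.inner_single_right, h]
      simp
    · refine ⟨!₂[-m 1, m 0, 0], fun h0 => h ?_, ?_⟩
      · simpa using congrArg (fun x : R3 => x 1) h0
      · simp [PiLp.inner_apply, Fin.sum_univ_three]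
        ring
  obtain ⟨n, hn, hmn⟩ := key
  refine ⟨‖n‖⁻¹ • n, ?_, by rw [real_inner_smul_right, hmn, mul_zero]⟩
  rw [norm_smul, norm_inv, norm_norm, inv_mul_cancel₀ (norm_ne_zero_iff.2 hn)]

/-- Each vector of the unit ball is the midpoint of two unit vectors. -/
theorem exists_direction_add_eq {m : R3} (hm : ‖m‖ ≤ 1) :
    ∃ θ η : ℝ × ℝ, ‖θ‖ ≤ 4 ∧ ‖η‖ ≤ 4 ∧ direction θ + direction η = (2 : ℝ) • m := by
  obtain ⟨n, hn, hmn⟩ := exists_unit_orthogonal m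
  -- By Pythagoras `m ± t • n` are unit vectors, and their midpoint is `m`.
  set t := Real.sqrt (1 - ‖m‖ ^ 2) with ht
  have ht2 : t ^ 2 = 1 - ‖m‖ ^ 2 := Real.sq_sqrt (by nlinarith [norm_nonneg m])
  have hin : inner ℝ m (t • n) = 0 := by rw [real_inner_smul_right, hmn, mul_zero]
  have hnn : ‖t • n‖ ^ 2 = t ^ 2 := by rw [norm_smul, hn, mul_one, Real.norm_eq_abs, sq_abs]
  have hp : ‖m + t • n‖ = 1 := by
    refine (sq_eq_sq₀ (norm_nonneg _) zero_le_one).1 ?_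
    rw [norm_add_sq_real, hin, hnn, ht2]
    ring
  have hq : ‖m - t • n‖ = 1 := by
    refine (sq_eq_sq₀ (norm_nonneg _) zero_le_one).1 ?_
    rw [norm_sub_sq_real, hin, hnn, ht2]
    ring
  obtain ⟨θ, hθ, hθp⟩ := exists_direction_eq hp
  obtain ⟨η, hη, hηq⟩ := exists_direction_eq hq
  refine ⟨θ, η, hθ, hη, ?_⟩
  rw [hθp, hηq, two_smul]
  abel

/-! ### Approximation of short curves by curves parametrized by arc length -/

theorem intervalIntegrable_of_bounded {f : ℝ → R3} (hf : StronglyMeasurable f) {C : ℝ}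
    (hC : ∀ s, ‖f s‖ ≤ C) (a b : ℝ) : IntervalIntegrable f volume a b :=
  (intervalIntegrable_const (c := C)).mono_fun hf.aestronglyMeasurable
    (Eventually.of_forall fun s => (hC s).trans (le_abs_self C))

/-- On each cell of length `τ` the mean of `g` lies in the unit ball, hence is the midpoint of two
unit vectors. Following each of them on half the cell reproduces the integral of `g` there, so the
primitives agree at the nodes. Between nodes they drift by at most `2 * τ`, since the integrands
differ by at most `2`. -/
theorem exists_direction_step {g : ℝ → R3} (hgm : StronglyMeasurable g) (hg : ∀ s, ‖g s‖ ≤ 1)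
    {τ : ℝ} (hτ : 0 < τ) :
    ∃ θ : ℝ → ℝ × ℝ, StronglyMeasurable θ ∧ (∀ s, ‖θ s‖ ≤ 4) ∧
      ∀ s, 0 ≤ s → ‖(∫ t in (0 : ℝ)..s, direction (θ t)) - ∫ t in (0 : ℝ)..s, g t‖ ≤ 2 * τ := by
  set m : ℕ → R3 := fun k => τ⁻¹ • ∫ t in (k * τ)..((k + 1 : ℕ) * τ), g t with hm
  have hlen : ∀ k : ℕ, ((k + 1 : ℕ) * τ) - k * τ = τ := fun k => by push_cast; ring
  have hm1 : ∀ k, ‖m k‖ ≤ 1 := by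
    intro k
    have h1 := intervalIntegral.norm_integral_le_of_norm_le_const (a := k * τ)
      (b := (k + 1 : ℕ) * τ) (f := g) (C := 1) fun s _ => hg s
    rw [hlen, abs_of_pos hτ, one_mul] at h1
    rw [hm, norm_smul, norm_inv, Real.norm_of_nonneg hτ.le, inv_mul_le_iff₀ hτ, mul_one]
    exact h1
  choose θ₀ θ₁ h₀ h₁ hadd using fun k => exists_direction_add_eq (hm1 k)
  -- The ceiling minus one makes the cells half-open on the left, matching interval integrals;
  -- truncated subtraction assigns index `0` to `s ≤ 0`, where nothing is claimed about the
  -- primitives.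
  set idx : ℝ → ℕ := fun s => ⌈s / τ⌉₊ - 1 with hidx
  have idxm : Measurable idx :=
    (Measurable.of_discrete (f := fun k : ℕ => k - 1)).comp
      (Nat.measurable_ceil.comp (measurable_id.div_const τ))
  set θ : ℝ → ℝ × ℝ := fun s => if s ≤ idx s * τ + τ / 2 then θ₀ (idx s) else θ₁ (idx s) with hθ
  have hθm : Measurable θ := by
    refine Measurable.ite ?_ ((Measurable.of_discrete (f := θ₀)).comp idxm)
      ((Measurable.of_discrete (f := θ₁)).comp idxm)
    refine measurableSet_le measurable_id (Measurable.add_const (Measurable.mul_const ?_ τ) _)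
    exact (Measurable.of_discrete (f := fun k : ℕ => (k : ℝ))).comp idxm
  have hidx_eq : ∀ (k : ℕ) (s : ℝ), s ∈ Ioc (k * τ) ((k + 1 : ℕ) * τ) → idx s = k := by
    intro k s hs
    have h1 : ⌈s / τ⌉₊ = k + 1 := by
      rw [Nat.ceil_eq_iff (by simp)]
      constructor
      · rw [lt_div_iff₀ hτ]; simpa using hs.1
      · rw [div_le_iff₀ hτ]; exact hs.2
    simp [hidx, h1]
  have hdm : StronglyMeasurable fun s => direction (θ s) :=
    (contDiff_direction.continuous.measurable.comp hθm).stronglyMeasurable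
  have id1 : ∀ a b, IntervalIntegrable (fun s => direction (θ s)) volume a b :=
    intervalIntegrable_of_bounded hdm fun s => (norm_direction _).le
  have id2 : ∀ a b, IntervalIntegrable g volume a b := intervalIntegrable_of_bounded hgm hg
  have idD : ∀ a b, IntervalIntegrable (fun s => direction (θ s) - g s) volume a b := fun a b =>
    (id1 a b).sub (id2 a b)
  have period : ∀ k : ℕ, ∫ s in (k * τ)..((k + 1 : ℕ) * τ), (direction (θ s) - g s) = 0 := by
    intro k
    have hk : ((k + 1 : ℕ) * τ) = k * τ + τ := by push_cast; ring
    have e1 : ∫ s in (k * τ)..(k * τ + τ / 2), direction (θ s) = (τ / 2) • direction (θ₀ k) := by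
      have : ∫ s in (k * τ)..(k * τ + τ / 2), direction (θ s)
          = ∫ s in (k * τ)..(k * τ + τ / 2), direction (θ₀ k) := by
        rw [intervalIntegral.integral_of_le (by linarith), intervalIntegral.integral_of_le (by linarith)]
        refine setIntegral_congr_fun measurableSet_Ioc fun s hs => ?_
        have hi := hidx_eq k s ⟨hs.1, by rw [hk]; linarith [hs.2]⟩
        simp only [hθ, hi, if_pos hs.2]
      rw [this, intervalIntegral.integral_const]
      congr 1
      ring
    have e2 : ∫ s in (k * τ + τ / 2)..(k * τ + τ), direction (θ s) = (τ / 2) • direction (θ₁ k) := by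
      have : ∫ s in (k * τ + τ / 2)..(k * τ + τ), direction (θ s)
          = ∫ s in (k * τ + τ / 2)..(k * τ + τ), direction (θ₁ k) := by
        rw [intervalIntegral.integral_of_le (by linarith), intervalIntegral.integral_of_le (by linarith)]
        refine setIntegral_congr_fun measurableSet_Ioc fun s hs => ?_
        have hi := hidx_eq k s ⟨by linarith [hs.1], by rw [hk]; exact hs.2⟩
        simp only [hθ, hi, if_neg (not_le.2 hs.1)]
      rw [this, intervalIntegral.integral_const]
      congr 1
      ring
    rw [intervalIntegral.integral_sub (id1 _ _) (id2 _ _)]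
    have e3 : ∫ s in (k * τ)..((k + 1 : ℕ) * τ), direction (θ s)
        = ∫ s in (k * τ)..((k + 1 : ℕ) * τ), g s := by
      rw [hk, ← intervalIntegral.integral_add_adjacent_intervals (id1 _ (k * τ + τ / 2)) (id1 _ _),
        e1, e2, ← smul_add, hadd, ← hk]
      simp only [hm, smul_smul]
      rw [show τ / 2 * (2 * τ⁻¹) = 1 by field_simp, one_smul]
    rw [e3, sub_self]
  have nodes : ∀ k : ℕ, ∫ s in (0 : ℝ)..(k * τ), (direction (θ s) - g s) = 0 := by
    intro k
    induction k with
    | zero => simp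
    | succ k ih =>
      rw [← intervalIntegral.integral_add_adjacent_intervals (idD _ (k * τ)) (idD _ _), ih, period,
        add_zero]
  refine ⟨θ, hθm.stronglyMeasurable, fun s => ?_, fun s hs => ?_⟩
  · simp only [hθ]
    split_ifs
    · exact h₀ _
    · exact h₁ _
  · rw [← intervalIntegral.integral_sub (id1 _ _) (id2 _ _)]
    set k := ⌊s / τ⌋₊ with hk
    have hk1 : k * τ ≤ s := by
      rw [← le_div_iff₀ hτ]; exact Nat.floor_le (by positivity)
    have hk2 : s < (k + 1) * τ := by
      rw [← div_lt_iff₀ hτ]; exact Nat.lt_floor_add_one _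
    rw [← intervalIntegral.integral_add_adjacent_intervals (idD 0 (k * τ)) (idD _ _), nodes, zero_add]
    have h1 := intervalIntegral.norm_integral_le_of_norm_le_const (a := k * τ) (b := s)
      (f := fun s => direction (θ s) - g s) (C := 2) fun t _ =>
        (norm_sub_le _ _).trans (by rw [norm_direction]; linarith [hg t])
    refine h1.trans ?_
    rw [abs_of_nonneg (by linarith)]
    linarith

/-- Smoothing the angles, not the tangents, keeps unit length. Smooth functions are dense in `L¹`:
an `L¹` error `ε / 8` in the angles costs `ε / 2` in the primitive by the Lipschitz constant `4`,
and the step approximation with `τ = ε / 4` costs the other half. -/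
theorem exists_smooth_direction {g : ℝ → R3} (hgm : StronglyMeasurable g) (hg : ∀ s, ‖g s‖ ≤ 1)
    (L : ℝ) {ε : ℝ} (hε : 0 < ε) :
    ∃ θ : ℝ → ℝ × ℝ, ContDiff ℝ ∞ θ ∧
      ∀ s ∈ Icc 0 L, ‖(∫ t in (0 : ℝ)..s, direction (θ t)) - ∫ t in (0 : ℝ)..s, g t‖ ≤ ε := by
  obtain ⟨η, hηm, hη4, hη⟩ := exists_direction_step hgm hg (τ := ε / 4) (by positivity)
  have hmem : MemLp ((Icc 0 L).indicator η) 1 := by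
    rw [memLp_indicator_iff_restrict measurableSet_Icc]
    exact MemLp.of_bound hηm.aestronglyMeasurable 4 (Eventually.of_forall hη4)
  obtain ⟨θ, -, hθ, hle⟩ := hmem.exist_eLpNorm_sub_le (by simp) le_rfl (ε := ε / 8) (by positivity)
  refine ⟨θ, hθ, fun s hs => ?_⟩
  have i1 : IntervalIntegrable (fun t => direction (θ t)) volume 0 s :=
    (contDiff_direction.continuous.comp hθ.continuous).intervalIntegrable _ _
  have i2 : IntervalIntegrable (fun t => direction (η t)) volume 0 s :=
    intervalIntegrable_of_bounded (contDiff_direction.continuous.comp_stronglyMeasurable hηm)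
      (fun t => (norm_direction _).le) _ _
  have h1 : ‖(∫ t in (0 : ℝ)..s, direction (θ t)) - ∫ t in (0 : ℝ)..s, direction (η t)‖ ≤ ε / 2 := by
    rw [← intervalIntegral.integral_sub i1 i2, ← ENNReal.ofReal_le_ofReal_iff (by positivity),
      ofReal_norm, intervalIntegral.integral_of_le hs.1]
    refine (enorm_integral_le_lintegral_enorm _).trans ?_
    calc ∫⁻ t in Ioc 0 s, ‖direction (θ t) - direction (η t)‖ₑ
        ≤ ∫⁻ t in Ioc 0 s, 4 * ‖((Icc 0 L).indicator η - θ) t‖ₑ := by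
          refine setLIntegral_mono' measurableSet_Ioc fun t ht => ?_
          have ht' : t ∈ Icc 0 L := ⟨ht.1.le, ht.2.trans hs.2⟩
          rw [Pi.sub_apply, indicator_of_mem ht', ← ofReal_norm, ← ofReal_norm]
          have := norm_direction_sub_le (θ t) (η t)
          rw [norm_sub_rev (η t), show (4 : ℝ≥0∞) = ENNReal.ofReal 4 by simp,
            ← ENNReal.ofReal_mul (by norm_num)]
          exact ENNReal.ofReal_le_ofReal this
      _ = 4 * ∫⁻ t in Ioc 0 s, ‖((Icc 0 L).indicator η - θ) t‖ₑ :=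
          lintegral_const_mul' _ _ (by simp)
      _ ≤ 4 * ∫⁻ t, ‖((Icc 0 L).indicator η - θ) t‖ₑ := by
          gcongr
          exact Measure.restrict_le_self
      _ ≤ 4 * ENNReal.ofReal (ε / 8) := by
          gcongr
          rwa [← eLpNorm_one_eq_lintegral_enorm]
      _ = ENNReal.ofReal (ε / 2) := by
          rw [show (4 : ℝ≥0∞) = ENNReal.ofReal 4 by simp, ← ENNReal.ofReal_mul (by norm_num)]
          congr 1
          ring
  have h2 := hη s hs.1
  calc _ = ‖((∫ t in (0 : ℝ)..s, direction (θ t)) - ∫ t in (0 : ℝ)..s, direction (η t))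
        + ((∫ t in (0 : ℝ)..s, direction (η t)) - ∫ t in (0 : ℝ)..s, g t)‖ := by
        congr 1; abel
    _ ≤ ε / 2 + 2 * (ε / 4) := (norm_add_le _ _).trans (add_le_add h1 h2)
    _ = ε := by ring

/-- A weakly differentiable function on an interval is the primitive of its weak derivative. -/
theorem HasWeakDeriv.exists_ae_eq_integral {L : ℝ} (hL : 0 < L) {v g : ℝ → R3}
    (hv : IntegrableOn v (Ioo 0 L)) (hgm : StronglyMeasurable g) (hg : ∀ s, ‖g s‖ ≤ 1)
    (h : HasWeakDeriv (Ioo 0 L) 1 v g) :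
    ∃ c : R3, ∀ᵐ s ∂volume.restrict (Ioo 0 L), v s = c + ∫ t in (0 : ℝ)..s, g t := by
  set u := hv.aestronglyMeasurable.mk v with hu
  have huv : v =ᵐ[volume.restrict (Ioo 0 L)] u := hv.aestronglyMeasurable.ae_eq_mk
  have hum : StronglyMeasurable u := hv.aestronglyMeasurable.stronglyMeasurable_mk
  have hui : IntegrableOn u (Ioo 0 L) := hv.congr huv
  have hgi : IntegrableOn g (Ioo 0 L) :=
    Measure.integrableOn_of_bounded (M := 1) (by simp) hgm.aestronglyMeasurable
      (Eventually.of_forall hg)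
  have hug : HasWeakDeriv (Ioo 0 L) 1 u g := by
    intro φ hφ hc hs
    rw [← h φ hφ hc hs]
    refine integral_congr_ae ?_
    filter_upwards [huv] with s hs
    rw [hs]
  have ig : ∀ a b, IntervalIntegrable g volume a b := intervalIntegrable_of_bounded hgm hg
  set G : ℝ → R3 := fun s => ∫ t in (0 : ℝ)..s, g t with hG
  have hGc : Continuous G := intervalIntegral.continuous_primitive ig 0
  -- The translation formula shows that `d` has vanishing differences, so it defines an oscillation
  -- kernel of zero energy and the interval estimate forces it to be constant almost everywhere.
  set d : ℝ → R3 := fun s => u s - G s with hd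
  have hdm : Measurable d := hum.measurable.sub hGc.measurable
  have hosc : IsOscKernel (Ioo 0 L) (fun x y => ‖d x - d y‖ₑ ^ 2) 0 := by
    refine ⟨?_, fun x y => by rw [← enorm_neg, neg_sub], fun x y z => enorm_sub_sq_triangle _ _ _, ?_⟩
    · have h1 : Measurable fun q : ℝ × ℝ => d q.1 - d q.2 :=
        (hdm.comp measurable_fst).sub (hdm.comp measurable_snd)
      exact h1.enorm.pow_const 2
    · intro A w hA hw
      have h1 := HasWeakDeriv.linearCombination hui hgi hgi hug hug w 0
      have e : (w • (1 : ℝ) + (0 : ℝ) • (1 : ℝ)) = w := by simp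
      rw [e] at h1
      have h2 := h1.sub_translate_ae_eq isOpen_Ioo hui ((hgi.smul w).add (hgi.smul (0 : ℝ)))
        ((hgm.const_smul w).add (hgm.const_smul (0 : ℝ))) hA hw
      rw [mul_zero, nonpos_iff_eq_zero]
      refine lintegral_eq_zero_of_ae_eq_zero ?_
      rw [Filter.EventuallyEq, ae_restrict_iff' hA.measurableSet]
      filter_upwards [h2] with x hx hxA
      have h3 := hx hxA
      have h4 : ∫ t in (0 : ℝ)..1, (w • g (x + t • w) + (0 : ℝ) • g (x + t • w))
          = G (x + w) - G x := by
        simp only [zero_smul, add_zero, smul_eq_mul]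
        rw [intervalIntegral.integral_smul]
        simp_rw [mul_comm _ w]
        rw [intervalIntegral.smul_integral_comp_add_mul, hG,
          intervalIntegral.integral_interval_sub_left (ig _ _) (ig _ _)]
        simp
      have h5 : d x - d (x + w) = 0 := by
        have h3 := h3.trans h4
        simp only [hd]
        rw [show u x - G x - (u (x + w) - G (x + w)) = (G (x + w) - G x) - (u (x + w) - u x) by abel,
          h3, sub_self]
      simp [h5]
  obtain ⟨C, hC⟩ := oscBounded_Ioo L
  have key := hC _ _ hosc
  rw [mul_zero, nonpos_iff_eq_zero] at key
  have key := (lintegral_eq_zero_iff (hosc.measurable.lintegral_prod_right'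
    (ν := volume.restrict (Ioo 0 L)))).1 key
  have hne : volume.restrict (Ioo 0 L) ≠ 0 := by
    intro h0
    have : volume.restrict (Ioo 0 L) univ = 0 := by rw [h0]; rfl
    simp at this
    linarith
  have : NeBot (ae (volume.restrict (Ioo 0 L))) := ae_neBot.2 hne
  obtain ⟨y, hy⟩ := key.exists
  have hy : ∫⁻ x in Ioo 0 L, ‖d y - d x‖ₑ ^ 2 = 0 := hy
  have hm : Measurable fun x => ‖d y - d x‖ₑ ^ 2 :=
    ((measurable_const.sub hdm).enorm).pow_const 2
  rw [lintegral_eq_zero_iff hm] at hy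
  refine ⟨d y, ?_⟩
  filter_upwards [hy, huv] with s h1 h2
  have h3 : d y - d s = 0 := by simpa using h1
  rw [h2, sub_eq_zero.1 h3]
  simp [hd, hG]

end CurvedRod

namespace CurvedRod

/-! ### The recovery family -/

/-- The rotation with columns `direction θ`, the unit vector of increasing longitude, and their
cross product. -/
noncomputable def angleFrame (θ : ℝ × ℝ) : M3 :=
  !![Real.cos θ.1 * Real.cos θ.2, -Real.sin θ.1, -(Real.cos θ.1 * Real.sin θ.2);
     Real.sin θ.1 * Real.cos θ.2, Real.cos θ.1, -(Real.sin θ.1 * Real.sin θ.2);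
     Real.sin θ.2, 0, Real.cos θ.2]

theorem angleFrame_mem_SO3 (θ : ℝ × ℝ) : angleFrame θ ∈ SO3 := by
  have h1 := Real.sin_sq_add_cos_sq θ.1
  have h2 := Real.sin_sq_add_cos_sq θ.2
  constructor
  · ext i j
    fin_cases i <;> fin_cases j <;>
      simp [angleFrame, Matrix.mul_apply, Fin.sum_univ_three] <;> grind
  · rw [angleFrame, Matrix.det_fin_three]
    simp
    grind

theorem frameVec_angleFrame_zero (θ : ℝ → ℝ × ℝ) (s : ℝ) :
    frameVec (fun s => angleFrame (θ s)) 0 s = direction (θ s) := by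
  ext i
  fin_cases i <;> rfl

theorem contDiff_frameVec_angleFrame {θ : ℝ → ℝ × ℝ} (hθ : ContDiff ℝ ∞ θ) (k : Fin 3) :
    ContDiff ℝ ∞ (frameVec (fun s => angleFrame (θ s)) k) := by
  have c1 := Real.contDiff_cos.comp hθ.fst
  have c2 := Real.contDiff_cos.comp hθ.snd
  have s1 := Real.contDiff_sin.comp hθ.fst
  have s2 := Real.contDiff_sin.comp hθ.snd
  rw [contDiff_euclidean]
  intro i
  fin_cases k <;> fin_cases i
  · exact c1.mul c2
  · exact s1.mul c2
  · exact s2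
  · exact s1.neg
  · exact c1
  · exact contDiff_const
  · exact (c1.mul s2).neg
  · exact (s1.mul s2).neg
  · exact c2

section

variable {L : ℝ} {γ : ℝ → R3} {R₀ : ℝ → M3} {D : Set R2} {W : ℝ → M3 → ℝ≥0∞}

/-- The comparison rotation is `R * Q.transpose`; the difference factors as `((S - R) - R *
Q.transpose * (B - Q)) * B⁻¹`. -/
theorem infDist_mul_inv_le {S B R Q : M3} (hR : R ∈ SO3) (hQ : Q ∈ SO3) (hB : B.det ≠ 0)
    {s b M : ℝ} (hs : ‖S - R‖ ≤ s) (hb : ‖B - Q‖ ≤ b) (hM : ‖B⁻¹‖ ≤ M) :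
    Metric.infDist (S * B⁻¹) SO3 ≤ (s + 2 * 2 * b) * M := by
  have hQt := transpose_mem_SO3 hQ
  refine (Metric.infDist_le_dist_of_mem (mul_mem_SO3 hR hQt)).trans ?_
  rw [dist_eq_norm]
  have e : S * B⁻¹ - R * Q.transpose = ((S - R) - R * Q.transpose * (B - Q)) * B⁻¹ := by
    have h1 : B * B⁻¹ = 1 := Matrix.mul_nonsing_inv _ (isUnit_iff_ne_zero.2 hB)
    have h2 : R * Q.transpose * Q = R := by rw [mul_assoc, hQ.1, mul_one]
    rw [mul_sub (R * Q.transpose), h2, sub_sub_sub_cancel_right, sub_mul, mul_assoc (R * Q.transpose),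
      h1, mul_one]
  rw [e]
  have h3 : ‖R * Q.transpose * (B - Q)‖ ≤ 2 * 2 * b := by
    refine (norm_mul_le_frobenius _ _).trans ?_
    gcongr
    refine (norm_mul_le_frobenius _ _).trans ?_
    gcongr
    · exact norm_le_two_of_mem_SO3 hR
    · exact norm_le_two_of_mem_SO3 hQt
  refine (norm_mul_le_frobenius _ _).trans ?_
  have h4 : 0 ≤ s + 2 * 2 * b := by
    have := (norm_nonneg _).trans hs
    have := (norm_nonneg _).trans hb
    positivity
  gcongr
  exact (norm_sub_le _ _).trans (add_le_add hs h3)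

/-- Both scaled gradients, of the deformed rod and of the reference rod, are within `O(h)` of
rotations, so their quotient is within `O(h)` of `SO3`; quadratic growth of `W` then gives `h ^ 2`.
-/
theorem exists_energy_upper_bound (hL : 0 < L) (hγ : IsFramedCurve L γ R₀)
    (hD : IsCrossSection D) (hW : IsEnergyDensity L W) {w : ℝ → R3} {R : ℝ → M3}
    (hR : ∀ s, R s ∈ SO3) (hRd : ∀ k, ContDiff ℝ 1 (frameVec R k))
    (hw : ∀ s, HasDerivAt w (frameVec R 0 s) s) :
    ∃ C : ℝ, ∃ h₀ > 0, ∀ h, 0 < h → h < h₀ → ∀ U : W12 (cyl L D),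
      (∀ i, W12.partialDeriv U i =ᵐ[volume.restrict (cyl L D)]
        fun z => fderiv ℝ (psi w R h) z (EuclideanSpace.single i 1)) →
      sobolevEnergy L D γ R₀ W h U ≤ ENNReal.ofReal (C * h ^ 2) := by
  obtain ⟨K, hK, M, h₀, hh₀, -, hreg⟩ := hγ.exists_gradPsi_regular hL hD
  obtain ⟨K', hK', hbd⟩ := exists_gradPsi_bound hL hD (fun k => (hRd k).contDiffOn)
    (fun s _ => hw s)
  obtain ⟨C₃, hC₃, hgrow⟩ := hW.growth
  refine ⟨C₃ * ((K' + 2 * 2 * K) * M) ^ 2 * 2 * L, h₀, hh₀, fun h hh hlt U hU => ?_⟩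
  have hgrow' := (hD.measurePreserving_axis L).quasiMeasurePreserving.ae hgrow
  have hpt : ∀ᵐ z ∂volume.restrict (cyl L D), energyDensity γ R₀ W h U z
      ≤ ENNReal.ofReal (C₃ * ((K' + 2 * 2 * K) * M) ^ 2 * 2 * h ^ 2) := by
    filter_upwards [hgrow', ae_restrict_mem (isOpen_cyl hD.isOpen).measurableSet, hU 0, hU 1, hU 2]
      with z hz hzc u0 u1 u2
    obtain ⟨hQ, hB, hdet, hdet2, hM⟩ := hreg h hh hlt z hzc
    have hS : scaledColumns h (fun i => W12.partialDeriv U i z) = gradPsi w R h z := by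
      unfold gradPsi
      congr 1
      funext i
      fin_cases i
      · exact u0
      · exact u1
      · exact u2
    have hd := infDist_mul_inv_le (hR (z 0)) hQ (by linarith) (hbd h hh z hzc) hB hM
    rw [energyDensity, hS]
    calc _ ≤ ENNReal.ofReal (C₃ * Metric.infDist (gradPsi w R h z * (gradPsi γ R₀ h z)⁻¹) SO3 ^ 2)
          * ENNReal.ofReal 2 := by
          gcongr
          exact hz _
      _ = ENNReal.ofReal (C₃ * Metric.infDist (gradPsi w R h z * (gradPsi γ R₀ h z)⁻¹) SO3 ^ 2 * 2) :=
          (ENNReal.ofReal_mul (by positivity)).symm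
      _ ≤ ENNReal.ofReal (C₃ * ((K' * h + 2 * 2 * (K * h)) * M) ^ 2 * 2) := by
          gcongr
          exact Metric.infDist_nonneg
      _ = _ := by
          congr 1
          ring
  rw [sobolevEnergy_eq]
  refine (lintegral_mono_ae hpt).trans ?_
  rw [setLIntegral_const, volume_cyl L hD, ← ENNReal.ofReal_mul (by positivity)]
  refine le_of_eq (congrArg _ ?_)
  ring

theorem exists_arcLength_approximation (hL : 0 < L) {v v' : ℝ → R3}
    (hv : MemLp v 2 (volume.restrict (Ioo 0 L))) (hv' : MemLp v' 2 (volume.restrict (Ioo 0 L)))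
    (h : HasWeakDeriv (Ioo 0 L) 1 v v') (hle : ∀ᵐ s ∂volume.restrict (Ioo 0 L), ‖v' s‖ ≤ 1)
    {ε : ℝ} (hε : 0 < ε) :
    ∃ (w : ℝ → R3) (R : ℝ → M3), (∀ s, R s ∈ SO3) ∧ (∀ k, ContDiff ℝ 1 (frameVec R k)) ∧
      (∀ s, HasDerivAt w (frameVec R 0 s) s) ∧
      ∀ᵐ s ∂volume.restrict (Ioo 0 L), ‖w s - v s‖ ≤ ε := by
  set g₀ := hv'.aestronglyMeasurable.mk v' with hg₀
  have hg₀m : StronglyMeasurable g₀ := hv'.aestronglyMeasurable.stronglyMeasurable_mk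
  -- Cutting off to zero outside `A` gives a measurable representative bounded by one everywhere, as
  -- the construction on cells requires.
  set A : Set ℝ := {s | ‖g₀ s‖ ≤ 1} with hA
  have hAm : MeasurableSet A := measurableSet_le hg₀m.norm.measurable measurable_const
  set g := A.indicator g₀ with hg
  have hgm : StronglyMeasurable g := hg₀m.indicator hAm
  have hg1 : ∀ s, ‖g s‖ ≤ 1 := fun s => by
    by_cases hs : s ∈ A
    · rw [hg, indicator_of_mem hs]; exact hs
    · rw [hg, indicator_of_notMem hs]; simp
  have hgv : v' =ᵐ[volume.restrict (Ioo 0 L)] g := by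
    filter_upwards [hv'.aestronglyMeasurable.ae_eq_mk, hle] with s h1 h2
    have hs : s ∈ A := by
      change ‖g₀ s‖ ≤ 1
      rw [hg₀, ← h1]; exact h2
    rw [hg, indicator_of_mem hs, h1]
  have hweak : HasWeakDeriv (Ioo 0 L) 1 v g := by
    intro φ hφ hc hs
    rw [h φ hφ hc hs]
    congr 1
    refine integral_congr_ae ?_
    filter_upwards [hgv] with s hs
    rw [hs]
  obtain ⟨c, hc⟩ := hweak.exists_ae_eq_integral hL (hv.integrable (by norm_num)) hgm hg1
  obtain ⟨θ, hθ, hθg⟩ := exists_smooth_direction hgm hg1 L hε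
  refine ⟨fun s => c + ∫ t in (0 : ℝ)..s, direction (θ t), fun s => angleFrame (θ s),
    fun s => angleFrame_mem_SO3 _,
    fun k => (contDiff_frameVec_angleFrame hθ k).of_le (by exact_mod_cast le_top), fun s => ?_, ?_⟩
  · rw [frameVec_angleFrame_zero]
    have hcont : Continuous fun t => direction (θ t) := contDiff_direction.continuous.comp hθ.continuous
    exact (intervalIntegral.integral_hasDerivAt_right (hcont.intervalIntegrable _ _)
      hcont.stronglyMeasurable.stronglyMeasurableAtFilter hcont.continuousAt).const_add c
  · filter_upwards [hc, ae_restrict_mem measurableSet_Ioo] with s h1 h2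
    rw [h1, add_sub_add_left_eq_sub]
    exact hθg s (Ioo_subset_Icc_self h2)

theorem contDiff_psi {w : ℝ → R3} {R : ℝ → M3} (hRd : ∀ k, ContDiff ℝ 1 (frameVec R k))
    (hw : ∀ s, HasDerivAt w (frameVec R 0 s) s) (h : ℝ) : ContDiff ℝ 1 (psi w R h) := by
  have hp : ∀ i : Fin 3, ContDiff ℝ 1 fun z : R3 => z i := fun i =>
    (EuclideanSpace.proj i : R3 →L[ℝ] ℝ).contDiff
  have hw1 : ContDiff ℝ 1 w := by
    rw [contDiff_one_iff_deriv]
    refine ⟨fun s => (hw s).differentiableAt, ?_⟩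
    rw [funext fun s => (hw s).deriv]
    exact (hRd 0).continuous
  exact ((hw1.comp (hp 0)).add ((contDiff_const.mul (hp 1)).smul ((hRd 1).comp (hp 0)))).add
    ((contDiff_const.mul (hp 2)).smul ((hRd 2).comp (hp 0)))

/-- Distance and energy are added into one quantity so that a single near-minimization can later
make both small. -/
theorem exists_approximate_recovery (hL : 0 < L) (hγ : IsFramedCurve L γ R₀)
    (hD : IsCrossSection D) (hW : IsEnergyDensity L W) {α : ℝ} (hα : α < 2) {x : L2 (cyl L D)}
    (hx : x ∈ limitClass L D) {ε : ℝ≥0∞} (hε : 0 < ε) :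
    ∀ᶠ h in 𝓝[>] (0 : ℝ), ∃ y : L2 (cyl L D),
      edist y x + scaledEnergy L D γ R₀ W α h y ≤ ε := by
  obtain ⟨v, v', hv, hv', hweak, hle, hxv⟩ := hx
  have hfin : IsFiniteMeasure (volume.restrict (cyl L D)) := ⟨by simp [volume_cyl L hD]⟩
  obtain ⟨ε', hε'0, hε'⟩ := ENNReal.lt_iff_exists_nnreal_btwn.1 (ENNReal.half_pos hε.ne')
  have hε'pos : (0 : ℝ) < ε' := by exact_mod_cast hε'0
  -- The factor between a uniform bound and the `L²` norm on `Ω`. Dividing by `m + 1` below keeps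
  -- the denominator positive and leaves a uniform error worth at most `ε' / 2`.
  set m : ℝ := (measureUnivNNReal (volume.restrict (cyl L D)) : ℝ) ^ (2 : ℝ≥0∞).toReal⁻¹ with hm
  have hm0 : 0 ≤ m := by positivity
  obtain ⟨w, R, hR, hRd, hw, hwv⟩ := exists_arcLength_approximation hL hv hv' hweak hle
    (ε := ε' / (2 * (m + 1))) (by positivity)
  obtain ⟨C, h₀, hh₀, hE⟩ := exists_energy_upper_bound hL hγ hD hW hR hRd hw
  obtain ⟨M, hM⟩ := (hD.isBounded_cyl L).exists_norm_le
  have lim1 : Tendsto (fun h : ℝ => m * (h * (2 * |M|)) + ε' / 2) (𝓝[>] 0) (𝓝 (ε' / 2)) := by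
    have : Continuous fun h : ℝ => m * (h * (2 * |M|)) + (ε' : ℝ) / 2 := by fun_prop
    have := this.tendsto 0
    simp only [zero_mul, mul_zero, zero_add] at this
    exact this.mono_left nhdsWithin_le_nhds
  have lim2 : Tendsto (fun h : ℝ => ENNReal.ofReal (C * h ^ (2 - α))) (𝓝[>] 0) (𝓝 0) := by
    have h1 : Tendsto (fun h : ℝ => C * h ^ (2 - α)) (𝓝[>] 0) (𝓝 (C * 0)) := by
      refine Tendsto.const_mul C ?_
      have := (Real.continuous_rpow_const (q := 2 - α) (by linarith)).tendsto 0
      rw [Real.zero_rpow (by linarith)] at this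
      exact this.mono_left nhdsWithin_le_nhds
    simpa using ENNReal.tendsto_ofReal h1
  filter_upwards [Ioo_mem_nhdsGT hh₀, lim1.eventually_lt_const (half_lt_self hε'pos),
    lim2.eventually_lt_const hε'0] with h hh l1 l2
  obtain ⟨U, hU, hUd⟩ := exists_W12_of_contDiff (L := L) hD (contDiff_psi hRd hw h)
  refine ⟨W12.toL2 U, ?_⟩
  have hdist : edist (W12.toL2 U) x ≤ ε' := by
    have hae : ∀ᵐ z ∂volume.restrict (cyl L D), ‖(W12.toL2 U - x : L2 (cyl L D)) z‖
        ≤ h * (2 * |M|) + ε' / (2 * (m + 1)) := by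
      have hwv' := (hD.measurePreserving_axis L).quasiMeasurePreserving.ae hwv
      filter_upwards [Lp.coeFn_sub (W12.toL2 U) x, hU, hxv, hwv',
        ae_restrict_mem (isOpen_cyl hD.isOpen).measurableSet] with z e1 e2 e3 e4 hzc
      rw [e1, Pi.sub_apply, e2, e3]
      have hz : ∀ i, |z i| ≤ |M| := fun i =>
        (PiLp.norm_apply_le z i).trans ((hM z hzc).trans (le_abs_self _))
      have hcol : ∀ k, ‖frameVec R k (z 0)‖ = 1 := fun k => norm_columnL_of_mem_SO3 (hR _) k
      have hterm : ∀ i k, ‖(h * z i) • frameVec R k (z 0)‖ ≤ h * |M| := fun i k => by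
        rw [norm_smul, hcol, mul_one, Real.norm_eq_abs, abs_mul, abs_of_pos hh.1]
        exact mul_le_mul_of_nonneg_left (hz i) hh.1.le
      have e5 : psi w R h z - v (z 0) = ((h * z 1) • frameVec R 1 (z 0)
          + (h * z 2) • frameVec R 2 (z 0)) + (w (z 0) - v (z 0)) := by
        rw [psi]; abel
      rw [e5]
      calc _ ≤ (h * |M| + h * |M|) + ε' / (2 * (m + 1)) :=
            (norm_add_le _ _).trans (add_le_add ((norm_add_le _ _).trans
              (add_le_add (hterm 1 1) (hterm 2 2))) e4)
        _ = _ := by ring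
    have hn := Lp.norm_le_of_ae_bound (by have := hh.1; positivity) hae
    rw [edist_dist, dist_eq_norm]
    refine ENNReal.ofReal_le_of_le_toReal (hn.trans ?_)
    rw [← hm, ENNReal.coe_toReal, mul_add]
    have h1 : m * (ε' / (2 * (m + 1))) ≤ ε' / 2 := by
      rw [mul_div_assoc', div_le_div_iff₀ (by positivity) (by norm_num)]
      nlinarith
    linarith
  have henergy : scaledEnergy L D γ R₀ W α h (W12.toL2 U) ≤ ε' := by
    have hpos : 0 < h ^ α := Real.rpow_pos_of_pos hh.1 α
    rw [scaledEnergy]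
    refine (ENNReal.div_le_iff (by simpa using hpos) ENNReal.ofReal_ne_top).2 ?_
    calc energy L D γ R₀ W h (W12.toL2 U) ≤ sobolevEnergy L D γ R₀ W h U :=
          iInf₂_le (f := fun (V : W12 (cyl L D)) (_ : W12.toL2 V = W12.toL2 U) =>
            sobolevEnergy L D γ R₀ W h V) U rfl
      _ ≤ ENNReal.ofReal (C * h ^ 2) := hE h hh.1 hh.2 U hUd
      _ = ENNReal.ofReal (C * h ^ (2 - α)) * ENNReal.ofReal (h ^ α) := by
          rw [← ENNReal.ofReal_mul' hpos.le, mul_assoc, ← Real.rpow_add hh.1]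
          simp
      _ ≤ _ := by gcongr
  calc _ ≤ (ε' : ℝ≥0∞) + ε' := add_le_add hdist henergy
    _ ≤ ε / 2 + ε / 2 := add_le_add hε'.le hε'.le
    _ = ε := ENNReal.add_halves ε

/-- A recovery family from approximate ones, by nearly minimizing the distance plus the energy. -/
theorem exists_recovery_of_approximate {X : Type*} [PseudoEMetricSpace X] {F : ℝ → X → ℝ≥0∞} {x : X}
    (hF : ∀ ε : ℝ≥0∞, 0 < ε → ∀ᶠ h in 𝓝[>] (0 : ℝ), ∃ y, edist y x + F h y ≤ ε) :
    ∃ u : ℝ → X, Tendsto u (𝓝[>] 0) (𝓝 x) ∧ limsup (fun h => F h (u h)) (𝓝[>] 0) ≤ 0 := by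
  -- The hypothesis says precisely that this infimum tends to zero. A slack `h` makes
  -- near-minimizers exist when it is finite; where it is infinite any choice will do.
  set m : ℝ → ℝ≥0∞ := fun h => ⨅ y, edist y x + F h y with hm
  have hmin : ∀ h : ℝ, ∃ y, 0 < h → edist y x + F h y ≤ m h + ENNReal.ofReal h := by
    intro h
    by_cases htop : m h = ⊤
    · exact ⟨x, fun _ => by simp [htop]⟩
    by_cases hh : 0 < h
    · have : m h < m h + ENNReal.ofReal h :=
        ENNReal.lt_add_right htop (by simpa using hh)
      obtain ⟨y, hy⟩ := iInf_lt_iff.1 this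
      exact ⟨y, fun _ => hy.le⟩
    · exact ⟨x, fun h0 => absurd h0 hh⟩
  choose u hu using hmin
  have hm0 : Tendsto m (𝓝[>] 0) (𝓝 0) := by
    rw [ENNReal.tendsto_nhds_zero]
    intro ε hε
    filter_upwards [hF ε hε] with h ⟨y, hy⟩
    exact (iInf_le _ y).trans hy
  have hsum : Tendsto (fun h => m h + ENNReal.ofReal h) (𝓝[>] 0) (𝓝 0) := by
    have h1 : Tendsto (fun h : ℝ => ENNReal.ofReal h) (𝓝[>] 0) (𝓝 0) := by
      have := ENNReal.continuous_ofReal.tendsto 0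
      rw [ENNReal.ofReal_zero] at this
      exact this.mono_left nhdsWithin_le_nhds
    simpa using hm0.add h1
  have hle : ∀ᶠ h in 𝓝[>] (0 : ℝ), edist (u h) x + F h (u h) ≤ m h + ENNReal.ofReal h := by
    filter_upwards [self_mem_nhdsWithin] with h hh
    exact hu h hh
  refine ⟨u, ?_, ?_⟩
  · rw [tendsto_iff_edist_tendsto_0]
    exact tendsto_of_tendsto_of_tendsto_of_le_of_le' tendsto_const_nhds hsum
      (Eventually.of_forall fun _ => zero_le) (hle.mono fun h hh => le_self_add.trans hh)
  · have : Tendsto (fun h => F h (u h)) (𝓝[>] 0) (𝓝 0) :=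
      tendsto_of_tendsto_of_tendsto_of_le_of_le' tendsto_const_nhds hsum
        (Eventually.of_forall fun _ => zero_le) (hle.mono fun h hh => le_add_self.trans hh)
    exact this.limsup_eq.le

theorem exists_recovery_family (hL : 0 < L) (hγ : IsFramedCurve L γ R₀)
    (hD : IsCrossSection D) (hW : IsEnergyDensity L W) {α : ℝ} (hα : α < 2) (x : L2 (cyl L D)) :
    ∃ u : ℝ → L2 (cyl L D), Tendsto u (𝓝[>] 0) (𝓝 x) ∧
      limsup (fun h => scaledEnergy L D γ R₀ W α h (u h)) (𝓝[>] 0) ≤ limitEnergy L D x := by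
  by_cases hx : x ∈ limitClass L D
  · obtain ⟨u, hu, hlim⟩ := exists_recovery_of_approximate
      (F := scaledEnergy L D γ R₀ W α) (x := x) fun ε hε =>
        exists_approximate_recovery hL hγ hD hW hα hx hε
    exact ⟨u, hu, hlim.trans zero_le⟩
  · exact ⟨fun _ => x, tendsto_const_nhds, by simp [limitEnergy, hx]⟩

end

end CurvedRod

theorem mainTheorem5
    (L : ℝ) (hL : 0 < L)
    (γ : ℝ → CurvedRod.R3) (R₀ : ℝ → CurvedRod.M3) (hγ : CurvedRod.IsFramedCurve L γ R₀)
    (D : Set CurvedRod.R2) (hD : CurvedRod.IsCrossSection D)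
    (W : ℝ → CurvedRod.M3 → ℝ≥0∞) (hW : CurvedRod.IsEnergyDensity L W)
    (α : ℝ) (hα₀ : 0 < α) (hα₂ : α < 2) :
    (∀ (h : ℕ → ℝ) (v : ℕ → CurvedRod.L2 (CurvedRod.cyl L D)) (c : ℝ≥0),
      (∀ j, 0 < h j) → Tendsto h atTop (𝓝 0) →
      (∀ j, CurvedRod.scaledEnergy L D γ R₀ W α (h j) (v j) ≤ c) →
      ∃ (σ : ℕ → ℕ) (a : ℕ → CurvedRod.R3)
        (U : ℕ → CurvedRod.W12 (CurvedRod.cyl L D)) (V : CurvedRod.W12 (CurvedRod.cyl L D)),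
        StrictMono σ ∧
        (∀ j, CurvedRod.W12.toL2 (U j) =ᵐ[volume.restrict (CurvedRod.cyl L D)] fun z => v (σ j) z - a j) ∧
        CurvedRod.W12.TendstoWeakly U V ∧
        CurvedRod.W12.toL2 V ∈ CurvedRod.limitClass L D) ∧
    CurvedRod.GammaTendsto (𝓝[>] (0 : ℝ)) (CurvedRod.scaledEnergy L D γ R₀ W α)
      (CurvedRod.limitEnergy L D) := by
  refine ⟨fun h v c hpos hlim hE => CurvedRod.compactness hL hγ hD hW hα₀ h v c hpos hlim hE,
    fun x u hu => CurvedRod.liminf_inequality hL hγ hD hW hα₀ x u hu,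
    fun x => CurvedRod.exists_recovery_family hL hγ hD hW hα₂ x⟩
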